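/- Let $s\in\{0,1\}$, $L,K\ge 0$, $m_1,\dots,m_K\ge 1$, $m_0\in\mathbb Z$ with $m_0=0$ if $s=0$, and $m_0\ge 1$ or $m_0=-1$ if $s=1$; assume $n:=L-\sum_{j=0}^K m_j\ge 1$. Let $\mathcal A_M$ be the manifold of the functions $$\lambda(p)=\frac{\prod_{i=1}^L(p-a_i)}{p^{m_0}\prod_{j=1}^K(p-v_j)^{m_j}},\qquad \sum_i a_i=\sum_j m_jv_j\ \text{ if } s=0,$$ with coordinates $a_i,v_j$, where the $a_i$ are distinct, the $v_j$ are distinct, $a_i\ne v_j$, and, if $s=1$, all $a_i,v_j\neq 0$. It has dimension $N=K+L+s-1$; its tangent vectors at $\lambda$ are the functions $X=D_\xi\lambda$. Put $v_0=0$ and $\Gamma=\{\infty,\,v_k\ (1-s\le k\le K)\}$. For $\nu\in\Gamma$ let $\mathrm{tr}_\nu f=\epsilon\,\mathrm{res}_{p=\nu}(p^{-s}f)$, with $\epsilon=-1$ for $\nu=\infty$ and $\epsilon=1$ otherwise. A function $\alpha\in\mathcal A=\mathbb C[p,p^{-1},(p-a_i)^{-1},(p-v_j)^{-1}]$ represents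 at $\nu$ the covector $X\mapsto\mathrm{tr}_\nu(X\alpha)$. The contravariant metric defined at $\nu$ is $\eta^*(\alpha,\beta)=\mathrm{tr}_\nu(\alpha\circ\beta)$, where $$\alpha\circ\beta=p^s[\lambda_p\alpha]^\nu_{\ge0}\,\beta+p^s\alpha\,[\lambda_p\beta]^\nu_{\ge0}-p^s\lambda_p\alpha\beta .$$ Here $[\,\cdot\,]^\nu$ denotes truncation of the Laurent expansion in powers of $p$ at $\infty$ and of $p-\nu$ at finite $\nu$. Near every point of $\mathcal A_M$ there are continuous branches of the roots and logarithms used below, and for all such branches on any open subset of $\mathcal A_M$ the following holds. (a) For every $\nu\in\Gamma$, $\eta^*$ is a well-defined (independent of the representatives in $\mathcal A$), symmetric, nondegenerate contravariant metric, and the following $N$ analytic functions are local flat coordinates for it, i.e. they form local coordinates near each point, their differentials are covariantly constant for the Levi-Civita connection, and the components of $\eta^*$ in them are constant: $$t^i_\infty=\frac{1}{1-\frac in}\,\mathrm{tr}_\infty\lambda^{1-\frac in}\quad(1\le i\le n-1),$$ and, for $1-s\le k\le K$ and integers $0\le j\le m_k$ (no such $j$ if $m_k=-1$), $$t^j_{v_k}=\begin{cases}\dfrac{1}{1-\frac{j}{m_k}}\,\mathrm{tr}_{v_k}\lambda^{1-\frac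 j{m_k}}, & 0\le j<m_k,\\[2mm] \mathrm{tr}_{v_k}\log\lambda+\frac{m_k}{n}\,\mathrm{tr}_\infty\log\lambda, & j=m_k.\end{cases}$$ Here $\lambda^{1/n}=p+\dots$ at $\infty$, and the last expression is understood as $$\mathrm{tr}_{v_k}\log[(p-v_k)^{m_k}\lambda]+\frac{m_k}{n}\mathrm{tr}_\infty\log[(p-v_k)^{-n}\lambda]+m_k\sum_{1-s\le l\le K,\ l\ne k}\mathrm{tr}_{v_l}\log(p-v_k).$$ (b) At each point their differentials are represented, at $\infty$ and at $v_k$ respectively, by $$dt^i_\infty=[\lambda^{-\frac in}]^\infty_{\ge 1-n}\in p^{1-n}\,\mathbb C_{N-1}[p],\qquad dt^j_{v_k}=[\lambda^{-\frac j{m_k}}]^{v_k}_{\le m_k}\in (p-v_k)^{m_k}\,\mathbb C_{N-1}[(p-v_k)^{-1}],$$ where $\mathbb C_{N-1}[x]$ is the space of polynomials in $x$ of degree at most $N-1$. -/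

import Mathlib

noncomputable section

namespace FlatCoord

open Polynomial

/-! ### Rational functions of `p`, expansions at points of the Riemann sphere, traces -/

/-- Points of the Riemann sphere. -/
inductive Place : Type
  | inf : Place
  | fin (c : ℂ) : Place

/-- The local parameter at a point, as a rational function: `p⁻¹` at `∞` and `p - c` at `c`. -/
def Place.unif : Place → RatFunc ℂ
  | .inf => RatFunc.X⁻¹
  | .fin c => RatFunc.X - RatFunc.C c

/-- The function `p` as a Laurent series in the local parameter `z`: `p = z⁻¹` at `∞`
and `p = c + z` at `c`. -/
def Place.pSeries : Place → LaurentSeries ℂ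
  | .inf => HahnSeries.single (-1) 1
  | .fin c => HahnSeries.C c + HahnSeries.single 1 1

/-- The Laurent expansion, in the local parameter at `ν`, of a rational function of `p`. -/
def Place.expand (ν : Place) (f : RatFunc ℂ) : LaurentSeries ℂ :=
  RatFunc.eval HahnSeries.C ν.pSeries f

/-- For a Laurent expansion `f = ∑ aᵢ zⁱ` at `ν` the rational function `∑_{i ≤ l} aᵢ zⁱ`.
So it is `[f]_{≥ -l}` at `∞` (where `z = p⁻¹`) and `[f]_{≤ l}` at a finite point. -/
def Place.trunc (ν : Place) (l : ℤ) (f : LaurentSeries ℂ) : RatFunc ℂ :=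
  ∑ i ∈ Finset.Icc f.order l, RatFunc.C (f.coeff i) * ν.unif ^ i

/-- The part `[f]^ν_{≥ 0}` of a rational function: at `∞` the part with nonnegative powers of `p`,
at a finite `c` what remains after removing the part with negative powers of `p - c`. -/
def Place.nonneg (ν : Place) (f : RatFunc ℂ) : RatFunc ℂ :=
  match ν with
  | .inf => Place.trunc .inf 0 (Place.expand .inf f)
  | .fin c => f - Place.trunc (.fin c) (-1) (Place.expand (.fin c) f)

/-- The trace form `tr_ν f = ε res_{p=ν} (p^{-s} f)`, `ε = -1` at `∞` and `ε = 1` elsewhere: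
it is the coefficient of `p⁻¹`, respectively of `(p - c)⁻¹`, in the expansion of `p^{-s} f`. -/
def Place.tr (s : ℕ) (ν : Place) (f : LaurentSeries ℂ) : ℂ :=
  match ν with
  | .inf => (Place.pSeries .inf ^ (-(s : ℤ)) * f).coeff 1
  | .fin c => (Place.pSeries (.fin c) ^ (-(s : ℤ)) * f).coeff (-1)

/-- The derivative `∂f/∂p` of a rational function. -/
def pDeriv (f : RatFunc ℂ) : RatFunc ℂ :=
  (algebraMap ℂ[X] (RatFunc ℂ) (derivative f.num) * algebraMap ℂ[X] (RatFunc ℂ) f.denom -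
      algebraMap ℂ[X] (RatFunc ℂ) f.num * algebraMap ℂ[X] (RatFunc ℂ) (derivative f.denom)) /
    algebraMap ℂ[X] (RatFunc ℂ) f.denom ^ 2

/-- `l` is a logarithm of the power series `u` with `u(0) ≠ 0`: it is a power series with
`l' = u' / u` and `exp (l(0)) = u(0)`. -/
structure IsLog (u l : LaurentSeries ℂ) : Prop where
  coeff_neg : ∀ i < 0, l.coeff i = 0
  deriv_eq : LaurentSeries.derivative ℂ l * u = LaurentSeries.derivative ℂ u
  exp_eq : Complex.exp (l.coeff 0) = u.coeff 0

/-! ### The manifold of meromorphic functions -/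

/-- Admissible discrete data: `s`, the number `L` of simple zeros, the number `K` of movable poles,
the pole orders `m` at these, the pole order `m0` at `0` (a simple zero if `m0 = -1`) and the pole
order `n` at `∞`. -/
structure Shape : Type where
  s : ℕ
  L : ℕ
  K : ℕ
  n : ℕ
  m0 : ℤ
  m : Fin K → ℕ
  s_eq : s = 0 ∨ s = 1
  m0_zero : s = 0 → m0 = 0
  m0_one : s = 1 → 1 ≤ m0 ∨ m0 = -1
  m_pos : ∀ j, 1 ≤ m j
  n_pos : 1 ≤ n
  n_eq : (n : ℤ) = L - (m0 + ∑ j, (m j : ℤ))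

namespace Shape

variable (D : Shape)

/-- The dimension `N = K + L + s - 1` (natural subtraction is harmless, as `K + L + s ≥ 1`). -/
def N : ℕ := D.K + D.L + D.s - 1

/-- The space of parameters `(a, v)`, cut out by `∑ aᵢ = ∑ mⱼ vⱼ` if `s = 0`. -/
def Param : Submodule ℂ ((Fin D.L → ℂ) × (Fin D.K → ℂ)) where
  carrier := {x | D.s = 0 → ∑ i, x.1 i = ∑ j, (D.m j : ℂ) * x.2 j}
  zero_mem' := by intro _; simp
  add_mem' := by
    intro x y hx hy h
    simp [Finset.sum_add_distrib, mul_add, hx h, hy h]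
  smul_mem' := by
    intro c x hx h
    have := hx h
    simp only [Prod.smul_fst, Prod.smul_snd, Pi.smul_apply, smul_eq_mul]
    rw [← Finset.mul_sum, this, Finset.mul_sum]
    exact Finset.sum_congr rfl fun j _ => by ring

variable {D}

/-- The zero `aᵢ`. -/
def a (x : D.Param) (i : Fin D.L) : ℂ := x.1.1 i

/-- The pole `vⱼ`. -/
def v (x : D.Param) (j : Fin D.K) : ℂ := x.1.2 j

variable (D)

/-- The manifold, as an open subset of the parameter space: the zeros `aᵢ` are simple and the pole
orders are exactly the prescribed ones. -/
def M : Set D.Param :=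
  {x | Function.Injective (a x) ∧ Function.Injective (v x) ∧ (∀ i j, a x i ≠ v x j) ∧
    (D.s = 1 → (∀ i, a x i ≠ 0) ∧ ∀ j, v x j ≠ 0)}

variable {D}

/-- The meromorphic function `λ = ∏ (p - aᵢ) / (p ^ m₀ ∏ (p - vⱼ) ^ mⱼ)`. -/
def lam (x : D.Param) : RatFunc ℂ :=
  (∏ i, (RatFunc.X - RatFunc.C (a x i))) /
    (RatFunc.X ^ D.m0 * ∏ j, (RatFunc.X - RatFunc.C (v x j)) ^ D.m j)

/-- The tangent vector at `λ` in the direction `ξ`, i.e. `∑ ξ(aᵢ) ∂λ/∂aᵢ + ∑ ξ(vⱼ) ∂λ/∂vⱼ`, where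
`∂λ/∂aᵢ = -λ / (p - aᵢ)` and `∂λ/∂vⱼ = mⱼ λ / (p - vⱼ)`. -/
def tangent (x ξ : D.Param) : RatFunc ℂ :=
  ∑ i, RatFunc.C (a ξ i) * (-lam x / (RatFunc.X - RatFunc.C (a x i))) +
    ∑ j, RatFunc.C (v ξ j) *
      (RatFunc.C (D.m j : ℂ) * lam x / (RatFunc.X - RatFunc.C (v x j)))

/-- The algebra `ℂ[p, p⁻¹, (p - aᵢ)⁻¹, (p - vⱼ)⁻¹]`. -/
def alg (x : D.Param) : Subalgebra ℂ (RatFunc ℂ) :=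
  Algebra.adjoin ℂ ({RatFunc.X, RatFunc.X⁻¹} ∪
    (Set.range fun i => (RatFunc.X - RatFunc.C (a x i))⁻¹) ∪
    Set.range fun j => (RatFunc.X - RatFunc.C (v x j))⁻¹)

variable (D)

/-- Labels of the finite marked points: `some j` stands for `vⱼ`; `none` stands for `v₀ = 0` and is
present only if `s = 1`. -/
abbrev FinPole : Type := {q : Option (Fin D.K) // q = none → D.s = 1}

/-- Labels of all marked points; `none` stands for `∞`. -/
abbrev Marked : Type := Option D.FinPole

variable {D}

/-- The pole order at a finite marked point. -/
def deg (q : D.FinPole) : ℤ :=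
  match q.1 with
  | none => D.m0
  | some j => D.m j

/-- The position of a finite marked point. -/
def pos (x : D.Param) (q : D.FinPole) : ℂ :=
  match q.1 with
  | none => 0
  | some j => v x j

/-- The position of a marked point on the Riemann sphere. -/
def place (x : D.Param) : D.Marked → Place
  | none => .inf
  | some q => .fin (pos x q)

/-! ### Cotangent spaces and the contravariant metric -/

/-- The function `α` represents, by means of the trace form at `ν`, the covector `ω` at `λ`:
`⟨ω, ξ⟩ = tr_ν (α X)` for each tangent vector `ξ`, where `X` is the function `D_ξ λ`. -/
def Represents (ν : D.Marked) (x : D.Param) (α : RatFunc ℂ) (ω : D.Param →L[ℂ] ℂ) : Prop :=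
  ∀ ξ, ω ξ = (place x ν).tr D.s ((place x ν).expand (α * tangent x ξ))

/-- The representatives of covectors with respect to the trace at a marked point:
`p^{1-n} ℂ_{N-1}[p]` at `∞` and `(p - ν)^m ℂ_{N-1}[(p - ν)⁻¹]` at a finite `ν` of degree `m`. -/
def cotangentRep (x : D.Param) : D.Marked → Set (RatFunc ℂ)
  | none => {α | ∃ f ∈ degreeLT ℂ D.N,
      α = RatFunc.X ^ (1 - (D.n : ℤ)) * aeval (RatFunc.X : RatFunc ℂ) f}
  | some q => {α | ∃ f ∈ degreeLT ℂ D.N,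
      α = (RatFunc.X - RatFunc.C (pos x q)) ^ deg q *
        aeval ((RatFunc.X - RatFunc.C (pos x q))⁻¹ : RatFunc ℂ) f}

/-- The multiplication
`α ∘ β = p^s [λ_p α]_{≥0} β + p^s α [λ_p β]_{≥0} - p^s λ_p α β` at a marked point. -/
def mul (ν : D.Marked) (x : D.Param) (α β : RatFunc ℂ) : RatFunc ℂ :=
  RatFunc.X ^ D.s * (place x ν).nonneg (pDeriv (lam x) * α) * β +
    RatFunc.X ^ D.s * α * (place x ν).nonneg (pDeriv (lam x) * β) -
    RatFunc.X ^ D.s * pDeriv (lam x) * α * β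

/-- The bilinear form `(α, β) ↦ tr_ν (α ∘ β)` on functions. -/
def traceForm (ν : D.Marked) (x : D.Param) (α β : RatFunc ℂ) : ℂ :=
  (place x ν).tr D.s ((place x ν).expand (mul ν x α β))

/-- A representative in the algebra of functions of a covector (with respect to the trace
at a marked point). -/
def rep (ν : D.Marked) (x : D.Param) (ω : D.Param →L[ℂ] ℂ) : RatFunc ℂ :=
  Classical.epsilon fun α => α ∈ alg x ∧ Represents ν x α ω

/-- The contravariant metric `η*(ω, ω') = tr_ν (α ∘ β)`, where `α`, `β` are representatives of the
covectors `ω`, `ω'`. -/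
def cometric (ν : D.Marked) (x : D.Param) (ω ω' : D.Param →L[ℂ] ℂ) : ℂ :=
  traceForm ν x (rep ν x ω) (rep ν x ω')

variable (D)

/-- The metric does not depend on the representatives of covectors. -/
def CometricWellDefined (ν : D.Marked) (U : Set D.Param) : Prop :=
  ∀ x ∈ U, ∀ (ω ω' : D.Param →L[ℂ] ℂ), ∀ α ∈ alg x, ∀ β ∈ alg x,
    Represents ν x α ω → Represents ν x β ω' → cometric ν x ω ω' = traceForm ν x α β

/-! ### The candidate flat coordinates -/

/-- Branches, over a set `U` of points of the manifold, of the multivalued functions of `λ` that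
occur in the coordinates. -/
structure Branches (U : Set D.Param) : Type where
  /-- the expansion of `λ^{1/n}` at `∞`, with leading term `p` -/
  rootInf : D.Param → LaurentSeries ℂ
  rootInf_pow : ∀ x ∈ U, rootInf x ^ D.n = Place.expand .inf (lam x)
  rootInf_lead : ∀ x ∈ U, (rootInf x).coeff (-1) = 1
  /-- the expansion of `λ^{1/m}` at a finite pole of order `m`, a branch being chosen -/
  root : D.FinPole → D.Param → LaurentSeries ℂ
  root_pow : ∀ q, 1 ≤ deg q → ∀ x ∈ U,
    root q x ^ deg q = Place.expand (.fin (pos x q)) (lam x)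
  root_cont : ∀ q, 1 ≤ deg q → ContinuousOn (fun x => (root q x).coeff (-1)) U
  /-- `log ((p - ν)^m λ)` at a finite pole `ν` of order `m` -/
  logFin : D.FinPole → D.Param → LaurentSeries ℂ
  logFin_isLog : ∀ q, 1 ≤ deg q → ∀ x ∈ U,
    IsLog (Place.expand (.fin (pos x q))
      ((RatFunc.X - RatFunc.C (pos x q)) ^ deg q * lam x)) (logFin q x)
  logFin_cont : ∀ q, 1 ≤ deg q → ContinuousOn (fun x => (logFin q x).coeff 0) U
  /-- `log ((p - ν)^{-n} λ)` at `∞` -/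
  logInf : D.FinPole → D.Param → LaurentSeries ℂ
  logInf_isLog : ∀ q, 1 ≤ deg q → ∀ x ∈ U,
    IsLog (Place.expand .inf
      ((RatFunc.X - RatFunc.C (pos x q)) ^ (-(D.n : ℤ)) * lam x)) (logInf q x)
  logInf_cont : ∀ q, 1 ≤ deg q → ContinuousOn (fun x => (logInf q x).coeff 0) U
  /-- `log (p - ν)` at another finite marked point `ν'` -/
  logSep : D.FinPole → D.FinPole → D.Param → LaurentSeries ℂ
  logSep_isLog : ∀ q q', 1 ≤ deg q → q' ≠ q → ∀ x ∈ U,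
    IsLog (Place.expand (.fin (pos x q')) (RatFunc.X - RatFunc.C (pos x q))) (logSep q q' x)
  logSep_cont : ∀ q q', 1 ≤ deg q → q' ≠ q →
    ContinuousOn (fun x => (logSep q q' x).coeff 0) U

/-- Labels of the coordinates: `t_∞^i`, `1 ≤ i ≤ n - 1` (the label is `i - 1`), and `t_q^j`,
`0 ≤ j ≤ m_q`, for the finite marked points `q`. -/
abbrev Index : Type := Fin (D.n - 1) ⊕ (Σ q : D.FinPole, Fin (deg q + 1).toNat)

variable {D}

/-- `t_∞^i = (1 - i/n)⁻¹ tr_∞ λ^{1 - i/n}`. -/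
def tInf {U : Set D.Param} (B : D.Branches U) (i : ℕ) (x : D.Param) : ℂ :=
  1 / (1 - (i : ℂ) / D.n) * Place.tr D.s .inf (B.rootInf x ^ ((D.n : ℤ) - i))

/-- The value of `tr_q log λ + (m_q/n) tr_∞ log λ`. With
`log λ = log ((p - ν)^m λ) - m log (p - ν)` at the pole `ν` labelled by `q`,
`log λ = log ((p - ν)^{-n} λ) + n log (p - ν)` at `∞`, and the residue theorem on the sphere cut from
`ν` to `∞`, applied to the difference of the two traces of `log (p - ν)`, it is
`tr_q log ((p - ν)^m λ) + (m/n) tr_∞ log ((p - ν)^{-n} λ) + m ∑_{q' ≠ q} tr_{q'} log (p - ν)`. -/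
def tLog {U : Set D.Param} (B : D.Branches U) (q : D.FinPole) (x : D.Param) : ℂ :=
  Place.tr D.s (.fin (pos x q)) (B.logFin q x) +
    (deg q : ℂ) / D.n * Place.tr D.s .inf (B.logInf q x) +
    (deg q : ℂ) * ∑ q' ∈ Finset.univ.erase q, Place.tr D.s (.fin (pos x q')) (B.logSep q q' x)

/-- `t_q^j = (1 - j/m)⁻¹ tr_q λ^{1 - j/m}` for `j < m`, and
`t_q^m = tr_q log λ + (m/n) tr_∞ log λ`, where `m` is the pole order at `q`. -/
def tFin {U : Set D.Param} (B : D.Branches U) (q : D.FinPole) (j : ℕ) (x : D.Param) : ℂ :=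
  if (j : ℤ) < deg q then
    1 / (1 - (j : ℂ) / deg q) * Place.tr D.s (.fin (pos x q)) (B.root q x ^ (deg q - j))
  else tLog B q x

/-- All the coordinates. -/
def coord {U : Set D.Param} (B : D.Branches U) : D.Index → D.Param → ℂ
  | .inl i => tInf B (i + 1)
  | .inr ⟨q, j⟩ => tFin B q j

/-- The truncated power that should represent the differential of a coordinate:
`[λ^{-i/n}]^∞_{≥ 1-n}` for `t_∞^i` and `[λ^{-j/m}]^q_{≤ m}` for `t_q^j`. -/
def diffRep {U : Set D.Param} (B : D.Branches U) (x : D.Param) : D.Index → RatFunc ℂ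
  | .inl i => Place.trunc .inf ((D.n : ℤ) - 1) (B.rootInf x ^ (-((i : ℤ) + 1)))
  | .inr ⟨q, j⟩ => Place.trunc (.fin (pos x q)) (deg q) (B.root q x ^ (-(j : ℤ)))

/-- The marked point to which a coordinate belongs. -/
def indexPole : D.Index → D.Marked
  | .inl _ => none
  | .inr ⟨q, _⟩ => some q

end Shape

/-! ### Flat coordinates of a contravariant metric on an open subset of a vector space -/

section Flat

variable {V : Type*} [NormedAddCommGroup V] [NormedSpace ℂ V]

/-- `g` is a contravariant metric over `U`: a symmetric nondegenerate bilinear form on the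
cotangent space at each point. -/
structure IsContravariantMetric (U : Set V) (g : V → (V →L[ℂ] ℂ) → (V →L[ℂ] ℂ) → ℂ) : Prop where
  symm : ∀ x ∈ U, ∀ ω ω', g x ω ω' = g x ω' ω
  add_left : ∀ x ∈ U, ∀ ω₁ ω₂ ω', g x (ω₁ + ω₂) ω' = g x ω₁ ω' + g x ω₂ ω'
  smul_left : ∀ x ∈ U, ∀ (c : ℂ) ω ω', g x (c • ω) ω' = c * g x ω ω'
  nondegenerate : ∀ x ∈ U, ∀ ω, (∀ ω', g x ω ω' = 0) → ω = 0

/-- `Γ` gives the Christoffel symbols of the Levi-Civita connection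
`∇_X Y = D_X Y + Γ(X, Y)` of `g` over the open set `U`: the connection is torsionless and `g` is
parallel, where `∇_X ω = -ω ∘ Γ(X, ·)` for a constant covector field `ω`. -/
structure IsLeviCivita (U : Set V) (g : V → (V →L[ℂ] ℂ) → (V →L[ℂ] ℂ) → ℂ)
    (Γ : V → V →L[ℂ] V →L[ℂ] V) : Prop where
  symm : ∀ x ∈ U, ∀ X Y, Γ x X Y = Γ x Y X
  diff : ∀ x ∈ U, ∀ ω ω', DifferentiableAt ℂ (fun y => g y ω ω') x
  compat : ∀ x ∈ U, ∀ ω ω' X,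
    fderiv ℂ (fun y => g y ω ω') x X + g x (ω.comp (Γ x X)) ω' + g x ω (ω'.comp (Γ x X)) = 0

/-- The functions `t` are (local) flat coordinates over the open set `U` for `g`: they are analytic,
form local coordinates near each point, their differentials are covariantly constant with
respect to the Levi-Civita connection, and the components of `g` in them are constant. -/
structure IsFlatCoordinates {J : Type*} (U : Set V)
    (g : V → (V →L[ℂ] ℂ) → (V →L[ℂ] ℂ) → ℂ) (t : J → V → ℂ) : Prop where
  metric : IsContravariantMetric U g
  analytic : ∀ a, AnalyticOnNhd ℂ (t a) U
  chart : ∀ x ∈ U, Function.Bijective fun (X : V) (a : J) => fderiv ℂ (t a) x X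
  parallel : ∃ Γ, IsLeviCivita U g Γ ∧ ∀ a, ∀ x ∈ U, ∀ X Y,
    fderiv ℂ (fun y => fderiv ℂ (t a) y Y) x X - fderiv ℂ (t a) x (Γ x X Y) = 0
  constant : ∃ C : J → J → ℂ, ∀ x ∈ U, ∀ a b,
    g x (fderiv ℂ (t a) x) (fderiv ℂ (t b) x) = C a b

end Flat

end FlatCoord

end

noncomputable section
namespace FlatCoord
open Polynomial

/-! ### Laurent series: orders, products, the derivative -/

/-- All coefficients of index less than `e` vanish. -/
def OrdGE (f : LaurentSeries ℂ) (e : ℤ) : Prop := ∀ k < e, f.coeff k = 0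

/-- All coefficients of index greater than `e` vanish. -/
def OrdLE (f : LaurentSeries ℂ) (e : ℤ) : Prop := ∀ k, e < k → f.coeff k = 0

section Ord

variable {f g : LaurentSeries ℂ} {a b e : ℤ}

lemma OrdGE.mono (hf : OrdGE f a) (h : b ≤ a) : OrdGE f b := fun k hk => hf k (by omega)

lemma ordGE_zero : OrdGE 0 e := fun _ _ => rfl

lemma OrdGE.add (hf : OrdGE f e) (hg : OrdGE g e) : OrdGE (f + g) e := fun k hk => by
  rw [HahnSeries.coeff_add, hf k hk, hg k hk, add_zero]

lemma OrdGE.neg (hf : OrdGE f e) : OrdGE (-f) e := fun k hk => by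
  rw [HahnSeries.coeff_neg, hf k hk, neg_zero]

lemma OrdGE.sub (hf : OrdGE f e) (hg : OrdGE g e) : OrdGE (f - g) e := by
  rw [sub_eq_add_neg]; exact hf.add hg.neg

lemma OrdGE.mul (hf : OrdGE f a) (hg : OrdGE g b) : OrdGE (f * g) (a + b) := fun k hk => by
  rw [HahnSeries.coeff_mul]
  refine Finset.sum_eq_zero fun ij hij => ?_
  rw [Finset.mem_antidiagonal] at hij
  by_cases h : ij.1 < a
  · rw [hf _ h, zero_mul]
  · rw [hg _ (by omega), mul_zero]

lemma OrdLE.mul (hf : OrdLE f a) (hg : OrdLE g b) : OrdLE (f * g) (a + b) := fun k hk => by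
  rw [HahnSeries.coeff_mul]
  refine Finset.sum_eq_zero fun ij hij => ?_
  rw [Finset.mem_antidiagonal] at hij
  by_cases h : a < ij.1
  · rw [hf _ h, zero_mul]
  · rw [hg _ (by omega), mul_zero]

lemma ordGE_order (f : LaurentSeries ℂ) : OrdGE f f.order :=
  fun _ hk => HahnSeries.coeff_eq_zero_of_lt_order hk

lemma OrdGE.le_order (hf : OrdGE f e) (h0 : f ≠ 0) : e ≤ f.order := by
  by_contra! h
  exact HahnSeries.coeff_order_eq_zero.not.2 h0 (hf _ h)

lemma ordGE_iff (h0 : f ≠ 0) : OrdGE f e ↔ e ≤ f.order :=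
  ⟨fun h => h.le_order h0, fun h => (ordGE_order f).mono h⟩

lemma order_eq (hf : OrdGE f e) (h : f.coeff e ≠ 0) : f.order = e := by
  refine le_antisymm ?_ (hf.le_order ?_)
  · by_contra! h'
    exact h (HahnSeries.coeff_eq_zero_of_lt_order h')
  · rintro rfl; exact h rfl

lemma ne_zero_of_coeff (h : f.coeff e ≠ 0) : f ≠ 0 := by
  rintro rfl; exact h rfl

lemma order_inv' (h0 : f ≠ 0) : (f⁻¹).order = -f.order := by
  have h := HahnSeries.order_mul h0 (inv_ne_zero h0)
  rw [mul_inv_cancel₀ h0, HahnSeries.order_one] at h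
  omega

lemma order_zpow' (h0 : f ≠ 0) (k : ℤ) : (f ^ k).order = k * f.order := by
  have hn : ∀ j : ℕ, (f ^ j).order = j * f.order := fun j => by
    rw [HahnSeries.order_pow]; simp
  obtain ⟨j, rfl | rfl⟩ := k.eq_nat_or_neg
  · rw [zpow_natCast, hn]
  · rw [zpow_neg, zpow_natCast, order_inv' (pow_ne_zero _ h0), hn]; ring

lemma order_prod' {ι : Type*} (t : Finset ι) (F : ι → LaurentSeries ℂ) (h : ∀ i ∈ t, F i ≠ 0) :
    (∏ i ∈ t, F i).order = ∑ i ∈ t, (F i).order := by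
  classical
  induction t using Finset.induction_on with
  | empty => simp
  | insert i t hi ih =>
    rw [Finset.prod_insert hi, Finset.sum_insert hi, HahnSeries.order_mul, ih]
    · exact fun j hj => h j (Finset.mem_insert_of_mem hj)
    · exact h i (Finset.mem_insert_self _ _)
    · exact Finset.prod_ne_zero_iff.2 fun j hj => h j (Finset.mem_insert_of_mem hj)

lemma coeff_mul_eq_sum (hf : OrdGE f a) (hg : OrdGE g b) (k : ℤ) :
    (f * g).coeff k = ∑ i ∈ Finset.Icc a (k - b), f.coeff i * g.coeff (k - i) := by
  rw [HahnSeries.coeff_mul]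
  refine Finset.sum_bij_ne_zero (fun ij _ _ => ij.1) ?_ ?_ ?_ ?_
  · intro ij h h'
    rw [Finset.mem_antidiagonal] at h
    rw [Finset.mem_Icc]
    constructor
    · by_contra! hlt
      exact h.1 (hf _ hlt)
    · by_contra! hlt
      exact h.2.1 (hg _ (by omega))
  · intro ij h _ ij' h' _ he
    rw [Finset.mem_antidiagonal] at h h'
    ext
    · exact he
    · omega
  · intro i hi hne
    refine ⟨(i, k - i), ?_, hne, rfl⟩
    rw [Finset.mem_antidiagonal]
    exact ⟨left_ne_zero_of_mul hne, right_ne_zero_of_mul hne, by simp⟩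
  · intro ij h h'
    rw [Finset.mem_antidiagonal] at h
    rw [← h.2.2]; simp

lemma coeff_mul_lead (hf : OrdGE f a) (hg : OrdGE g b) :
    (f * g).coeff (a + b) = f.coeff a * g.coeff b := by
  rw [coeff_mul_eq_sum hf hg]
  simp

lemma pow_lead (hf : OrdGE f e) (k : ℕ) :
    OrdGE (f ^ k) (k * e) ∧ (f ^ k).coeff (k * e) = f.coeff e ^ k := by
  induction k with
  | zero =>
    simp only [pow_zero, Nat.cast_zero, zero_mul, HahnSeries.coeff_one, if_true, and_true]
    exact fun j hj => by rw [HahnSeries.coeff_one, if_neg hj.ne]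
  | succ k ih =>
    have h := coeff_mul_lead ih.1 hf
    have h' := ih.1.mul hf
    rw [← pow_succ, show (k : ℤ) * e + e = ((k + 1 : ℕ) : ℤ) * e by push_cast; ring] at h h'
    exact ⟨h', by rw [h, ih.2, pow_succ]⟩

lemma OrdGE.inv (hf : OrdGE f e) (h : f.coeff e ≠ 0) : OrdGE f⁻¹ (-e) := by
  have h0 := ne_zero_of_coeff h
  rw [ordGE_iff (inv_ne_zero h0), order_inv' h0, order_eq hf h]

lemma coeff_inv_lead (hf : OrdGE f e) (h : f.coeff e ≠ 0) :
    f⁻¹.coeff (-e) = (f.coeff e)⁻¹ := by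
  have h1 := coeff_mul_lead hf (hf.inv h)
  rw [mul_inv_cancel₀ (ne_zero_of_coeff h), add_neg_cancel, HahnSeries.coeff_one, if_pos rfl] at h1
  exact eq_inv_of_mul_eq_one_right h1.symm

lemma ordGE_sum {ι : Type*} (t : Finset ι) (F : ι → LaurentSeries ℂ) (h : ∀ i ∈ t, OrdGE (F i) e) :
    OrdGE (∑ i ∈ t, F i) e := fun k hk => by
  rw [HahnSeries.coeff_sum]
  exact Finset.sum_eq_zero fun i hi => h i hi k hk

lemma ordGE_C (c : ℂ) : OrdGE (HahnSeries.C c) 0 := fun k hk => by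
  rw [HahnSeries.C_apply, HahnSeries.coeff_single_of_ne hk.ne]

lemma ordGE_one : OrdGE 1 0 := fun k hk => by
  rw [HahnSeries.coeff_one, if_neg hk.ne]

lemma ordGE_single (c : ℂ) (e : ℤ) : OrdGE (HahnSeries.single e c) e := fun k hk => by
  rw [HahnSeries.coeff_single_of_ne hk.ne]

end Ord

/-- The formal derivative of a Laurent series. -/
abbrev dz : LaurentSeries ℂ →ₗ[ℂ] LaurentSeries ℂ := LaurentSeries.derivative ℂ

lemma coeff_dz (f : LaurentSeries ℂ) (k : ℤ) : (dz f).coeff k = (k + 1) * f.coeff (k + 1) := by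
  rw [dz, LaurentSeries.derivative_apply, LaurentSeries.hasseDeriv_coeff]
  simp

lemma OrdGE.dz {f : LaurentSeries ℂ} {e : ℤ} (hf : OrdGE f e) : OrdGE (dz f) (e - 1) := fun k hk => by
  rw [coeff_dz, hf _ (by omega), mul_zero]

lemma OrdGE.dz_zero {f : LaurentSeries ℂ} (hf : OrdGE f 0) : OrdGE (FlatCoord.dz f) 0 := fun k hk => by
  rw [coeff_dz]
  rcases eq_or_ne (k + 1) 0 with h | h
  · have : (k : ℂ) + 1 = 0 := by exact_mod_cast h
    rw [this, zero_mul]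
  · rw [hf _ (by omega), mul_zero]

lemma dz_mul (f g : LaurentSeries ℂ) : dz (f * g) = dz f * g + f * dz g := by
  obtain ⟨a, ha⟩ : ∃ a, OrdGE f a := ⟨_, ordGE_order f⟩
  obtain ⟨b, hb⟩ : ∃ b, OrdGE g b := ⟨_, ordGE_order g⟩
  ext k
  rw [HahnSeries.coeff_add, coeff_dz, coeff_mul_eq_sum ha hb, coeff_mul_eq_sum ha.dz hb,
    coeff_mul_eq_sum ha hb.dz]
  have h1 : ∑ i ∈ Finset.Icc (a - 1) (k - b), (dz f).coeff i * g.coeff (k - i) =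
      ∑ i ∈ Finset.Icc a (k + 1 - b), (i : ℂ) * f.coeff i * g.coeff (k + 1 - i) := by
    refine Finset.sum_bij (fun i _ => i + 1) ?_ ?_ ?_ ?_
    · intro i hi; rw [Finset.mem_Icc] at hi ⊢; omega
    · intro i _ j _ h; omega
    · intro i hi; rw [Finset.mem_Icc] at hi; exact ⟨i - 1, by rw [Finset.mem_Icc]; omega, by omega⟩
    · intro i _
      rw [coeff_dz, show k + 1 - (i + 1) = k - i by ring]
      push_cast; ring
  rw [h1, show k - (b - 1) = k + 1 - b by ring, Finset.mul_sum, ← Finset.sum_add_distrib]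
  refine Finset.sum_congr rfl fun i _ => ?_
  rw [coeff_dz, show k - i + 1 = k + 1 - i by ring]
  push_cast; ring

lemma dz_single (e : ℤ) (c : ℂ) : dz (HahnSeries.single e c) = HahnSeries.single (e - 1) (e * c) := by
  ext k
  rw [coeff_dz]
  by_cases h : k + 1 = e
  · have : k = e - 1 := by omega
    subst this
    simp
  · rw [HahnSeries.coeff_single_of_ne h, HahnSeries.coeff_single_of_ne (by omega), mul_zero]

lemma dz_C (c : ℂ) : dz (HahnSeries.C c) = 0 := by
  rw [HahnSeries.C_apply, dz_single]; simp

lemma coeff_dz_neg_one (f : LaurentSeries ℂ) : (dz f).coeff (-1) = 0 := by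
  rw [coeff_dz]; simp

lemma dz_coeff_order {f : LaurentSeries ℂ} : (dz f).coeff (f.order - 1) = f.order * f.coeff f.order := by
  rw [coeff_dz]; simp

end FlatCoord
end


noncomputable section
namespace FlatCoord
open Polynomial

/-! ### Derivations of fields -/

section Leibniz

variable {F : Type*} [Field F] {d : F → F} (hd : ∀ f g, d (f * g) = d f * g + f * d g)
include hd

lemma leibniz_one : d 1 = 0 := by
  have := hd 1 1
  simpa using this

lemma leibniz_inv {f w : F} (h0 : f ≠ 0) (h : d f = f * w) : d f⁻¹ = f⁻¹ * -w := by
  have := hd f f⁻¹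
  rw [mul_inv_cancel₀ h0, leibniz_one hd, h] at this
  have h2 : f * d f⁻¹ = f * (f⁻¹ * -w) := by
    rw [eq_comm, ← sub_eq_zero] at this
    linear_combination this
  exact mul_left_cancel₀ h0 h2

lemma leibniz_log_mul {f g w u : F} (hf : d f = f * w) (hg : d g = g * u) :
    d (f * g) = f * g * (w + u) := by
  rw [hd, hf, hg]; ring

lemma leibniz_log_pow {f w : F} (h : d f = f * w) (k : ℕ) : d (f ^ k) = f ^ k * (k * w) := by
  induction k with
  | zero => simp [leibniz_one hd]
  | succ k ih => rw [pow_succ, leibniz_log_mul hd ih h]; push_cast; ring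

lemma leibniz_log_zpow {f w : F} (h0 : f ≠ 0) (h : d f = f * w) (k : ℤ) :
    d (f ^ k) = f ^ k * (k * w) := by
  obtain ⟨j, rfl | rfl⟩ := k.eq_nat_or_neg
  · rw [zpow_natCast, leibniz_log_pow hd h]; push_cast; ring
  · rw [zpow_neg, zpow_natCast, leibniz_inv hd (pow_ne_zero _ h0) (leibniz_log_pow hd h j)]
    push_cast; ring

end Leibniz

/-! ### Expansions of rational functions -/

lemma coeff_eval₂_single {e : ℤ} (he : e ≠ 0) (q : ℂ[X]) (k : ℕ) :
    (q.eval₂ HahnSeries.C (HahnSeries.single e (1 : ℂ))).coeff (e * k) = q.coeff k := by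
  induction q using Polynomial.induction_on' with
  | add p q hp hq => rw [eval₂_add, HahnSeries.coeff_add, hp, hq, coeff_add]
  | monomial n c =>
    rw [eval₂_monomial, HahnSeries.single_pow, HahnSeries.C_apply, HahnSeries.single_mul_single,
      coeff_monomial, HahnSeries.coeff_single]
    have h : e * (k : ℤ) = ↑n * e ↔ n = k := by
      rw [mul_comm, mul_left_inj' he, Nat.cast_inj, eq_comm]
    simp [h]

lemma coeff_eval₂_single_of_neg {e : ℤ} (q : ℂ[X]) (k : ℤ) (hk : ∀ n : ℕ, k ≠ e * n) :
    (q.eval₂ HahnSeries.C (HahnSeries.single e (1 : ℂ))).coeff k = 0 := by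
  induction q using Polynomial.induction_on' with
  | add p q hp hq => rw [eval₂_add, HahnSeries.coeff_add, hp, hq, add_zero]
  | monomial n c =>
    rw [eval₂_monomial, HahnSeries.single_pow, HahnSeries.C_apply, HahnSeries.single_mul_single,
      HahnSeries.coeff_single_of_ne]
    have := hk n
    simpa [mul_comm] using this

namespace Place

lemma eval₂_fin (c : ℂ) (q : ℂ[X]) : q.eval₂ HahnSeries.C (Place.fin c).pSeries =
    (q.comp (X + C c)).eval₂ HahnSeries.C (HahnSeries.single 1 (1 : ℂ)) := by
  rw [← coe_eval₂RingHom, ← coe_eval₂RingHom]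
  simp only [coe_eval₂RingHom, eval₂_comp]
  simp [pSeries, add_comm]

lemma eval₂_ne_zero (ν : Place) {q : ℂ[X]} (hq : q ≠ 0) :
    q.eval₂ HahnSeries.C ν.pSeries ≠ 0 := by
  have key : ∀ e : ℤ, e ≠ 0 → ∀ q : ℂ[X], q ≠ 0 →
      q.eval₂ HahnSeries.C (HahnSeries.single e (1 : ℂ)) ≠ 0 := by
    intro e he q hq h0
    apply hq
    ext k
    rw [← coeff_eval₂_single he, h0]; simp
  cases ν with
  | inf => exact key (-1) (by norm_num) q hq
  | fin c =>
    rw [eval₂_fin]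
    refine key 1 one_ne_zero _ ?_
    intro h
    apply hq
    have := congrArg (fun r => r.comp (X - C c)) h
    simpa [comp_assoc] using this

/-- The Laurent expansion as a ring homomorphism. -/
def expandHom (ν : Place) : RatFunc ℂ →+* LaurentSeries ℂ where
  toFun := ν.expand
  map_one' := RatFunc.eval_one _ _
  map_zero' := RatFunc.eval_zero _ _
  map_mul' f g := RatFunc.eval_mul _ _ (ν.eval₂_ne_zero (RatFunc.denom_ne_zero f))
    (ν.eval₂_ne_zero (RatFunc.denom_ne_zero g))
  map_add' f g := RatFunc.eval_add _ _ (ν.eval₂_ne_zero (RatFunc.denom_ne_zero f))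
    (ν.eval₂_ne_zero (RatFunc.denom_ne_zero g))

variable (ν : Place)

lemma expand_mul (f g : RatFunc ℂ) : ν.expand (f * g) = ν.expand f * ν.expand g :=
  map_mul ν.expandHom f g
lemma expand_add (f g : RatFunc ℂ) : ν.expand (f + g) = ν.expand f + ν.expand g :=
  map_add ν.expandHom f g
lemma expand_sub (f g : RatFunc ℂ) : ν.expand (f - g) = ν.expand f - ν.expand g :=
  map_sub ν.expandHom f g
lemma expand_neg (f : RatFunc ℂ) : ν.expand (-f) = -ν.expand f :=
  map_neg ν.expandHom f
lemma expand_zero : ν.expand 0 = 0 := map_zero ν.expandHom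
lemma expand_one : ν.expand 1 = 1 := map_one ν.expandHom
lemma expand_inv (f : RatFunc ℂ) : ν.expand f⁻¹ = (ν.expand f)⁻¹ := map_inv₀ ν.expandHom f
lemma expand_div (f g : RatFunc ℂ) : ν.expand (f / g) = ν.expand f / ν.expand g :=
  map_div₀ ν.expandHom f g
lemma expand_pow (f : RatFunc ℂ) (k : ℕ) : ν.expand (f ^ k) = ν.expand f ^ k :=
  map_pow ν.expandHom f k
lemma expand_zpow (f : RatFunc ℂ) (k : ℤ) : ν.expand (f ^ k) = ν.expand f ^ k :=
  map_zpow₀ ν.expandHom f k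
lemma expand_sum {ι : Type*} (t : Finset ι) (f : ι → RatFunc ℂ) :
    ν.expand (∑ i ∈ t, f i) = ∑ i ∈ t, ν.expand (f i) := map_sum ν.expandHom f t
lemma expand_prod {ι : Type*} (t : Finset ι) (f : ι → RatFunc ℂ) :
    ν.expand (∏ i ∈ t, f i) = ∏ i ∈ t, ν.expand (f i) := map_prod ν.expandHom f t
lemma expand_C (c : ℂ) : ν.expand (RatFunc.C c) = HahnSeries.C c := RatFunc.eval_C _ _
lemma expand_X : ν.expand RatFunc.X = ν.pSeries := RatFunc.eval_X _ _
lemma expand_algebraMap (q : ℂ[X]) :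
    ν.expand (algebraMap ℂ[X] (RatFunc ℂ) q) = q.eval₂ HahnSeries.C ν.pSeries :=
  RatFunc.eval_algebraMap _ _ q

lemma expand_injective : Function.Injective ν.expand := ν.expandHom.injective

lemma expand_ne_zero {f : RatFunc ℂ} (h : f ≠ 0) : ν.expand f ≠ 0 := by
  rw [← ν.expand_zero]; exact ν.expand_injective.ne h

/-- The derivation `∂/∂p` of Laurent series in the local parameter. -/
def dp (f : LaurentSeries ℂ) : LaurentSeries ℂ :=
  match ν with
  | .inf => -HahnSeries.single 2 1 * dz f
  | .fin _ => dz f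

lemma dp_mul (f g : LaurentSeries ℂ) : ν.dp (f * g) = ν.dp f * g + f * ν.dp g := by
  cases ν
  · simp only [dp, dz_mul]; ring
  · simp only [dp, dz_mul]

lemma dp_add (f g : LaurentSeries ℂ) : ν.dp (f + g) = ν.dp f + ν.dp g := by
  cases ν
  · simp only [dp, map_add]; ring
  · simp only [dp, map_add]

lemma dp_C (c : ℂ) : ν.dp (HahnSeries.C c) = 0 := by
  cases ν <;> simp only [dp, dz_C, mul_zero]

lemma dp_pSeries : ν.dp ν.pSeries = 1 := by
  cases ν
  · simp only [dp, pSeries, dz_single]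
    rw [← HahnSeries.single_neg, HahnSeries.single_mul_single]
    simp
  · simp only [dp, pSeries, map_add, dz_C, dz_single]
    simp

lemma dp_expand_algebraMap (q : ℂ[X]) : ν.dp (ν.expand (algebraMap ℂ[X] (RatFunc ℂ) q)) =
    ν.expand (algebraMap ℂ[X] (RatFunc ℂ) (derivative q)) := by
  rw [expand_algebraMap, expand_algebraMap]
  induction q using Polynomial.induction_on' with
  | add p q hp hq => rw [eval₂_add, dp_add, hp, hq, derivative_add, eval₂_add]
  | monomial n c =>
    have hp : ν.pSeries ≠ 0 := by rw [← expand_X]; exact ν.expand_ne_zero RatFunc.X_ne_zero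
    have h1 : ν.dp ν.pSeries = ν.pSeries * ν.pSeries⁻¹ := by rw [dp_pSeries, mul_inv_cancel₀ hp]
    rw [eval₂_monomial, derivative_monomial, eval₂_monomial, dp_mul, dp_C,
      leibniz_log_pow ν.dp_mul h1, zero_mul, zero_add, map_mul, map_natCast]
    cases n with
    | zero => simp
    | succ n => rw [Nat.add_sub_cancel, pow_succ]; field_simp

lemma expand_pDeriv (f : RatFunc ℂ) : ν.expand (pDeriv f) = ν.dp (ν.expand f) := by
  have hD : algebraMap ℂ[X] (RatFunc ℂ) f.denom ≠ 0 := RatFunc.algebraMap_ne_zero f.denom_ne_zero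
  have hD' := ν.expand_ne_zero hD
  have h := congrArg (fun g => ν.dp (ν.expand g)) (RatFunc.num_div_denom f)
  have h2 : ν.expand f * ν.expand (algebraMap ℂ[X] (RatFunc ℂ) f.denom) =
      ν.expand (algebraMap ℂ[X] (RatFunc ℂ) f.num) := by
    rw [← expand_mul]; congr 1
    conv_lhs => rw [← RatFunc.num_div_denom f]
    rw [RatFunc.num_div_denom f]
    rw [← eq_div_iff hD, RatFunc.num_div_denom f]
  have h3 := congrArg ν.dp h2
  rw [dp_mul, dp_expand_algebraMap, dp_expand_algebraMap] at h3
  rw [pDeriv, expand_div, expand_sub, expand_mul, expand_mul, expand_pow, ← h3, ← h2,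
    div_eq_iff (pow_ne_zero _ hD')]
  ring

end Place

lemma X_sub_C_ne_zero' (b : ℂ) : (RatFunc.X - RatFunc.C b : RatFunc ℂ) ≠ 0 := by
  rw [← RatFunc.algebraMap_X, ← RatFunc.algebraMap_C, ← map_sub]
  exact RatFunc.algebraMap_ne_zero (X_sub_C_ne_zero b)

namespace Place

lemma expand_X_sub_C_fin (c b : ℂ) : (Place.fin c).expand (RatFunc.X - RatFunc.C b) =
    HahnSeries.C (c - b) + HahnSeries.single 1 1 := by
  rw [expand_sub, expand_X, expand_C, pSeries, map_sub]; ring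

lemma expand_X_sub_C_inf (b : ℂ) : Place.inf.expand (RatFunc.X - RatFunc.C b) =
    HahnSeries.single (-1) 1 - HahnSeries.C b := by
  rw [expand_sub, expand_X, expand_C, pSeries]

lemma expand_unif (ν : Place) : ν.expand ν.unif = HahnSeries.single 1 1 := by
  cases ν with
  | inf =>
    rw [unif, expand_inv, expand_X, pSeries]
    simp
  | fin c => rw [unif, expand_X_sub_C_fin]; simp

lemma unif_ne_zero (ν : Place) : ν.unif ≠ 0 := by
  cases ν with
  | inf => exact inv_ne_zero RatFunc.X_ne_zero
  | fin c => exact X_sub_C_ne_zero' c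

lemma single_zpow' (i : ℤ) : (HahnSeries.single 1 (1 : ℂ)) ^ i = HahnSeries.single i 1 := by
  obtain ⟨j, rfl | rfl⟩ := i.eq_nat_or_neg <;> simp

lemma expand_unif_zpow (ν : Place) (i : ℤ) : ν.expand (ν.unif ^ i) = HahnSeries.single i 1 := by
  rw [expand_zpow, expand_unif, single_zpow']

lemma order_X_sub_C_fin_self (c : ℂ) :
    ((Place.fin c).expand (RatFunc.X - RatFunc.C c)).order = 1 := by
  rw [expand_X_sub_C_fin]; simp

lemma coeff_X_sub_C_fin (c b : ℂ) :
    ((Place.fin c).expand (RatFunc.X - RatFunc.C b)).coeff 0 = c - b := by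
  rw [expand_X_sub_C_fin]; simp

lemma ordGE_X_sub_C_fin (c b : ℂ) : OrdGE ((Place.fin c).expand (RatFunc.X - RatFunc.C b)) 0 := by
  rw [expand_X_sub_C_fin]
  exact (ordGE_C _).add ((ordGE_single _ _).mono zero_le_one)

lemma order_X_sub_C_fin {c b : ℂ} (h : c ≠ b) :
    ((Place.fin c).expand (RatFunc.X - RatFunc.C b)).order = 0 :=
  order_eq (ordGE_X_sub_C_fin c b) (by rw [coeff_X_sub_C_fin]; exact sub_ne_zero.2 h)

lemma ordGE_X_sub_C_inf (b : ℂ) : OrdGE (Place.inf.expand (RatFunc.X - RatFunc.C b)) (-1) := by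
  rw [expand_X_sub_C_inf]
  exact (ordGE_single _ _).sub ((ordGE_C _).mono (by norm_num))

lemma coeff_X_sub_C_inf (b : ℂ) :
    (Place.inf.expand (RatFunc.X - RatFunc.C b)).coeff (-1) = 1 := by
  rw [expand_X_sub_C_inf]; simp

lemma order_X_sub_C_inf (b : ℂ) : (Place.inf.expand (RatFunc.X - RatFunc.C b)).order = -1 :=
  order_eq (ordGE_X_sub_C_inf b) (by rw [coeff_X_sub_C_inf]; exact one_ne_zero)

end Place

end FlatCoord
end


noncomputable section
namespace FlatCoord
open Polynomial

namespace Place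

/-! ### Residues and truncations -/

/-- The coefficient of `p⁻¹` at `∞`, of `(p - c)⁻¹` at `c`. -/
def res (ν : Place) (f : LaurentSeries ℂ) : ℂ :=
  match ν with
  | .inf => f.coeff 1
  | .fin _ => f.coeff (-1)

/-- The residue (up to sign at `∞`) of a rational function. -/
def rres (ν : Place) (f : RatFunc ℂ) : ℂ := ν.res (ν.expand f)

lemma tr_eq (s : ℕ) (ν : Place) (f : LaurentSeries ℂ) :
    ν.tr s f = ν.res (ν.pSeries ^ (-(s : ℤ)) * f) := by
  cases ν <;> rfl

lemma tr_expand (s : ℕ) (ν : Place) (f : RatFunc ℂ) :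
    ν.tr s (ν.expand f) = ν.rres (RatFunc.X ^ (-(s : ℤ)) * f) := by
  rw [tr_eq, rres, expand_mul, expand_zpow, expand_X]

section
variable (ν : Place)

lemma res_add (f g : LaurentSeries ℂ) : ν.res (f + g) = ν.res f + ν.res g := by cases ν <;> rfl
lemma res_sub (f g : LaurentSeries ℂ) : ν.res (f - g) = ν.res f - ν.res g := by cases ν <;> rfl
lemma res_neg (f : LaurentSeries ℂ) : ν.res (-f) = -ν.res f := by cases ν <;> rfl
lemma res_sum {ι : Type*} (t : Finset ι) (f : ι → LaurentSeries ℂ) :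
    ν.res (∑ i ∈ t, f i) = ∑ i ∈ t, ν.res (f i) := by
  cases ν <;> simp [res, HahnSeries.coeff_sum]
lemma res_C_mul (c : ℂ) (f : LaurentSeries ℂ) : ν.res (HahnSeries.C c * f) = c * ν.res f := by
  cases ν <;> simp [res]

lemma rres_add (f g : RatFunc ℂ) : ν.rres (f + g) = ν.rres f + ν.rres g := by
  rw [rres, expand_add, res_add]; rfl
lemma rres_sub (f g : RatFunc ℂ) : ν.rres (f - g) = ν.rres f - ν.rres g := by
  rw [rres, expand_sub, res_sub]; rfl
lemma rres_neg (f : RatFunc ℂ) : ν.rres (-f) = -ν.rres f := by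
  rw [rres, expand_neg, res_neg]; rfl
lemma rres_sum {ι : Type*} (t : Finset ι) (f : ι → RatFunc ℂ) :
    ν.rres (∑ i ∈ t, f i) = ∑ i ∈ t, ν.rres (f i) := by
  rw [rres, expand_sum, res_sum]; rfl
lemma rres_C_mul (c : ℂ) (f : RatFunc ℂ) : ν.rres (RatFunc.C c * f) = c * ν.rres f := by
  rw [rres, expand_mul, expand_C, res_C_mul]; rfl
lemma rres_zero : ν.rres 0 = 0 := by
  rw [rres, expand_zero]; cases ν <;> rfl

/-- The part of a rational function complementary to `nonneg`. -/
def neg (f : RatFunc ℂ) : RatFunc ℂ := f - ν.nonneg f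

lemma nonneg_add_neg (f : RatFunc ℂ) : ν.nonneg f + ν.neg f = f := by rw [neg]; ring

lemma coeff_expand_trunc (l : ℤ) (f : LaurentSeries ℂ) (k : ℤ) :
    (ν.expand (ν.trunc l f)).coeff k = if k ≤ l then f.coeff k else 0 := by
  have h : ∀ i, ν.expand (RatFunc.C (f.coeff i) * ν.unif ^ i) = HahnSeries.single i (f.coeff i) := by
    intro i
    rw [expand_mul, expand_C, expand_unif_zpow, HahnSeries.C_apply, HahnSeries.single_mul_single]
    simp
  rw [trunc, expand_sum, HahnSeries.coeff_sum]
  simp only [h]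
  by_cases hk : k ∈ Finset.Icc f.order l
  · rw [Finset.sum_eq_single_of_mem k hk fun i _ hi => HahnSeries.coeff_single_of_ne hi.symm,
      HahnSeries.coeff_single_same, if_pos (Finset.mem_Icc.1 hk).2]
  · rw [Finset.sum_eq_zero fun i hi => HahnSeries.coeff_single_of_ne (by rintro rfl; exact hk hi)]
    rw [Finset.mem_Icc] at hk
    split_ifs with h2
    · rw [ordGE_order f k (by omega)]
    · rfl

end

lemma rres_inf_eq_zero {f : RatFunc ℂ} (h : OrdGE (Place.inf.expand f) 2) : Place.inf.rres f = 0 :=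
  h 1 (by norm_num)

lemma rres_fin_eq_zero {c : ℂ} {f : RatFunc ℂ} (h : OrdGE ((Place.fin c).expand f) 0) :
    (Place.fin c).rres f = 0 :=
  h (-1) (by norm_num)

lemma neg_fin (c : ℂ) (f : RatFunc ℂ) :
    (Place.fin c).neg f = (Place.fin c).trunc (-1) ((Place.fin c).expand f) := by
  simp [neg, nonneg]

lemma ordLE_neg_fin (c : ℂ) (f : RatFunc ℂ) :
    OrdLE ((Place.fin c).expand ((Place.fin c).neg f)) (-1) := fun k hk => by
  rw [neg_fin, coeff_expand_trunc, if_neg (by omega)]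

lemma ordGE_nonneg_fin (c : ℂ) (f : RatFunc ℂ) :
    OrdGE ((Place.fin c).expand ((Place.fin c).nonneg f)) 0 := fun k hk => by
  have : (Place.fin c).nonneg f = f - (Place.fin c).neg f := by rw [neg]; ring
  rw [this, expand_sub, HahnSeries.coeff_sub, neg_fin, coeff_expand_trunc, if_pos (by omega), sub_self]

lemma ordLE_nonneg_inf (f : RatFunc ℂ) :
    OrdLE (Place.inf.expand (Place.inf.nonneg f)) 0 := fun k hk => by
  rw [nonneg, coeff_expand_trunc, if_neg (by omega)]

lemma ordGE_neg_inf (f : RatFunc ℂ) :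
    OrdGE (Place.inf.expand (Place.inf.neg f)) 1 := fun k hk => by
  rw [neg, expand_sub, HahnSeries.coeff_sub, nonneg, coeff_expand_trunc, if_pos (by omega), sub_self]

lemma rres_nonneg_mul_nonneg (ν : Place) (f g : RatFunc ℂ) :
    ν.rres (ν.nonneg f * ν.nonneg g) = 0 := by
  cases ν with
  | inf =>
    rw [rres, expand_mul]
    exact ((ordLE_nonneg_inf f).mul (ordLE_nonneg_inf g)) 1 (by norm_num)
  | fin c =>
    rw [rres, expand_mul]
    exact ((ordGE_nonneg_fin c f).mul (ordGE_nonneg_fin c g)) (-1) (by norm_num)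

lemma rres_neg_mul_neg (ν : Place) (f g : RatFunc ℂ) : ν.rres (ν.neg f * ν.neg g) = 0 := by
  cases ν with
  | inf =>
    rw [rres, expand_mul]
    exact ((ordGE_neg_inf f).mul (ordGE_neg_inf g)) 1 (by norm_num)
  | fin c =>
    rw [rres, expand_mul]
    exact ((ordLE_neg_fin c f).mul (ordLE_neg_fin c g)) (-1) (by norm_num)

lemma rres_mul_neg (ν : Place) (f g : RatFunc ℂ) :
    ν.rres (f * ν.neg g) = ν.rres (ν.nonneg f * g) := by
  have h1 : f * ν.neg g = ν.nonneg f * ν.neg g + ν.neg f * ν.neg g := by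
    rw [← add_mul, nonneg_add_neg]
  have h2 : ν.nonneg f * g = ν.nonneg f * ν.nonneg g + ν.nonneg f * ν.neg g := by
    rw [← mul_add, nonneg_add_neg]
  rw [h1, h2, rres_add, rres_add, rres_nonneg_mul_nonneg, rres_neg_mul_neg, add_zero, zero_add]

lemma order_X_sub_C_zpow_inf (c : ℂ) (i : ℤ) :
    (Place.inf.expand ((RatFunc.X - RatFunc.C c) ^ i)).order = -i := by
  rw [expand_zpow, order_zpow' (expand_ne_zero _ (X_sub_C_ne_zero' c)), order_X_sub_C_inf]; ring

lemma order_X_sub_C_zpow_fin {c b : ℂ} (h : c ≠ b) (i : ℤ) :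
    ((Place.fin c).expand ((RatFunc.X - RatFunc.C b) ^ i)).order = 0 := by
  rw [expand_zpow, order_zpow' (expand_ne_zero _ (X_sub_C_ne_zero' b)), order_X_sub_C_fin h]; ring

lemma OrdGE.C_mul {ν : Place} {f : RatFunc ℂ} {e : ℤ} (c : ℂ) (h : OrdGE (ν.expand f) e) :
    OrdGE (ν.expand (RatFunc.C c * f)) e := by
  rw [expand_mul, expand_C]
  have := (ordGE_C c).mul h
  rwa [zero_add] at this

lemma ordGE_trunc_fin_inf (c : ℂ) (l : ℤ) (f : LaurentSeries ℂ) :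
    OrdGE (Place.inf.expand ((Place.fin c).trunc l f)) (-l) := by
  rw [trunc, expand_sum]
  refine ordGE_sum _ _ fun i hi => OrdGE.C_mul _ ?_
  rw [Finset.mem_Icc] at hi
  refine (ordGE_order _).mono ?_
  rw [unif, order_X_sub_C_zpow_inf]; omega

lemma ordGE_trunc_fin_fin {c c' : ℂ} (h : c' ≠ c) (l : ℤ) (f : LaurentSeries ℂ) :
    OrdGE ((Place.fin c').expand ((Place.fin c).trunc l f)) 0 := by
  rw [trunc, expand_sum]
  refine ordGE_sum _ _ fun i _ => OrdGE.C_mul _ ?_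
  refine (ordGE_order _).mono ?_
  rw [unif, order_X_sub_C_zpow_fin h]

lemma ordGE_algebraMap_fin (c : ℂ) (q : ℂ[X]) :
    OrdGE ((Place.fin c).expand (algebraMap ℂ[X] (RatFunc ℂ) q)) 0 := fun k hk => by
  rw [expand_algebraMap, eval₂_fin, coeff_eval₂_single_of_neg]
  intro n; omega

lemma ordGE_trunc_inf_fin (c : ℂ) (f : LaurentSeries ℂ) {l : ℤ} (hl : l ≤ 0) :
    OrdGE ((Place.fin c).expand (Place.inf.trunc l f)) 0 := by
  rw [trunc, expand_sum]
  refine ordGE_sum _ _ fun i hi => OrdGE.C_mul _ ?_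
  rw [Finset.mem_Icc] at hi
  obtain ⟨j, hj⟩ := Int.eq_ofNat_of_zero_le (a := -i) (by omega)
  have : Place.inf.unif ^ i = algebraMap ℂ[X] (RatFunc ℂ) (X ^ j) := by
    rw [unif, inv_zpow', hj, zpow_natCast, map_pow, RatFunc.algebraMap_X]
  rw [this]
  exact ordGE_algebraMap_fin c _

lemma ordGE_neg_fin_inf (c : ℂ) (f : RatFunc ℂ) :
    OrdGE (Place.inf.expand ((Place.fin c).neg f)) 1 := by
  rw [neg_fin]; exact ordGE_trunc_fin_inf c (-1) _

lemma ordGE_neg_fin_fin {c c' : ℂ} (h : c' ≠ c) (f : RatFunc ℂ) :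
    OrdGE ((Place.fin c').expand ((Place.fin c).neg f)) 0 := by
  rw [neg_fin]; exact ordGE_trunc_fin_fin h (-1) _

lemma ordGE_nonneg_inf_fin (c : ℂ) (f : RatFunc ℂ) :
    OrdGE ((Place.fin c).expand (Place.inf.nonneg f)) 0 :=
  ordGE_trunc_inf_fin c _ le_rfl

/-! ### The residue theorem -/

lemma coeff_zero_algebraMap_fin (c : ℂ) (q : ℂ[X]) :
    ((Place.fin c).expand (algebraMap ℂ[X] (RatFunc ℂ) q)).coeff 0 = q.eval c := by
  have := coeff_eval₂_single one_ne_zero (q.comp (X + C c)) 0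
  rw [expand_algebraMap, eval₂_fin]
  rw [Nat.cast_zero, mul_zero] at this
  rw [this, coeff_zero_eq_eval_zero]
  simp

lemma exists_polynomial_of_regular {f : RatFunc ℂ} (h : ∀ c, OrdGE ((Place.fin c).expand f) 0) :
    ∃ q : ℂ[X], f = algebraMap ℂ[X] (RatFunc ℂ) q := by
  have hD : algebraMap ℂ[X] (RatFunc ℂ) f.denom ≠ 0 := RatFunc.algebraMap_ne_zero f.denom_ne_zero
  have hmul : f * algebraMap ℂ[X] (RatFunc ℂ) f.denom = algebraMap ℂ[X] (RatFunc ℂ) f.num := by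
    rw [← eq_div_iff hD, RatFunc.num_div_denom f]
  have hdeg : f.denom.degree = 0 := by
    by_contra hdeg
    obtain ⟨c, hc⟩ := IsAlgClosed.exists_root f.denom hdeg
    have h1 := congrArg (fun g => ((Place.fin c).expand g).coeff (0 + 0)) hmul
    simp only [expand_mul] at h1
    rw [coeff_mul_lead (h c) (ordGE_algebraMap_fin c _), add_zero, coeff_zero_algebraMap_fin,
      coeff_zero_algebraMap_fin, hc, mul_zero] at h1
    obtain ⟨u, w, huw⟩ := f.isCoprime_num_denom
    have := congrArg (eval c) huw
    rw [eval_add, eval_mul, eval_mul, ← h1, hc.eq_zero] at this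
    simp at this
  replace hdeg := (Polynomial.Monic.degree_le_zero_iff_eq_one f.monic_denom).1 hdeg.le
  rw [hdeg, map_one, mul_one] at hmul
  exact ⟨_, hmul⟩

lemma degree_lt_of_ordGE_inf {q : ℂ[X]} {d : ℕ} {e : ℤ} (he : (-e : ℤ) < d)
    (h : OrdGE (Place.inf.expand (algebraMap ℂ[X] (RatFunc ℂ) q)) e) : q ∈ degreeLT ℂ d := by
  rw [mem_degreeLT, degree_lt_iff_coeff_zero]
  intro k hk
  rw [← coeff_eval₂_single (e := -1) (by norm_num)]
  have := h (-1 * k) (by omega)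
  rwa [expand_algebraMap] at this

lemma rres_algebraMap_inf (q : ℂ[X]) : Place.inf.rres (algebraMap ℂ[X] (RatFunc ℂ) q) = 0 := by
  rw [rres, expand_algebraMap]
  exact coeff_eval₂_single_of_neg _ _ fun n => by omega

lemma rres_neg_fin_inf (c : ℂ) (f : RatFunc ℂ) :
    Place.inf.rres ((Place.fin c).neg f) = (Place.fin c).rres f := by
  have h1 : (Place.fin c).rres f = (Place.fin c).rres ((Place.fin c).neg f) := by
    conv_lhs => rw [← nonneg_add_neg (Place.fin c) f]
    rw [rres_add, rres_fin_eq_zero (ordGE_nonneg_fin c f), zero_add]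
  rw [h1, neg_fin, trunc, rres_sum, rres_sum]
  refine Finset.sum_congr rfl fun i hi => ?_
  rw [rres_C_mul, rres_C_mul]
  congr 1
  rw [Finset.mem_Icc] at hi
  rcases eq_or_ne i (-1) with rfl | hne
  · rw [rres, rres, expand_unif_zpow, unif, res, res, zpow_neg_one, expand_inv]
    have := coeff_inv_lead (ordGE_X_sub_C_inf c) (by rw [coeff_X_sub_C_inf]; exact one_ne_zero)
    rw [coeff_X_sub_C_inf, neg_neg, inv_one] at this
    simp [this]
  · rw [rres_inf_eq_zero, rres, expand_unif_zpow, res, HahnSeries.coeff_single_of_ne hne.symm]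
    refine (ordGE_order _).mono ?_
    rw [unif, order_X_sub_C_zpow_inf]; omega

/-- The residue theorem for rational functions with poles in a finite set and at `∞`. -/
theorem rres_inf_eq_sum (S : Finset ℂ) (f : RatFunc ℂ)
    (h : ∀ c ∉ S, OrdGE ((Place.fin c).expand f) 0) :
    Place.inf.rres f = ∑ c ∈ S, (Place.fin c).rres f := by
  obtain ⟨q, hq⟩ := exists_polynomial_of_regular (f := f - ∑ c ∈ S, (Place.fin c).neg f) (by
    intro c
    by_cases hc : c ∈ S
    · rw [← Finset.add_sum_erase _ _ hc, ← sub_sub, expand_sub, expand_sum, expand_sub]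
      refine OrdGE.sub ?_ (ordGE_sum _ _ fun c' hc' => ordGE_neg_fin_fin ?_ f)
      · have := ordGE_nonneg_fin c f
        rwa [eq_sub_of_add_eq (nonneg_add_neg (Place.fin c) f), expand_sub] at this
      · exact (Finset.ne_of_mem_erase hc').symm
    · rw [expand_sub, expand_sum]
      refine (h c hc).sub (ordGE_sum _ _ fun c' hc' => ordGE_neg_fin_fin ?_ f)
      rintro rfl; exact hc hc')
  have := congrArg Place.inf.rres hq
  rw [rres_algebraMap_inf, rres_sub, rres_sum, sub_eq_zero] at this
  rw [this]
  exact Finset.sum_congr rfl fun c _ => rres_neg_fin_inf c f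

end Place
end FlatCoord
end


noncomputable section
namespace FlatCoord
open Polynomial
namespace Shape

variable {D : Shape}

/-! ### Local orders of `λ` and its derivative -/

lemma deg_cases (q : D.FinPole) : 1 ≤ deg q ∨ deg q = -1 := by
  obtain ⟨_ | j, hq⟩ := q
  · exact D.m0_one (hq rfl)
  · left
    have := D.m_pos j
    change (1 : ℤ) ≤ (D.m j : ℤ)
    omega

@[to_additive]
lemma prod_finPole {A : Type*} [CommMonoid A] (F : D.FinPole → A) (G : Option (Fin D.K) → A)
    (hFG : ∀ q, F q = G q.1) (h0 : D.s = 0 → G none = 1) :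
    ∏ q, F q = G none * ∏ j, G (some j) := by
  classical
  rw [← Fintype.prod_option, Finset.prod_congr rfl fun q _ => hFG q,
    ← Finset.prod_subtype (p := fun q : Option (Fin D.K) => q = none → D.s = 1)
      (Finset.univ.filter fun q => (q = none → D.s = 1)) (by simp) G]
  rw [Finset.prod_filter_of_ne]
  intro q _ hq hq'
  rcases D.s_eq with h | h
  · rw [hq', h0 h] at hq; exact absurd rfl hq
  · exact h

lemma sum_deg : ∑ q : D.FinPole, deg q = D.L - D.n := by
  rw [sum_finPole (F := deg) (fun o => match o with | none => D.m0 | some j => (D.m j : ℤ))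
    (by rintro ⟨_ | _, _⟩ <;> rfl) D.m0_zero]
  have := D.n_eq
  simp only
  omega

lemma sum_deg_add_one : ∑ q : D.FinPole, (deg q + 1) = D.N + 1 - D.n := by
  rw [Finset.sum_add_distrib, sum_deg,
    sum_finPole (fun _ => (1 : ℤ)) (fun o => match o with | none => (D.s : ℤ) | some j => 1)]
  · have h1 := D.n_eq
    have h2 := D.n_pos
    have h3 : (0 : ℤ) ≤ ∑ j, (D.m j : ℤ) := Finset.sum_nonneg fun j _ => by positivity
    have h4 := D.m0_zero
    have h5 := D.s_eq
    simp only [Finset.sum_const, Finset.card_univ, Fintype.card_fin, N]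
    simp only [nsmul_eq_mul, mul_one]
    omega
  · rintro ⟨_ | _, h⟩
    · simp [h rfl]
    · rfl
  · intro h; simp [h]

variable {x : D.Param}

lemma pos_injective (hx : x ∈ D.M) : Function.Injective (pos x) := by
  rintro ⟨_ | j, h⟩ ⟨_ | j', h'⟩ he
  · rfl
  · exact absurd he.symm ((hx.2.2.2 (h rfl)).2 j')
  · exact absurd he ((hx.2.2.2 (h' rfl)).2 j)
  · have : v x j = v x j' := he
    obtain rfl := hx.2.1 this
    rfl

lemma a_ne_pos (hx : x ∈ D.M) (i : Fin D.L) (q : D.FinPole) : a x i ≠ pos x q := by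
  obtain ⟨_ | j, h⟩ := q
  · exact (hx.2.2.2 (h rfl)).1 i
  · exact hx.2.2.1 i j

lemma lam_eq (x : D.Param) : lam x = (∏ i, (RatFunc.X - RatFunc.C (a x i))) *
    ∏ q, (RatFunc.X - RatFunc.C (pos x q)) ^ (-deg q) := by
  rw [prod_finPole (D := D) _ (fun o => match o with
    | none => RatFunc.X ^ (-D.m0)
    | some j => (RatFunc.X - RatFunc.C (v x j)) ^ (-(D.m j : ℤ)))]
  · simp only [zpow_neg, zpow_natCast, Finset.prod_inv_distrib]
    rw [lam, div_eq_mul_inv, mul_inv]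
  · rintro ⟨_ | _, h⟩
    · simp [pos, deg]
    · rfl
  · intro h; simp [D.m0_zero h]

lemma prod_zeros_ne_zero (x : D.Param) : (∏ i, (RatFunc.X - RatFunc.C (a x i))) ≠ 0 :=
  Finset.prod_ne_zero_iff.2 fun _ _ => X_sub_C_ne_zero' _

lemma lam_ne_zero (x : D.Param) : lam x ≠ 0 := by
  rw [lam_eq]
  exact mul_ne_zero (prod_zeros_ne_zero x)
    (Finset.prod_ne_zero_iff.2 fun _ _ => zpow_ne_zero _ (X_sub_C_ne_zero' _))

lemma order_lam (x : D.Param) (ν : Place) : (ν.expand (lam x)).order =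
    ∑ i, (ν.expand (RatFunc.X - RatFunc.C (a x i))).order +
      ∑ q, -deg q * (ν.expand (RatFunc.X - RatFunc.C (pos x q))).order := by
  rw [lam_eq, Place.expand_mul, HahnSeries.order_mul, Place.expand_prod, Place.expand_prod,
    order_prod', order_prod']
  · congr 1
    refine Finset.sum_congr rfl fun q _ => ?_
    rw [Place.expand_zpow, order_zpow' (Place.expand_ne_zero _ (X_sub_C_ne_zero' _))]
  · exact fun q _ => Place.expand_ne_zero _ (zpow_ne_zero _ (X_sub_C_ne_zero' _))
  · exact fun q _ => Place.expand_ne_zero _ (X_sub_C_ne_zero' _)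
  · exact Place.expand_ne_zero _ (prod_zeros_ne_zero x)
  · exact Place.expand_ne_zero _
      (Finset.prod_ne_zero_iff.2 fun _ _ => zpow_ne_zero _ (X_sub_C_ne_zero' _))

lemma order_lam_inf (x : D.Param) : (Place.inf.expand (lam x)).order = -D.n := by
  rw [order_lam]
  simp only [Place.order_X_sub_C_inf]
  have h : ∑ q : D.FinPole, -deg q * -1 = ∑ q : D.FinPole, deg q :=
    Finset.sum_congr rfl fun q _ => by ring
  rw [h, sum_deg]
  simp only [Finset.sum_const, Finset.card_univ, Fintype.card_fin, nsmul_eq_mul]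
  ring

lemma order_lam_pos (hx : x ∈ D.M) (q : D.FinPole) :
    ((Place.fin (pos x q)).expand (lam x)).order = -deg q := by
  rw [order_lam, Finset.sum_eq_zero, Finset.sum_eq_single q, Place.order_X_sub_C_fin_self]
  · ring
  · intro q' _ hq
    rw [Place.order_X_sub_C_fin ((pos_injective hx).ne hq.symm), mul_zero]
  · simp
  · exact fun i _ => Place.order_X_sub_C_fin (a_ne_pos hx i q).symm

lemma order_lam_unmarked {c : ℂ} (hc : ∀ q, pos x q ≠ c) :
    ((Place.fin c).expand (lam x)).order =
      ∑ i, ((Place.fin c).expand (RatFunc.X - RatFunc.C (a x i))).order := by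
  rw [order_lam, add_eq_left]
  refine Finset.sum_eq_zero fun q _ => ?_
  rw [Place.order_X_sub_C_fin (hc q).symm, mul_zero]

lemma ordGE_lam_unmarked {c : ℂ} (hc : ∀ q, pos x q ≠ c) :
    OrdGE ((Place.fin c).expand (lam x)) 0 := by
  refine (ordGE_order _).mono ?_
  rw [order_lam_unmarked hc]
  exact Finset.sum_nonneg fun i _ => (Place.ordGE_X_sub_C_fin c _).le_order
    (Place.expand_ne_zero _ (X_sub_C_ne_zero' _))

lemma ordGE_pDeriv_lam_unmarked {c : ℂ} (hc : ∀ q, pos x q ≠ c) :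
    OrdGE ((Place.fin c).expand (pDeriv (lam x))) 0 := by
  rw [Place.expand_pDeriv]
  exact (ordGE_lam_unmarked hc).dz_zero

lemma ordGE_pDeriv_lam_pos (hx : x ∈ D.M) (q : D.FinPole) :
    OrdGE ((Place.fin (pos x q)).expand (pDeriv (lam x))) (-deg q - 1) := by
  rw [Place.expand_pDeriv, ← order_lam_pos hx]
  exact (ordGE_order _).dz

lemma coeff_pDeriv_lam_pos (hx : x ∈ D.M) (q : D.FinPole) :
    ((Place.fin (pos x q)).expand (pDeriv (lam x))).coeff (-deg q - 1) ≠ 0 := by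
  rw [Place.expand_pDeriv, ← order_lam_pos hx]
  change (dz _).coeff _ ≠ 0
  rw [dz_coeff_order]
  refine mul_ne_zero ?_ (HahnSeries.coeff_order_eq_zero.not.2 (Place.expand_ne_zero _ (lam_ne_zero x)))
  rw [order_lam_pos hx]
  have := deg_cases q
  have h : -deg q ≠ 0 := by omega
  exact_mod_cast h

lemma ordGE_pDeriv_lam_inf (x : D.Param) :
    OrdGE (Place.inf.expand (pDeriv (lam x))) (1 - D.n) := by
  rw [Place.expand_pDeriv, Place.dp, ← HahnSeries.single_neg]
  have := (ordGE_single (-1) 2).mul (ordGE_order (Place.inf.expand (lam x))).dz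
  rw [order_lam_inf] at this
  exact this.mono (by omega)

lemma coeff_pDeriv_lam_inf (x : D.Param) :
    (Place.inf.expand (pDeriv (lam x))).coeff (1 - D.n) ≠ 0 := by
  rw [Place.expand_pDeriv, Place.dp, ← HahnSeries.single_neg]
  have := coeff_mul_lead (ordGE_single (-1) 2) (ordGE_order (Place.inf.expand (lam x))).dz
  rw [dz_coeff_order, order_lam_inf, HahnSeries.coeff_single_same] at this
  rw [show (1 - D.n : ℤ) = 2 + (-D.n - 1) by ring, this]
  refine mul_ne_zero (by norm_num) (mul_ne_zero ?_ ?_)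
  · have := D.n_pos
    have h : -(D.n : ℤ) ≠ 0 := by omega
    exact_mod_cast h
  · rw [← order_lam_inf x]
    exact HahnSeries.coeff_order_eq_zero.not.2 (Place.expand_ne_zero _ (lam_ne_zero x))

lemma pDeriv_lam_ne_zero (x : D.Param) : pDeriv (lam x) ≠ 0 := by
  intro h
  apply coeff_pDeriv_lam_inf x
  rw [h, Place.expand_zero]; rfl

/-! ### Tangent vectors -/

/-- The logarithmic derivative `(D_ξ λ) / λ`. -/
def logTangent (x ξ : D.Param) : RatFunc ℂ :=
  ∑ i, RatFunc.C (-a ξ i) * (RatFunc.X - RatFunc.C (a x i))⁻¹ +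
    ∑ q, RatFunc.C (deg q * pos ξ q) * (RatFunc.X - RatFunc.C (pos x q))⁻¹

lemma tangent_eq (x ξ : D.Param) : tangent x ξ = lam x * logTangent x ξ := by
  rw [logTangent, sum_finPole (D := D) _ (fun o => match o with
    | none => 0
    | some j => RatFunc.C (D.m j * v ξ j) * (RatFunc.X - RatFunc.C (v x j))⁻¹)]
  · rw [tangent, mul_add, Finset.mul_sum, zero_add, Finset.mul_sum]
    congr 1
    · refine Finset.sum_congr rfl fun i _ => ?_
      rw [map_neg]; ring
    · refine Finset.sum_congr rfl fun i _ => ?_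
      simp only [map_mul]; ring
  · rintro ⟨_ | _, h⟩
    · simp [pos]
    · rfl
  · intro _; rfl

variable (x) in
/-- The linear map `ξ ↦ p^{-s} D_ξ λ`. -/
def ztan : D.Param →ₗ[ℂ] RatFunc ℂ where
  toFun ξ := RatFunc.X ^ (-(D.s : ℤ)) * tangent x ξ
  map_add' ξ η := by
    rw [← mul_add, tangent_eq, tangent_eq, tangent_eq, ← mul_add]
    congr 2
    have h1 : ∀ i, a (ξ + η) i = a ξ i + a η i := fun i => rfl
    have h2 : ∀ q, pos (ξ + η) q = pos ξ q + pos η q := by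
      rintro ⟨_ | j, h⟩
      · simp [pos]
      · rfl
    simp only [logTangent, h1, h2, map_mul, map_neg, map_add, mul_add, add_mul, neg_add,
      Finset.sum_add_distrib]
    ring
  map_smul' c ξ := by
    have h1 : ∀ i, a (c • ξ) i = c * a ξ i := fun i => rfl
    have h2 : ∀ q, pos (c • ξ) q = c * pos ξ q := by
      rintro ⟨_ | j, h⟩
      · simp [pos]
      · rfl
    rw [RingHom.id_apply, RatFunc.smul_eq_C_mul, mul_left_comm, tangent_eq, tangent_eq]
    rw [mul_left_comm (RatFunc.C c) (lam x)]
    congr 2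
    simp only [logTangent, h1, h2, map_mul, map_neg, mul_add, Finset.mul_sum]
    congr 1 <;> refine Finset.sum_congr rfl fun i _ => by ring

lemma ztan_apply (x ξ : D.Param) : ztan x ξ = RatFunc.X ^ (-(D.s : ℤ)) * tangent x ξ := rfl

lemma rres_simple (c b : ℂ) (r : ℂ) : (Place.fin c).rres
    (RatFunc.C r * (RatFunc.X - RatFunc.C b)⁻¹) = if c = b then r else 0 := by
  rw [Place.rres_C_mul]
  split_ifs with h
  · subst h
    have : (RatFunc.X - RatFunc.C c)⁻¹ = (Place.fin c).unif ^ (-1 : ℤ) := by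
      rw [zpow_neg_one]; rfl
    rw [this, Place.rres, Place.expand_unif_zpow, Place.res, HahnSeries.coeff_single_same, mul_one]
  · rw [Place.rres_fin_eq_zero, mul_zero]
    have := Place.order_X_sub_C_zpow_fin h (-1)
    rw [zpow_neg_one] at this
    exact (ordGE_order _).mono this.ge

lemma ztan_injective (hx : x ∈ D.M) : Function.Injective (ztan x) := by
  rw [injective_iff_map_eq_zero]
  intro ξ h
  rw [ztan_apply, tangent_eq] at h
  have h0 : logTangent x ξ = 0 := by
    rcases mul_eq_zero.1 h with h | h
    · exact absurd h (zpow_ne_zero _ RatFunc.X_ne_zero)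
    · exact (mul_eq_zero.1 h).resolve_left (lam_ne_zero x)
  have hr : ∀ c, (Place.fin c).rres (logTangent x ξ) =
      ∑ i, (if c = a x i then -a ξ i else 0) + ∑ q, if c = pos x q then deg q * pos ξ q else 0 := by
    intro c
    rw [logTangent, Place.rres_add, Place.rres_sum, Place.rres_sum]
    simp only [rres_simple]
  simp only [h0, Place.rres_zero] at hr
  refine Subtype.ext (Prod.ext (funext fun i => ?_) (funext fun j => ?_))
  · have := hr (a x i)
    rw [Finset.sum_eq_single i, if_pos rfl, Finset.sum_eq_zero, add_zero] at this
    · exact neg_eq_zero.1 this.symm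
    · exact fun q _ => if_neg (a_ne_pos hx i q)
    · exact fun i' _ hi => if_neg (hx.1.ne hi.symm)
    · simp
  · let q : D.FinPole := ⟨some j, by simp⟩
    have := hr (pos x q)
    rw [Finset.sum_eq_zero, Finset.sum_eq_single q, if_pos rfl, zero_add] at this
    · rcases mul_eq_zero.1 this.symm with h | h
      · have := deg_cases q
        have h' : deg q ≠ 0 := by omega
        exact absurd h (by exact_mod_cast h')
      · exact h
    · exact fun q' _ hq => if_neg ((pos_injective hx).ne hq.symm)
    · simp
    · exact fun i _ => if_neg (a_ne_pos hx i q).symm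

variable (x) in
/-- The rational functions `p^{-s} X`, with `X` tangent at `λ`, characterized by their poles. -/
structure IsTan (Z : RatFunc ℂ) : Prop where
  unmarked : ∀ c, (∀ q, pos x q ≠ c) → OrdGE ((Place.fin c).expand Z) 0
  pole : ∀ q, OrdGE ((Place.fin (pos x q)).expand Z) (-deg q - 1)
  inf : OrdGE (Place.inf.expand Z) (2 - D.n)

lemma order_X_zpow_fin {c : ℂ} (hc : c ≠ 0) (k : ℤ) :
    ((Place.fin c).expand (RatFunc.X ^ k)).order = 0 := by
  have := Place.order_X_sub_C_zpow_fin hc k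
  rwa [map_zero, sub_zero] at this

lemma ordGE_Xs_fin {c : ℂ} (hc : D.s = 1 → c ≠ 0) :
    OrdGE ((Place.fin c).expand (RatFunc.X ^ (-(D.s : ℤ)))) 0 := by
  rcases D.s_eq with h | h
  · rw [h]
    simpa [Place.expand_one] using ordGE_one
  · exact (ordGE_order _).mono (order_X_zpow_fin (hc h) _).ge

lemma ordGE_Xs_pos_none {q : D.FinPole} (hq : q.1 = none) (x : D.Param) :
    OrdGE ((Place.fin (pos x q)).expand (RatFunc.X ^ (-(D.s : ℤ)))) (-1) := by
  have hp : pos x q = 0 := by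
    obtain ⟨_ | j, h⟩ := q
    · rfl
    · simp at hq
  have : RatFunc.X ^ (-(D.s : ℤ)) = (Place.fin (pos x q)).unif ^ (-1 : ℤ) := by
    rw [q.2 hq, Place.unif, hp, map_zero, sub_zero]; rfl
  rw [this, Place.expand_unif_zpow]
  exact ordGE_single _ _

lemma pos_ne_zero_of_some (hx : x ∈ D.M) {q : D.FinPole} (hq : q.1 ≠ none) (hs : D.s = 1) :
    pos x q ≠ 0 := by
  obtain ⟨_ | j, h⟩ := q
  · exact absurd rfl hq
  · exact (hx.2.2.2 hs).2 j

lemma unmarked_ne_zero {c : ℂ} (hc : ∀ q, pos x q ≠ c) (hs : D.s = 1) : c ≠ 0 :=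
  (hc ⟨none, fun _ => hs⟩).symm

lemma expand_Xs_inf : Place.inf.expand (RatFunc.X ^ (-(D.s : ℤ))) = HahnSeries.single (D.s : ℤ) 1 := by
  rw [← inv_zpow', ← Place.expand_unif_zpow]; rfl

lemma ordGE_inv_X_sub_C_inf (b : ℂ) : OrdGE (Place.inf.expand (RatFunc.X - RatFunc.C b)⁻¹) 1 := by
  rw [Place.expand_inv]
  exact (Place.ordGE_X_sub_C_inf b).inv (by rw [Place.coeff_X_sub_C_inf]; exact one_ne_zero)

lemma coeff_inv_X_sub_C_inf (b : ℂ) :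
    (Place.inf.expand (RatFunc.X - RatFunc.C b)⁻¹).coeff 1 = 1 := by
  rw [Place.expand_inv]
  have := coeff_inv_lead (Place.ordGE_X_sub_C_inf b)
    (by rw [Place.coeff_X_sub_C_inf]; exact one_ne_zero)
  rwa [Place.coeff_X_sub_C_inf, inv_one] at this

lemma rres_inf_simple (b r : ℂ) : Place.inf.rres (RatFunc.C r * (RatFunc.X - RatFunc.C b)⁻¹) = r := by
  rw [Place.rres_C_mul, Place.rres, Place.res, coeff_inv_X_sub_C_inf, mul_one]

lemma ordGE_logTangent_inf (x ξ : D.Param) :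
    OrdGE (Place.inf.expand (logTangent x ξ)) (2 - D.s) := by
  have h1 : OrdGE (Place.inf.expand (logTangent x ξ)) 1 := by
    rw [logTangent, Place.expand_add, Place.expand_sum, Place.expand_sum]
    exact (ordGE_sum _ _ fun i _ => Place.OrdGE.C_mul _ (ordGE_inv_X_sub_C_inf _)).add
      (ordGE_sum _ _ fun i _ => Place.OrdGE.C_mul _ (ordGE_inv_X_sub_C_inf _))
  rcases D.s_eq with hs | hs
  · intro k hk
    rcases lt_or_eq_of_le (show k ≤ 1 by omega) with h | rfl
    · exact h1 k h
    · change Place.inf.rres (logTangent x ξ) = 0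
      rw [logTangent, Place.rres_add, Place.rres_sum, Place.rres_sum]
      simp only [rres_inf_simple]
      rw [sum_finPole (D := D) _ (fun o => match o with | none => 0 | some j => (D.m j : ℂ) * v ξ j)]
      · have := ξ.2 hs
        simp only [Finset.sum_neg_distrib, zero_add]
        rw [neg_add_eq_zero]
        exact this
      · rintro ⟨_ | _, h⟩
        · simp [pos]
        · rfl
      · intro _; rfl
  · exact h1.mono (by omega)

lemma isTan_ztan (hx : x ∈ D.M) (ξ : D.Param) : IsTan x (ztan x ξ) := by
  refine ⟨fun c hc => ?_, fun q => ?_, ?_⟩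
  · rw [ztan_apply, Place.expand_mul, tangent_eq, logTangent, mul_add, Finset.mul_sum,
      Finset.mul_sum, Place.expand_add, Place.expand_sum, Place.expand_sum]
    have h1 := ordGE_Xs_fin (D := D) (c := c) (fun hs => unmarked_ne_zero hc hs)
    rw [show (0 : ℤ) = 0 + 0 by rfl]
    refine h1.mul (.add (ordGE_sum _ _ fun i _ => ?_) (ordGE_sum _ _ fun q _ => ?_))
    · rw [mul_left_comm]
      refine Place.OrdGE.C_mul _ ?_
      refine (ordGE_order _).mono ?_
      rw [Place.expand_mul, Place.expand_inv, HahnSeries.order_mul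
        (Place.expand_ne_zero _ (lam_ne_zero x))
        (inv_ne_zero (Place.expand_ne_zero _ (X_sub_C_ne_zero' _))),
        order_inv' (Place.expand_ne_zero _ (X_sub_C_ne_zero' _)), order_lam_unmarked hc,
        ← Finset.add_sum_erase _ _ (Finset.mem_univ i), add_right_comm, add_neg_cancel, zero_add]
      exact Finset.sum_nonneg fun i _ => (Place.ordGE_X_sub_C_fin c _).le_order
        (Place.expand_ne_zero _ (X_sub_C_ne_zero' _))
    · rw [mul_left_comm]
      refine Place.OrdGE.C_mul _ ?_
      rw [Place.expand_mul, show (0 : ℤ) = 0 + 0 by rfl]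
      refine (ordGE_lam_unmarked hc).mul ((ordGE_order _).mono ?_)
      have := Place.order_X_sub_C_zpow_fin (hc q).symm (-1)
      rw [zpow_neg_one] at this
      exact this.ge
  · have hlam := (ordGE_order ((Place.fin (pos x q)).expand (lam x)))
    rw [order_lam_pos hx] at hlam
    rw [ztan_apply, Place.expand_mul, tangent_eq, Place.expand_mul, logTangent]
    have hinv : ∀ b, pos x q ≠ b →
        OrdGE ((Place.fin (pos x q)).expand (RatFunc.X - RatFunc.C b)⁻¹) 0 := fun b hb => by
      have := Place.order_X_sub_C_zpow_fin hb (-1)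
      rw [zpow_neg_one] at this
      exact (ordGE_order _).mono this.ge
    have hinv' : ∀ b,
        OrdGE ((Place.fin (pos x q)).expand (RatFunc.X - RatFunc.C b)⁻¹) (-1) := fun b => by
      rcases eq_or_ne (pos x q) b with rfl | hb
      · have : (RatFunc.X - RatFunc.C (pos x q))⁻¹ = (Place.fin (pos x q)).unif ^ (-1 : ℤ) := by
          rw [zpow_neg_one]; rfl
        rw [this, Place.expand_unif_zpow]
        exact ordGE_single _ _
      · exact (hinv b hb).mono (by norm_num)
    by_cases hq : q.1 = none
    · have h1 := ordGE_Xs_pos_none hq x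
      refine (h1.mul (hlam.mul (b := 0) ?_)).mono (by omega)
      rw [Place.expand_add, Place.expand_sum, Place.expand_sum]
      refine .add (ordGE_sum _ _ fun i _ => Place.OrdGE.C_mul _ (hinv _ (a_ne_pos hx i q).symm))
        (ordGE_sum _ _ fun q' _ => ?_)
      rcases eq_or_ne q' q with rfl | hne
      · have : pos ξ q' = 0 := by
          obtain ⟨_ | j, h⟩ := q'
          · rfl
          · simp at hq
        rw [this, mul_zero, map_zero, zero_mul, Place.expand_zero]
        exact ordGE_zero
      · exact Place.OrdGE.C_mul _ (hinv _ ((pos_injective hx).ne hne.symm))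
    · have h1 := ordGE_Xs_fin (D := D) (c := pos x q) (pos_ne_zero_of_some hx hq)
      refine (h1.mul (hlam.mul (b := -1) ?_)).mono (by omega)
      rw [Place.expand_add, Place.expand_sum, Place.expand_sum]
      exact .add (ordGE_sum _ _ fun i _ => Place.OrdGE.C_mul _ (hinv' _))
        (ordGE_sum _ _ fun q' _ => Place.OrdGE.C_mul _ (hinv' _))
  · rw [ztan_apply, Place.expand_mul, tangent_eq, Place.expand_mul, expand_Xs_inf]
    have hlam := (ordGE_order (Place.inf.expand (lam x)))
    rw [order_lam_inf] at hlam
    exact ((ordGE_single _ _).mul (hlam.mul (ordGE_logTangent_inf x ξ))).mono (by omega)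

end Shape
end FlatCoord
end


noncomputable section
namespace FlatCoord
open Polynomial
namespace Shape

variable {D : Shape} {x : D.Param}

/-! ### Dimension count -/

lemma N_le_finrank : D.N ≤ Module.finrank ℂ D.Param := by
  have hV : Module.finrank ℂ ((Fin D.L → ℂ) × (Fin D.K → ℂ)) = D.L + D.K := by simp
  rcases D.s_eq with hs | hs
  · let φ : ((Fin D.L → ℂ) × (Fin D.K → ℂ)) →ₗ[ℂ] ℂ :=
      (∑ i, LinearMap.proj i) ∘ₗ LinearMap.fst ℂ _ _ -
        (∑ j, (D.m j : ℂ) • LinearMap.proj j) ∘ₗ LinearMap.snd ℂ _ _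
    have hk : LinearMap.ker φ = D.Param := by
      ext y
      rw [LinearMap.mem_ker]
      change φ y = 0 ↔ (D.s = 0 → ∑ i, y.1 i = ∑ j, (D.m j : ℂ) * y.2 j)
      simp [φ, hs, sub_eq_zero]
    have h1 := LinearMap.finrank_range_add_finrank_ker φ
    have h2 := Submodule.finrank_le (LinearMap.range φ)
    rw [Module.finrank_self] at h2
    rw [hV, hk] at h1
    have : D.N = D.K + D.L + D.s - 1 := rfl
    omega
  · have : D.Param = ⊤ := by
      rw [eq_top_iff]
      intro y _ h
      omega
    rw [this, finrank_top, hV]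
    have : D.N = D.K + D.L + D.s - 1 := rfl
    omega

variable (x) in
/-- The common denominator `∏_q (p - q)^{m_q + 1}`. -/
def comDenom : RatFunc ℂ := ∏ q, (RatFunc.X - RatFunc.C (pos x q)) ^ (deg q + 1)

lemma comDenom_ne_zero (x : D.Param) : comDenom x ≠ 0 :=
  Finset.prod_ne_zero_iff.2 fun _ _ => zpow_ne_zero _ (X_sub_C_ne_zero' _)

lemma order_comDenom (x : D.Param) (ν : Place) : (ν.expand (comDenom x)).order =
    ∑ q, (deg q + 1) * (ν.expand (RatFunc.X - RatFunc.C (pos x q))).order := by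
  rw [comDenom, Place.expand_prod, order_prod']
  · refine Finset.sum_congr rfl fun q _ => ?_
    rw [Place.expand_zpow, order_zpow' (Place.expand_ne_zero _ (X_sub_C_ne_zero' _))]
  · exact fun q _ => Place.expand_ne_zero _ (zpow_ne_zero _ (X_sub_C_ne_zero' _))

lemma order_comDenom_inf (x : D.Param) :
    (Place.inf.expand (comDenom x)).order = D.n - 1 - D.N := by
  rw [order_comDenom]
  simp only [Place.order_X_sub_C_inf]
  rw [← Finset.sum_mul, sum_deg_add_one]; ring

lemma order_comDenom_pos (hx : x ∈ D.M) (q : D.FinPole) :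
    ((Place.fin (pos x q)).expand (comDenom x)).order = deg q + 1 := by
  rw [order_comDenom, Finset.sum_eq_single q, Place.order_X_sub_C_fin_self]
  · ring
  · intro q' _ hq
    rw [Place.order_X_sub_C_fin ((pos_injective hx).ne hq.symm), mul_zero]
  · simp

lemma order_comDenom_unmarked {c : ℂ} (hc : ∀ q, pos x q ≠ c) :
    ((Place.fin c).expand (comDenom x)).order = 0 := by
  rw [order_comDenom]
  refine Finset.sum_eq_zero fun q _ => ?_
  rw [Place.order_X_sub_C_fin (hc q).symm, mul_zero]

lemma IsTan.exists_polynomial (hx : x ∈ D.M) {Z : RatFunc ℂ} (hZ : IsTan x Z) :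
    ∃ f ∈ degreeLT ℂ D.N, Z * comDenom x = algebraMap ℂ[X] (RatFunc ℂ) f := by
  obtain ⟨f, hf⟩ := Place.exists_polynomial_of_regular (f := Z * comDenom x) (by
    intro c
    rw [Place.expand_mul]
    by_cases hc : ∀ q, pos x q ≠ c
    · have h := ordGE_order ((Place.fin c).expand (comDenom x))
      rw [order_comDenom_unmarked hc] at h
      exact (hZ.unmarked c hc).mul h
    · push Not at hc
      obtain ⟨q, rfl⟩ := hc
      have h := ordGE_order ((Place.fin (pos x q)).expand (comDenom x))
      rw [order_comDenom_pos hx] at h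
      exact ((hZ.pole q).mul h).mono (by omega))
  refine ⟨f, ?_, hf⟩
  have h := ordGE_order (Place.inf.expand (comDenom x))
  rw [order_comDenom_inf] at h
  have h2 := hZ.inf.mul h
  rw [← Place.expand_mul, hf] at h2
  exact Place.degree_lt_of_ordGE_inf (by omega) h2

lemma finrank_and_range_ztan (hx : x ∈ D.M) : Module.finrank ℂ D.Param = D.N ∧
    ∀ Z, IsTan x Z → ∃ ξ, ztan x ξ = Z := by
  let ψ : degreeLT ℂ D.N →ₗ[ℂ] RatFunc ℂ :=
    LinearMap.mulRight ℂ (comDenom x)⁻¹ ∘ₗ (Algebra.linearMap ℂ[X] (RatFunc ℂ)).restrictScalars ℂ ∘ₗ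
      (degreeLT ℂ D.N).subtype
  have hψ : ∀ Z, IsTan x Z → Z ∈ LinearMap.range ψ := by
    intro Z hZ
    obtain ⟨f, hf, h⟩ := hZ.exists_polynomial hx
    refine ⟨⟨f, hf⟩, ?_⟩
    change algebraMap ℂ[X] (RatFunc ℂ) f * (comDenom x)⁻¹ = Z
    rw [← h, mul_assoc, mul_inv_cancel₀ (comDenom_ne_zero x), mul_one]
  have hle : LinearMap.range (ztan x) ≤ LinearMap.range ψ := by
    rintro _ ⟨ξ, rfl⟩
    exact hψ _ (isTan_ztan hx ξ)
  have hdim : Module.finrank ℂ (degreeLT ℂ D.N) = D.N := by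
    rw [(degreeLTEquiv ℂ D.N).finrank_eq]; simp
  have : FiniteDimensional ℂ (degreeLT ℂ D.N) := (degreeLTEquiv ℂ D.N).symm.finiteDimensional
  have h1 : Module.finrank ℂ (LinearMap.range ψ) ≤ D.N := (LinearMap.finrank_range_le ψ).trans hdim.le
  have h2 : Module.finrank ℂ (LinearMap.range (ztan x)) = Module.finrank ℂ D.Param :=
    LinearMap.finrank_range_of_inj (ztan_injective hx)
  have h3 := Submodule.finrank_mono hle
  have h4 := N_le_finrank (D := D)
  have heq := Submodule.eq_of_le_of_finrank_le hle (by omega)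
  refine ⟨by omega, fun Z hZ => ?_⟩
  have := hψ Z hZ
  rwa [← heq] at this

lemma IsTan.exists_tangent (hx : x ∈ D.M) {Z : RatFunc ℂ} (hZ : IsTan x Z) : ∃ ξ, ztan x ξ = Z :=
  (finrank_and_range_ztan hx).2 Z hZ

/-! ### Representatives of covectors -/

lemma represents_iff {ν : D.Marked} {α : RatFunc ℂ} {ω : D.Param →L[ℂ] ℂ} :
    Represents ν x α ω ↔ ∀ ξ, ω ξ = (place x ν).rres (α * ztan x ξ) := by
  refine forall_congr' fun ξ => ?_
  rw [Place.tr_expand, ztan_apply, mul_left_comm]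

variable (x) in
/-- The monomials spanning the standard representatives of covectors. -/
def monoRep (ν : D.Marked) (k : ℕ) : RatFunc ℂ :=
  match ν with
  | none => Place.inf.unif ^ ((D.n : ℤ) - 1 - k)
  | some q => (Place.fin (pos x q)).unif ^ (deg q - k)

lemma rres_unif_zpow_mul_inf (i : ℤ) (Z : RatFunc ℂ) :
    Place.inf.rres (Place.inf.unif ^ i * Z) = (Place.inf.expand Z).coeff (1 - i) := by
  rw [Place.rres, Place.expand_mul, Place.expand_unif_zpow, Place.res]
  have := HahnSeries.coeff_single_mul_add (r := (1 : ℂ)) (x := Place.inf.expand Z) (a := 1 - i) (b := i)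
  rwa [sub_add_cancel, one_mul] at this

lemma rres_unif_zpow_mul_fin (c : ℂ) (i : ℤ) (Z : RatFunc ℂ) :
    (Place.fin c).rres ((Place.fin c).unif ^ i * Z) =
      ((Place.fin c).expand Z).coeff (-1 - i) := by
  rw [Place.rres, Place.expand_mul, Place.expand_unif_zpow, Place.res]
  have := HahnSeries.coeff_single_mul_add (r := (1 : ℂ)) (x := (Place.fin c).expand Z)
    (a := -1 - i) (b := i)
  rwa [sub_add_cancel, one_mul] at this

lemma IsTan.eq_zero_of_pairing (hx : x ∈ D.M) (ν : D.Marked) {Z : RatFunc ℂ} (hZ : IsTan x Z)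
    (h : ∀ k < D.N, (place x ν).rres (monoRep x ν k * Z) = 0) : Z = 0 := by
  obtain ⟨f, hf, hfZ⟩ := hZ.exists_polynomial hx
  suffices f = 0 by
    rw [this, map_zero] at hfZ
    exact (mul_eq_zero.1 hfZ).resolve_right (comDenom_ne_zero x)
  have hdeg := hf
  rw [mem_degreeLT] at hdeg
  cases ν with
  | none =>
    have h1 : OrdGE (Place.inf.expand Z) (2 - D.n + D.N) := by
      intro k hk
      by_cases hk2 : k < 2 - D.n
      · exact hZ.inf k hk2
      · obtain ⟨j, hj⟩ := Int.eq_ofNat_of_zero_le (a := k - (2 - D.n)) (by omega)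
        have := h j (by omega)
        change Place.inf.rres (Place.inf.unif ^ ((D.n : ℤ) - 1 - j) * Z) = 0 at this
        rw [rres_unif_zpow_mul_inf] at this
        rwa [show k = 1 - ((D.n : ℤ) - 1 - j) by omega]
    have h2 := ordGE_order (Place.inf.expand (comDenom x))
    rw [order_comDenom_inf] at h2
    have h3 := h1.mul h2
    rw [← Place.expand_mul, hfZ, Place.expand_algebraMap] at h3
    ext k
    rw [← coeff_eval₂_single (e := -1) (by norm_num), coeff_zero]
    exact h3 _ (by omega)
  | some q =>
    have h1 : OrdGE ((Place.fin (pos x q)).expand Z) (-deg q - 1 + D.N) := by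
      intro k hk
      by_cases hk2 : k < -deg q - 1
      · exact hZ.pole q k hk2
      · obtain ⟨j, hj⟩ := Int.eq_ofNat_of_zero_le (a := k - (-deg q - 1)) (by omega)
        have := h j (by omega)
        change (Place.fin (pos x q)).rres ((Place.fin (pos x q)).unif ^ (deg q - j) * Z) = 0 at this
        rw [rres_unif_zpow_mul_fin] at this
        rwa [show k = -1 - (deg q - j) by omega]
    have h2 := ordGE_order ((Place.fin (pos x q)).expand (comDenom x))
    rw [order_comDenom_pos hx] at h2
    have h3 := h1.mul h2
    rw [← Place.expand_mul, hfZ, Place.expand_algebraMap, Place.eval₂_fin] at h3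
    have h4 : f.comp (X + C (pos x q)) = 0 := by
      by_contra hne
      have hd : (f.comp (X + C (pos x q))).natDegree = f.natDegree := by
        rw [natDegree_comp, natDegree_X_add_C, mul_one]
      have hf0 : f ≠ 0 := by rintro rfl; simp at hne
      have hlt : (f.comp (X + C (pos x q))).natDegree < D.N := by
        rw [hd]
        exact (natDegree_lt_iff_degree_lt hf0).2 hdeg
      apply leadingCoeff_ne_zero.2 hne
      rw [leadingCoeff, ← coeff_eval₂_single one_ne_zero]
      exact h3 _ (by omega)
    have h5 := congrArg (fun r => r.comp (X - C (pos x q))) h4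
    simpa [comp_assoc] using h5

lemma X_sub_C_pos_zpow_mem_alg (q : D.FinPole) (i : ℤ) :
    (RatFunc.X - RatFunc.C (pos x q)) ^ i ∈ alg x := by
  have hX : RatFunc.X ∈ alg x := Algebra.subset_adjoin (by simp)
  have hX' : RatFunc.X⁻¹ ∈ alg x := Algebra.subset_adjoin (by simp)
  have hC : ∀ c, RatFunc.C c ∈ alg x := fun c => (alg x).algebraMap_mem c
  have h2 : (RatFunc.X - RatFunc.C (pos x q))⁻¹ ∈ alg x := by
    obtain ⟨_ | j, h⟩ := q
    · simpa [pos] using hX'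
    · exact Algebra.subset_adjoin (Or.inr ⟨j, rfl⟩)
  obtain ⟨j, rfl | rfl⟩ := i.eq_nat_or_neg
  · rw [zpow_natCast]; exact pow_mem (sub_mem hX (hC _)) _
  · rw [zpow_neg, zpow_natCast, ← inv_pow]; exact pow_mem h2 _

lemma monoRep_mem_alg (ν : D.Marked) (k : ℕ) : monoRep x ν k ∈ alg x := by
  have hX : RatFunc.X ∈ alg x := Algebra.subset_adjoin (by simp)
  have hX' : RatFunc.X⁻¹ ∈ alg x := Algebra.subset_adjoin (by simp)
  cases ν with
  | none =>
    rw [monoRep, Place.unif]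
    obtain ⟨j, h | h⟩ := ((D.n : ℤ) - 1 - k).eq_nat_or_neg
    · rw [h, zpow_natCast]; exact pow_mem hX' _
    · rw [h, zpow_neg, zpow_natCast, inv_pow, inv_inv]; exact pow_mem hX _
  | some q => exact X_sub_C_pos_zpow_mem_alg q _

lemma exists_represents (hx : x ∈ D.M) (ν : D.Marked) (ω : D.Param →L[ℂ] ℂ) :
    ∃ α ∈ alg x, Represents ν x α ω := by
  let E : D.Param →ₗ[ℂ] (Fin D.N → ℂ) :=
    { toFun := fun ξ k => (place x ν).rres (monoRep x ν k * ztan x ξ)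
      map_add' := fun ξ η => by
        ext k
        rw [map_add, mul_add, Place.rres_add]; rfl
      map_smul' := fun c ξ => by
        ext k
        rw [map_smul, RatFunc.smul_eq_C_mul, mul_left_comm, Place.rres_C_mul]; rfl }
  have hE : LinearMap.ker E = ⊥ := by
    rw [LinearMap.ker_eq_bot']
    intro ξ hξ
    apply ztan_injective hx
    rw [map_zero]
    exact (isTan_ztan hx ξ).eq_zero_of_pairing hx ν fun k hk => congrFun hξ ⟨k, hk⟩
  obtain ⟨r, hr⟩ := LinearMap.exists_leftInverse_of_injective E hE
  let φ : (Fin D.N → ℂ) →ₗ[ℂ] ℂ := (ω : D.Param →ₗ[ℂ] ℂ) ∘ₗ r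
  refine ⟨∑ k : Fin D.N, RatFunc.C (φ (Pi.single k 1)) * monoRep x ν k, ?_, ?_⟩
  · exact sum_mem fun k _ => mul_mem ((alg x).algebraMap_mem _) (monoRep_mem_alg ν k)
  · rw [represents_iff]
    intro ξ
    have h1 : ω ξ = φ (E ξ) := by
      have := LinearMap.congr_fun hr ξ
      simp only [LinearMap.comp_apply, LinearMap.id_apply] at this
      simp [φ, this]
    rw [h1, LinearMap.pi_apply_eq_sum_univ φ (E ξ), Finset.sum_mul, Place.rres_sum]
    refine Finset.sum_congr rfl fun k _ => ?_
    rw [mul_assoc, Place.rres_C_mul, smul_eq_mul, mul_comm]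
    congr 2
    ext j
    simp [Pi.single_apply, eq_comm]

/-! ### The metric -/

/-- The function `p^{-s} X` for the tangent vector `X` dual to the covector represented by `α`. -/
def sharp (ν : D.Marked) (x : D.Param) (α : RatFunc ℂ) : RatFunc ℂ :=
  (place x ν).nonneg (pDeriv (lam x) * α) - pDeriv (lam x) * (place x ν).nonneg α

lemma sharp_eq (ν : D.Marked) (x : D.Param) (α : RatFunc ℂ) : sharp ν x α =
    pDeriv (lam x) * (place x ν).neg α - (place x ν).neg (pDeriv (lam x) * α) := by
  rw [sharp, Place.neg, Place.neg]; ring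

lemma traceForm_eq (ν : D.Marked) (x : D.Param) (α β : RatFunc ℂ) :
    traceForm ν x α β = (place x ν).rres (sharp ν x α * β) := by
  have h : RatFunc.X ^ (-(D.s : ℤ)) * mul ν x α β =
      (place x ν).nonneg (pDeriv (lam x) * α) * β -
        α * (place x ν).neg (pDeriv (lam x) * β) := by
    have hX : (RatFunc.X : RatFunc ℂ) ^ (-(D.s : ℤ)) * RatFunc.X ^ D.s = 1 := by
      rw [zpow_neg, zpow_natCast, inv_mul_cancel₀ (pow_ne_zero _ RatFunc.X_ne_zero)]
    rw [mul, Place.neg]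
    linear_combination ((place x ν).nonneg (pDeriv (lam x) * α) * β +
      α * (place x ν).nonneg (pDeriv (lam x) * β) - pDeriv (lam x) * α * β) * hX
  rw [traceForm, Place.tr_expand, h, Place.rres_sub, Place.rres_mul_neg, ← Place.rres_sub, sharp]
  congr 1; ring

lemma traceForm_comm (ν : D.Marked) (x : D.Param) (α β : RatFunc ℂ) :
    traceForm ν x α β = traceForm ν x β α := by
  rw [traceForm, traceForm]
  congr 2
  rw [mul, mul]; ring

lemma isTan_sharp (hx : x ∈ D.M) (ν : D.Marked) (α : RatFunc ℂ) : IsTan x (sharp ν x α) := by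
  have hn := D.n_pos
  cases ν with
  | none =>
    have hreg : ∀ c e, e ≤ 0 → OrdGE ((Place.fin c).expand (pDeriv (lam x))) e →
        OrdGE ((Place.fin c).expand (sharp none x α)) e := by
      intro c e he h
      rw [sharp, place, Place.expand_sub, Place.expand_mul]
      exact ((Place.ordGE_nonneg_inf_fin c _).mono he).sub
        ((h.mul (Place.ordGE_nonneg_inf_fin c α)).mono (by omega))
    refine ⟨fun c hc => hreg c 0 le_rfl (ordGE_pDeriv_lam_unmarked hc), fun q => ?_, ?_⟩
    · have := deg_cases q
      exact hreg _ _ (by omega) (ordGE_pDeriv_lam_pos hx q)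
    · rw [sharp_eq, place, Place.expand_sub, Place.expand_mul]
      exact (((ordGE_pDeriv_lam_inf x).mul (Place.ordGE_neg_inf α)).mono (by omega)).sub
        ((Place.ordGE_neg_inf _).mono (by omega))
  | some q =>
    have hreg : ∀ c e, c ≠ pos x q → e ≤ 0 → OrdGE ((Place.fin c).expand (pDeriv (lam x))) e →
        OrdGE ((Place.fin c).expand (sharp (some q) x α)) e := by
      intro c e hc he h
      rw [sharp_eq, place, Place.expand_sub, Place.expand_mul]
      exact ((h.mul (Place.ordGE_neg_fin_fin hc α)).mono (by omega)).sub
        ((Place.ordGE_neg_fin_fin hc _).mono he)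
    refine ⟨fun c hc => hreg c 0 (hc q).symm le_rfl (ordGE_pDeriv_lam_unmarked hc), fun q' => ?_, ?_⟩
    · have := deg_cases q'
      rcases eq_or_ne q' q with rfl | hne
      · rw [sharp, place, Place.expand_sub, Place.expand_mul]
        exact ((Place.ordGE_nonneg_fin _ _).mono (by omega)).sub
          (((ordGE_pDeriv_lam_pos hx q').mul (Place.ordGE_nonneg_fin _ α)).mono (by omega))
      · exact hreg _ _ ((pos_injective hx).ne hne) (by omega) (ordGE_pDeriv_lam_pos hx q')
    · rw [sharp_eq, place, Place.expand_sub, Place.expand_mul]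
      exact (((ordGE_pDeriv_lam_inf x).mul (Place.ordGE_neg_fin_inf _ α)).mono (by omega)).sub
        ((Place.ordGE_neg_fin_inf _ _).mono (by omega))

variable (x) in
/-- Minus the sum of the residues at the marked points; for a function regular at
the remaining points except at the zeros of `λ_p` it is the sum of the residues at these. -/
def totalRes (f : RatFunc ℂ) : ℂ := Place.inf.rres f - ∑ q, (Place.fin (pos x q)).rres f

lemma totalRes_sub (f g : RatFunc ℂ) : totalRes x (f - g) = totalRes x f - totalRes x g := by
  simp only [totalRes, Place.rres_sub, Finset.sum_sub_distrib]; ring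

lemma totalRes_eq_zero (hx : x ∈ D.M) {f : RatFunc ℂ}
    (h : ∀ c, (∀ q, pos x q ≠ c) → OrdGE ((Place.fin c).expand f) 0) : totalRes x f = 0 := by
  classical
  rw [totalRes, Place.rres_inf_eq_sum (Finset.univ.image (pos x)) f, Finset.sum_image, sub_self]
  · exact fun _ _ _ _ h => pos_injective hx h
  · intro c hc
    exact h c fun q hq => hc (Finset.mem_image.2 ⟨q, Finset.mem_univ _, hq⟩)

lemma ordGE_inv_pDeriv_lam_pos (hx : x ∈ D.M) (q : D.FinPole) :
    OrdGE ((Place.fin (pos x q)).expand (pDeriv (lam x))⁻¹) (deg q + 1) := by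
  rw [Place.expand_inv]
  exact ((ordGE_pDeriv_lam_pos hx q).inv (coeff_pDeriv_lam_pos hx q)).mono (by omega)

lemma ordGE_inv_pDeriv_lam_inf (x : D.Param) :
    OrdGE (Place.inf.expand (pDeriv (lam x))⁻¹) (D.n - 1) := by
  rw [Place.expand_inv]
  exact ((ordGE_pDeriv_lam_inf x).inv (coeff_pDeriv_lam_inf x)).mono (by omega)

lemma totalRes_sharp (hx : x ∈ D.M) (ν : D.Marked) (α : RatFunc ℂ) {Y : RatFunc ℂ}
    (hY : IsTan x Y) :
    totalRes x (sharp ν x α * Y * (pDeriv (lam x))⁻¹) = (place x ν).rres (α * Y) := by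
  have hl := pDeriv_lam_ne_zero x
  have hpole : ∀ q, OrdGE ((Place.fin (pos x q)).expand (Y * (pDeriv (lam x))⁻¹)) 0 := fun q => by
    rw [Place.expand_mul]
    exact ((hY.pole q).mul (ordGE_inv_pDeriv_lam_pos hx q)).mono (by omega)
  have hinf : OrdGE (Place.inf.expand (Y * (pDeriv (lam x))⁻¹)) 1 := by
    rw [Place.expand_mul]
    exact (hY.inf.mul (ordGE_inv_pDeriv_lam_inf x)).mono (by omega)
  cases ν with
  | none =>
    have h1 : sharp none x α * Y * (pDeriv (lam x))⁻¹ =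
        Place.inf.nonneg (pDeriv (lam x) * α) * (Y * (pDeriv (lam x))⁻¹) -
          Place.inf.nonneg α * Y := by
      rw [sharp, place]; field_simp
    rw [h1, totalRes_sub, totalRes_eq_zero hx (f := Place.inf.nonneg α * Y), sub_zero, totalRes,
      Finset.sum_eq_zero, sub_zero]
    · have h2 : Place.inf.nonneg (pDeriv (lam x) * α) * (Y * (pDeriv (lam x))⁻¹) =
          α * Y - Place.inf.neg (pDeriv (lam x) * α) * (Y * (pDeriv (lam x))⁻¹) := by
        rw [Place.neg]; field_simp; ring
      rw [h2, Place.rres_sub, Place.rres_inf_eq_zero (f := Place.inf.neg _ * _), sub_zero, place]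
      rw [Place.expand_mul]
      exact ((Place.ordGE_neg_inf _).mul hinf).mono (by omega)
    · intro q _
      apply Place.rres_fin_eq_zero
      rw [Place.expand_mul]
      exact ((Place.ordGE_nonneg_inf_fin _ _).mul (hpole q)).mono (by omega)
    · intro c hc
      rw [Place.expand_mul]
      exact (Place.ordGE_nonneg_inf_fin _ _).mul (hY.unmarked c hc)
  | some q =>
    have h1 : sharp (some q) x α * Y * (pDeriv (lam x))⁻¹ =
        (Place.fin (pos x q)).neg α * Y -
        (Place.fin (pos x q)).neg (pDeriv (lam x) * α) * (Y * (pDeriv (lam x))⁻¹) := by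
      rw [sharp_eq, place]; field_simp
    rw [h1, totalRes_sub, totalRes_eq_zero hx, zero_sub, totalRes, Place.rres_inf_eq_zero, zero_sub,
      neg_neg, Finset.sum_eq_single q]
    · have h2 : (Place.fin (pos x q)).neg (pDeriv (lam x) * α) * (Y * (pDeriv (lam x))⁻¹) =
          α * Y - (Place.fin (pos x q)).nonneg (pDeriv (lam x) * α) * (Y * (pDeriv (lam x))⁻¹) := by
        rw [Place.neg]; field_simp
      rw [h2, Place.rres_sub, Place.rres_fin_eq_zero (f := Place.nonneg _ _ * _), sub_zero, place]
      rw [Place.expand_mul]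
      exact ((Place.ordGE_nonneg_fin _ _).mul (hpole q)).mono (by omega)
    · intro q' _ hq
      apply Place.rres_fin_eq_zero
      rw [Place.expand_mul]
      exact ((Place.ordGE_neg_fin_fin ((pos_injective hx).ne hq) _).mul (hpole q')).mono (by omega)
    · simp
    · rw [Place.expand_mul]
      exact ((Place.ordGE_neg_fin_inf _ _).mul hinf).mono (by omega)
    · intro c hc
      rw [Place.expand_mul]
      exact (Place.ordGE_neg_fin_fin (hc q).symm _).mul (hY.unmarked c hc)

lemma IsTan.eq_zero_of_totalRes (hx : x ∈ D.M) {Z : RatFunc ℂ} (hZ : IsTan x Z)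
    (h : ∀ Y, IsTan x Y → totalRes x (Z * Y * (pDeriv (lam x))⁻¹) = 0) : Z = 0 := by
  refine hZ.eq_zero_of_pairing hx none fun k _ => ?_
  rw [← totalRes_sharp hx none _ hZ, ← h _ (isTan_sharp hx none (monoRep x none k))]
  congr 1; ring

/-- A covector is dual to the same tangent vector for all marked points. -/
lemma exists_sharp (hx : x ∈ D.M) (ω : D.Param →L[ℂ] ℂ) :
    ∃ ξ, (∀ ν α, Represents ν x α ω → sharp ν x α = ztan x ξ) ∧ (ξ = 0 → ω = 0) := by
  obtain ⟨α₀, -, h₀⟩ := exists_represents hx none ω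
  obtain ⟨ξ, hξ⟩ := (isTan_sharp hx none α₀).exists_tangent hx
  refine ⟨ξ, fun ν α h => ?_, ?_⟩
  · rw [hξ, ← sub_eq_zero]
    refine IsTan.eq_zero_of_totalRes hx ?_ fun Y hY => ?_
    · obtain ⟨ξ', hξ'⟩ := (isTan_sharp hx ν α).exists_tangent hx
      rw [← hξ, ← hξ', ← map_sub]
      exact isTan_ztan hx _
    · obtain ⟨η, rfl⟩ := hY.exists_tangent hx
      rw [sub_mul, sub_mul, totalRes_sub, totalRes_sharp hx _ _ hY, totalRes_sharp hx _ _ hY,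
        ← represents_iff.1 h, ← represents_iff.1 h₀, sub_self]
  · rintro rfl
    ext η
    rw [represents_iff.1 h₀, ← totalRes_sharp hx _ _ (isTan_ztan hx η), ← hξ, map_zero]
    simp [totalRes, Place.rres_zero]

lemma traceForm_eq_apply {ν : D.Marked} {α β : RatFunc ℂ}
    {ω' : D.Param →L[ℂ] ℂ} (hβ : Represents ν x β ω') {ξ : D.Param}
    (hξ : sharp ν x α = ztan x ξ) : traceForm ν x α β = ω' ξ := by
  rw [traceForm_eq, hξ, represents_iff.1 hβ, mul_comm]

lemma rep_spec (hx : x ∈ D.M) (ν : D.Marked) (ω : D.Param →L[ℂ] ℂ) :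
    rep ν x ω ∈ alg x ∧ Represents ν x (rep ν x ω) ω :=
  Classical.epsilon_spec (p := fun α => α ∈ alg x ∧ Represents ν x α ω) (exists_represents hx ν ω)

lemma cometric_eq_apply (hx : x ∈ D.M) (ν : D.Marked) (ω ω' : D.Param →L[ℂ] ℂ) {ν' : D.Marked}
    {α : RatFunc ℂ} (hα : Represents ν' x α ω) {ξ : D.Param} (hξ : sharp ν' x α = ztan x ξ) :
    cometric ν x ω ω' = ω' ξ := by
  obtain ⟨η, hη, -⟩ := exists_sharp hx ω
  have : ξ = η := ztan_injective hx (by rw [← hξ, hη _ _ hα])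
  rw [this]
  exact traceForm_eq_apply (rep_spec hx ν ω').2 (hη _ _ (rep_spec hx ν ω).2)

lemma cometricWellDefined {U : Set D.Param} (hU : U ⊆ D.M) (ν : D.Marked) :
    D.CometricWellDefined ν U := by
  intro x hx ω ω' α _ β _ hα hβ
  obtain ⟨ξ, hξ, -⟩ := exists_sharp (hU hx) ω
  rw [cometric_eq_apply (hU hx) ν ω ω' hα (hξ _ _ hα), traceForm_eq_apply hβ (hξ _ _ hα)]

lemma isContravariantMetric_cometric {U : Set D.Param} (hU : U ⊆ D.M) (ν : D.Marked) :
    IsContravariantMetric U (cometric (D := D) ν) := by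
  have hsymm : ∀ x ∈ U, ∀ ω ω', cometric ν x ω ω' = cometric ν x ω' ω := by
    intro x _ ω ω'
    rw [cometric, cometric, traceForm_comm]
  have key : ∀ x ∈ U, ∀ ω : D.Param →L[ℂ] ℂ, ∃ ξ, (∀ ω', cometric ν x ω ω' = ω' ξ) ∧
      (ξ = 0 → ω = 0) := by
    intro x hx ω
    obtain ⟨ξ, hξ, h0⟩ := exists_sharp (hU hx) ω
    have hr := (rep_spec (hU hx) ν ω).2
    exact ⟨ξ, fun ω' => cometric_eq_apply (hU hx) ν ω ω' hr (hξ _ _ hr), h0⟩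
  refine ⟨hsymm, fun x hx ω₁ ω₂ ω' => ?_, fun x hx c ω ω' => ?_, fun x hx ω h => ?_⟩
  · obtain ⟨ξ, hξ, -⟩ := key x hx ω'
    rw [hsymm x hx _ ω', hsymm x hx ω₁, hsymm x hx ω₂, hξ, hξ, hξ]; rfl
  · obtain ⟨ξ, hξ, -⟩ := key x hx ω'
    rw [hsymm x hx _ ω', hsymm x hx ω, hξ, hξ]; rfl
  · obtain ⟨ξ, hξ, h0⟩ := key x hx ω
    apply h0
    by_contra hne
    obtain ⟨ω', hω'⟩ := SeparatingDual.exists_ne_zero (R := ℂ) hne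
    exact hω' (by rw [← hξ, h])

end Shape
end FlatCoord
end


noncomputable section
namespace FlatCoord
open Filter Topology

/-! ### Flat coordinates from a constant Gram matrix -/

section Flat

variable {V : Type*} [NormedAddCommGroup V] [NormedSpace ℂ V] [CompleteSpace V]
  {J : Type*} [Fintype J]

theorem isFlatCoordinates_of_gram [FiniteDimensional ℂ V] {U : Set V} (hU : IsOpen U)
    {g : V → (V →L[ℂ] ℂ) → (V →L[ℂ] ℂ) → ℂ} (hg : IsContravariantMetric U g) {t : J → V → ℂ}
    (ht : ∀ a, AnalyticOnNhd ℂ (t a) U)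
    (hchart : ∀ x ∈ U, Function.Bijective fun (X : V) (a : J) => fderiv ℂ (t a) x X)
    {C : J → J → ℂ} (hC : ∀ x ∈ U, ∀ a b, g x (fderiv ℂ (t a) x) (fderiv ℂ (t b) x) = C a b) :
    IsFlatCoordinates U g t := by
  classical
  let F : V → J → ℂ := fun y a => t a y
  have hF : AnalyticOnNhd ℂ F U := fun x hx => AnalyticAt.pi fun a => ht a x hx
  let T : V → V →L[ℂ] (J → ℂ) := fderiv ℂ F
  have hT : ∀ x ∈ U, ∀ X a, T x X a = fderiv ℂ (t a) x X := by
    intro x hx X a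
    have := fderiv_pi (𝕜 := ℂ) (φ := fun a y => t a y) (x := x)
      fun a => (ht a x hx).differentiableAt
    change fderiv ℂ F x X a = _
    rw [this]; rfl
  have hTd : ∀ x ∈ U, DifferentiableAt ℂ T x := fun x hx => (hF x hx).fderiv.differentiableAt
  have hbij : ∀ x ∈ U, Function.Bijective (T x) := by
    intro x hx
    have : (T x : V → J → ℂ) = fun (X : V) (a : J) => fderiv ℂ (t a) x X := by
      ext X a; exact hT x hx X a
    rw [this]; exact hchart x hx
  have hequiv : ∀ x ∈ U, ∃ e : V ≃L[ℂ] (J → ℂ), (e : V →L[ℂ] (J → ℂ)) = T x := by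
    intro x hx
    refine ⟨(LinearEquiv.ofBijective (T x : V →ₗ[ℂ] (J → ℂ)) (hbij x hx)).toContinuousLinearEquiv, ?_⟩
    ext; rfl
  let S : V → (J → ℂ) →L[ℂ] V := fun x => (T x).inverse
  have hTS : ∀ x ∈ U, ∀ y, T x (S x y) = y := by
    intro x hx y
    obtain ⟨e, he⟩ := hequiv x hx
    simp only [S, ← he, ContinuousLinearMap.inverse_equiv]
    exact e.apply_symm_apply y
  have hST : ∀ x ∈ U, ∀ y, S x (T x y) = y := by
    intro x hx y
    obtain ⟨e, he⟩ := hequiv x hx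
    simp only [S, ← he, ContinuousLinearMap.inverse_equiv]
    exact e.symm_apply_apply y
  have hSd : ∀ x ∈ U, DifferentiableAt ℂ S x := by
    intro x hx
    obtain ⟨e, he⟩ := hequiv x hx
    have h1 : ContDiffAt ℂ 1 ContinuousLinearMap.inverse (T x) := by
      rw [← he]; exact contDiffAt_map_inverse e
    exact (h1.differentiableAt one_ne_zero).comp x (hTd x hx)
  let Γ : V → V →L[ℂ] V →L[ℂ] V := fun x =>
    (ContinuousLinearMap.compL ℂ V (J → ℂ) V (S x)).comp (fderiv ℂ T x)
  have hΓ : ∀ x X Y, Γ x X Y = S x (fderiv ℂ T x X Y) := fun _ _ _ => rfl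
  let E : J → V → V := fun a x => S x (Pi.single a 1)
  have hEd : ∀ a, ∀ x ∈ U, DifferentiableAt ℂ (E a) x := fun a x hx =>
    (hSd x hx).clm_apply (differentiableAt_const _)
  have hE : ∀ a, ∀ x ∈ U, ∀ X, fderiv ℂ (E a) x X = -Γ x X (E a x) := by
    intro a x hx X
    have h1 : HasFDerivAt (fun y => T y (E a y)) (0 : V →L[ℂ] (J → ℂ)) x := by
      refine (hasFDerivAt_const (Pi.single a (1 : ℂ) : J → ℂ) x).congr_of_eventuallyEq ?_
      filter_upwards [hU.mem_nhds hx] with y hy using hTS y hy _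
    have h2 := (hTd x hx).hasFDerivAt.clm_apply (hEd a x hx).hasFDerivAt
    have h3 := congrArg (fun L => S x (L X)) (h2.unique h1)
    simp only [_root_.add_apply, ContinuousLinearMap.comp_apply,
      ContinuousLinearMap.flip_apply, map_add, _root_.zero_apply, map_zero] at h3
    rw [hST x hx] at h3
    rw [hΓ]
    exact eq_neg_of_add_eq_zero_left h3
  have hexp : ∀ x ∈ U, ∀ ω : V →L[ℂ] ℂ, ω = ∑ a, ω (E a x) • fderiv ℂ (t a) x := by
    intro x hx ω
    ext X
    conv_lhs => rw [← hST x hx X, pi_eq_sum_univ' (T x X)]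
    simp only [map_sum, map_smul, smul_eq_mul, _root_.sum_apply,
      _root_.smul_apply]
    refine Finset.sum_congr rfl fun a _ => ?_
    rw [hT x hx, mul_comm]
  have hsum : ∀ x ∈ U, ∀ (c : J → ℂ) (w : J → V →L[ℂ] ℂ) ω',
      g x (∑ a, c a • w a) ω' = ∑ a, c a * g x (w a) ω' := by
    intro x hx c w ω'
    let φ : (V →L[ℂ] ℂ) →ₗ[ℂ] ℂ :=
      { toFun := fun ω => g x ω ω'
        map_add' := fun a b => hg.add_left x hx a b ω'
        map_smul' := fun r a => hg.smul_left x hx r a ω' }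
    have := map_sum φ (fun a => c a • w a) Finset.univ
    simp only [map_smul] at this
    exact this
  have hgform : ∀ x ∈ U, ∀ ω ω', g x ω ω' = ∑ a, ∑ b, C a b * (ω (E a x) * ω' (E b x)) := by
    intro x hx ω ω'
    conv_lhs => rw [hexp x hx ω]
    rw [hsum x hx]
    refine Finset.sum_congr rfl fun a _ => ?_
    rw [hg.symm x hx]
    conv_lhs => rw [hexp x hx ω']
    rw [hsum x hx, Finset.mul_sum]
    refine Finset.sum_congr rfl fun b _ => ?_
    rw [hg.symm x hx, hC x hx]; ring
  have hderiv : ∀ x ∈ U, ∀ ω ω' : V →L[ℂ] ℂ, HasFDerivAt (fun y => g y ω ω')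
      (∑ a, ∑ b, C a b • (ω (E a x) • ω'.comp (fderiv ℂ (E b) x) +
        ω' (E b x) • ω.comp (fderiv ℂ (E a) x))) x := by
    intro x hx ω ω'
    have h1 : HasFDerivAt (fun y => ∑ a, ∑ b, C a b * (ω (E a y) * ω' (E b y)))
      (∑ a, ∑ b, C a b • (ω (E a x) • ω'.comp (fderiv ℂ (E b) x) +
        ω' (E b x) • ω.comp (fderiv ℂ (E a) x))) x := by
      refine HasFDerivAt.fun_sum fun a _ => HasFDerivAt.fun_sum fun b _ => HasFDerivAt.const_mul ?_ _
      exact (ω.hasFDerivAt.comp x (hEd a x hx).hasFDerivAt).mul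
        (ω'.hasFDerivAt.comp x (hEd b x hx).hasFDerivAt)
    refine h1.congr_of_eventuallyEq ?_
    filter_upwards [hU.mem_nhds hx] with y hy using hgform y hy _ _
  refine ⟨hg, ht, hchart, ⟨Γ, ⟨fun x hx X Y => ?_, fun x hx ω ω' => (hderiv x hx ω ω').differentiableAt,
    fun x hx ω ω' X => ?_⟩, fun a x hx X Y => ?_⟩, C, hC⟩
  · rw [hΓ, hΓ]
    have : IsSymmSndFDerivAt ℂ F x :=
      (hF x hx).contDiffAt.isSymmSndFDerivAt (n := ⊤) (by simp)
    exact congrArg _ (this X Y)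
  · rw [(hderiv x hx ω ω').fderiv, hgform x hx, hgform x hx]
    simp only [_root_.sum_apply, _root_.smul_apply,
      _root_.add_apply, ContinuousLinearMap.comp_apply, hE _ x hx, map_neg, smul_eq_mul]
    rw [← Finset.sum_add_distrib, ← Finset.sum_add_distrib]
    refine Finset.sum_eq_zero fun a _ => ?_
    rw [← Finset.sum_add_distrib, ← Finset.sum_add_distrib]
    refine Finset.sum_eq_zero fun b _ => ?_
    ring
  · rw [← hT x hx, hΓ, hTS x hx, sub_eq_zero]
    have h1 : HasFDerivAt (fun y => T y Y a)
        ((ContinuousLinearMap.proj (R := ℂ) (φ := fun _ : J => ℂ) a).comp ((fderiv ℂ T x).flip Y)) x := by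
      have h2 := (hTd x hx).hasFDerivAt.clm_apply (hasFDerivAt_const Y x)
      refine ((ContinuousLinearMap.proj (R := ℂ) (φ := fun _ : J => ℂ) a).hasFDerivAt.comp x
        h2).congr_fderiv ?_
      ext; simp
    have h4 : (fun y => fderiv ℂ (t a) y Y) =ᶠ[𝓝 x] fun y => T y Y a := by
      filter_upwards [hU.mem_nhds hx] with y hy using (hT y hy Y a).symm
    rw [h4.fderiv_eq, h1.fderiv]
    rfl

end Flat

end FlatCoord
end


noncomputable section
namespace FlatCoord
open Filter Topology

/-! ### Families of Laurent series -/

section Families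

variable {E : Type*} [NormedAddCommGroup E] [NormedSpace ℂ E]

/-- A family of Laurent series has analytic coefficients and a locally uniform lower bound for the
order at `x₀`. -/
structure LAn (S : E → LaurentSeries ℂ) (x₀ : E) : Prop where
  bdd : ∃ e, ∀ᶠ x in 𝓝 x₀, OrdGE (S x) e
  an : ∀ k, AnalyticAt ℂ (fun x => (S x).coeff k) x₀

/-- The derivative of the coefficients of a family in the direction `ξ`. -/
def HasLD (S : E → LaurentSeries ℂ) (x₀ ξ : E) (σ : LaurentSeries ℂ) : Prop :=
  ∀ k, fderiv ℂ (fun x => (S x).coeff k) x₀ ξ = σ.coeff k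

variable {S T : E → LaurentSeries ℂ} {x₀ ξ : E} {σ τ : LaurentSeries ℂ}

lemma HasLD.unique (h : HasLD S x₀ ξ σ) (h' : HasLD S x₀ ξ τ) : σ = τ := by
  ext k; rw [← h k, h' k]

lemma HasLD.congr (h : HasLD S x₀ ξ σ) (hST : S =ᶠ[𝓝 x₀] T) : HasLD T x₀ ξ σ := fun k => by
  rw [← h k]
  have : (fun x => (T x).coeff k) =ᶠ[𝓝 x₀] fun x => (S x).coeff k := by
    filter_upwards [hST] with x hx
    rw [hx]
  rw [this.fderiv_eq]

lemma LAn.congr (h : LAn S x₀) (hST : S =ᶠ[𝓝 x₀] T) : LAn T x₀ := by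
  obtain ⟨e, he⟩ := h.bdd
  refine ⟨⟨e, ?_⟩, fun k => (h.an k).congr ?_⟩
  · filter_upwards [he, hST] with x hx hx'
    rwa [← hx']
  · filter_upwards [hST] with x hx
    rw [hx]

lemma lAn_const (f : LaurentSeries ℂ) : LAn (fun _ : E => f) x₀ :=
  ⟨⟨_, Eventually.of_forall fun _ => ordGE_order f⟩, fun _ => analyticAt_const⟩

lemma hasLD_const (f : LaurentSeries ℂ) : HasLD (fun _ : E => f) x₀ ξ 0 := fun k => by
  simp

lemma HasLD.ordGE (h : HasLD S x₀ ξ σ) {e : ℤ} (he : ∀ᶠ x in 𝓝 x₀, OrdGE (S x) e) : OrdGE σ e := by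
  intro k hk
  rw [← h k]
  have : (fun x => (S x).coeff k) =ᶠ[𝓝 x₀] fun _ => 0 := by
    filter_upwards [he] with x hx using hx k hk
  rw [this.fderiv_eq]; simp

lemma LAn.exists_hasLD (h : LAn S x₀) (ξ : E) : ∃ σ, HasLD S x₀ ξ σ := by
  obtain ⟨e, he⟩ := h.bdd
  refine ⟨HahnSeries.ofSuppBddBelow (fun k => fderiv ℂ (fun x => (S x).coeff k) x₀ ξ) ⟨e, ?_⟩,
    fun k => rfl⟩
  intro k hk
  by_contra! hlt
  apply hk
  have : (fun x => (S x).coeff k) =ᶠ[𝓝 x₀] fun _ => 0 := by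
    filter_upwards [he] with x hx using hx k hlt
  change fderiv ℂ (fun x => (S x).coeff k) x₀ ξ = 0
  rw [this.fderiv_eq]; simp

lemma LAn.add (hS : LAn S x₀) (hT : LAn T x₀) : LAn (fun x => S x + T x) x₀ := by
  obtain ⟨e, he⟩ := hS.bdd
  obtain ⟨f, hf⟩ := hT.bdd
  refine ⟨⟨min e f, ?_⟩, fun k => (hS.an k).add (hT.an k)⟩
  filter_upwards [he, hf] with x h1 h2
  exact (h1.mono (min_le_left _ _)).add (h2.mono (min_le_right _ _))

lemma HasLD.add (hS : LAn S x₀) (hT : LAn T x₀) (h : HasLD S x₀ ξ σ) (h' : HasLD T x₀ ξ τ) :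
    HasLD (fun x => S x + T x) x₀ ξ (σ + τ) := fun k => by
  rw [HahnSeries.coeff_add, ← h k, ← h' k]
  simp only [HahnSeries.coeff_add]
  rw [fderiv_fun_add (hS.an k).differentiableAt (hT.an k).differentiableAt]
  rfl

lemma LAn.mul (hS : LAn S x₀) (hT : LAn T x₀) : LAn (fun x => S x * T x) x₀ := by
  obtain ⟨e, he⟩ := hS.bdd
  obtain ⟨f, hf⟩ := hT.bdd
  refine ⟨⟨e + f, ?_⟩, fun k => ?_⟩
  · filter_upwards [he, hf] with x h1 h2 using h1.mul h2
  · have : AnalyticAt ℂ (fun x => ∑ i ∈ Finset.Icc e (k - f), (S x).coeff i * (T x).coeff (k - i)) x₀ :=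
      Finset.analyticAt_fun_sum _ fun i _ => (hS.an i).mul (hT.an _)
    refine this.congr ?_
    filter_upwards [he, hf] with x h1 h2 using (coeff_mul_eq_sum h1 h2 k).symm

lemma HasLD.mul (hS : LAn S x₀) (hT : LAn T x₀) (h : HasLD S x₀ ξ σ) (h' : HasLD T x₀ ξ τ) :
    HasLD (fun x => S x * T x) x₀ ξ (σ * T x₀ + S x₀ * τ) := fun k => by
  obtain ⟨e, he⟩ := hS.bdd
  obtain ⟨f, hf⟩ := hT.bdd
  have hev : (fun x => (S x * T x).coeff k) =ᶠ[𝓝 x₀]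
      fun x => ∑ i ∈ Finset.Icc e (k - f), (S x).coeff i * (T x).coeff (k - i) := by
    filter_upwards [he, hf] with x h1 h2 using coeff_mul_eq_sum h1 h2 k
  rw [hev.fderiv_eq, fderiv_fun_sum fun i _ =>
    (hS.an i).differentiableAt.fun_mul (hT.an (k - i)).differentiableAt, _root_.sum_apply,
    HahnSeries.coeff_add, coeff_mul_eq_sum (h.ordGE he) hf.self_of_nhds,
    coeff_mul_eq_sum he.self_of_nhds (h'.ordGE hf), ← Finset.sum_add_distrib]
  refine Finset.sum_congr rfl fun i _ => ?_
  rw [fderiv_fun_mul (hS.an i).differentiableAt (hT.an (k - i)).differentiableAt]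
  simp only [_root_.add_apply, _root_.smul_apply, smul_eq_mul]
  rw [h i, h' (k - i)]; ring

lemma LAn.dz (hS : LAn S x₀) : LAn (fun x => dz (S x)) x₀ := by
  obtain ⟨e, he⟩ := hS.bdd
  refine ⟨⟨e - 1, ?_⟩, fun k => ?_⟩
  · filter_upwards [he] with x hx using hx.dz
  · simp only [coeff_dz]
    exact analyticAt_const.mul (hS.an _)

lemma HasLD.dz (hS : LAn S x₀) (h : HasLD S x₀ ξ σ) :
    HasLD (fun x => FlatCoord.dz (S x)) x₀ ξ (FlatCoord.dz σ) := fun k => by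
  simp only [coeff_dz]
  rw [fderiv_const_mul (hS.an _).differentiableAt, _root_.smul_apply, h (k + 1), smul_eq_mul]

lemma lAn_C {c : E → ℂ} (hc : AnalyticAt ℂ c x₀) : LAn (fun x => HahnSeries.C (c x)) x₀ := by
  refine ⟨⟨0, Eventually.of_forall fun x => ordGE_C _⟩, fun k => ?_⟩
  by_cases hk : k = 0
  · subst hk; simpa using hc
  · simp only [HahnSeries.C_apply, HahnSeries.coeff_single_of_ne hk]
    exact analyticAt_const

lemma hasLD_C (c : E →L[ℂ] ℂ) : HasLD (fun x => HahnSeries.C (c x)) x₀ ξ (HahnSeries.C (c ξ)) := by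
  intro k
  by_cases hk : k = 0
  · subst hk; simp
  · simp only [HahnSeries.C_apply, HahnSeries.coeff_single_of_ne hk]
    simp

/-- The leading coefficient of the family at `x₀` has index `e`, and no nearby member
of the family has coefficients of smaller index. -/
def LOrd (S : E → LaurentSeries ℂ) (x₀ : E) (e : ℤ) : Prop :=
  (∀ᶠ x in 𝓝 x₀, OrdGE (S x) e) ∧ (S x₀).coeff e ≠ 0

lemma LOrd.eventually_ne {e : ℤ} (hS : LAn S x₀) (h : LOrd S x₀ e) :
    ∀ᶠ x in 𝓝 x₀, (S x).coeff e ≠ 0 :=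
  (hS.an e).continuousAt.eventually_ne h.2

omit [NormedSpace ℂ E] in
lemma LOrd.mul {e f : ℤ} (h : LOrd S x₀ e) (h' : LOrd T x₀ f) :
    LOrd (fun x => S x * T x) x₀ (e + f) := by
  refine ⟨?_, ?_⟩
  · filter_upwards [h.1, h'.1] with x h1 h2 using h1.mul h2
  · rw [coeff_mul_lead h.1.self_of_nhds h'.1.self_of_nhds]
    exact mul_ne_zero h.2 h'.2

lemma LOrd.inv {e : ℤ} (hS : LAn S x₀) (h : LOrd S x₀ e) : LOrd (fun x => (S x)⁻¹) x₀ (-e) := by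
  refine ⟨?_, ?_⟩
  · filter_upwards [h.1, h.eventually_ne hS] with x h1 h2 using h1.inv h2
  · rw [coeff_inv_lead h.1.self_of_nhds h.2]
    exact inv_ne_zero h.2

lemma LAn.inv {e : ℤ} (hS : LAn S x₀) (h : LOrd S x₀ e) : LAn (fun x => (S x)⁻¹) x₀ := by
  have hinv := (h.inv hS).1
  refine ⟨⟨_, hinv⟩, ?_⟩
  have key : ∀ j : ℕ, AnalyticAt ℂ (fun x => ((S x)⁻¹).coeff (j - e)) x₀ := by
    intro j
    induction j using Nat.strong_induction_on with
    | _ j ih =>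
      have h1 : AnalyticAt ℂ (fun x => ((1 : LaurentSeries ℂ).coeff (j : ℤ) -
          ∑ i ∈ Finset.Ioc e (j + e), (S x).coeff i * ((S x)⁻¹).coeff (j - i)) /
            (S x).coeff e) x₀ := by
        refine AnalyticAt.div (analyticAt_const.sub
          (Finset.analyticAt_fun_sum _ fun i hi => (hS.an i).mul ?_)) (hS.an e) h.2
        rw [Finset.mem_Ioc] at hi
        obtain ⟨j', hj'⟩ := Int.eq_ofNat_of_zero_le (a := j - i + e) (by omega)
        have := ih j' (by omega)
        rwa [show (j' : ℤ) - e = j - i by omega] at this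
      refine h1.congr ?_
      filter_upwards [h.1, h.eventually_ne hS, hinv] with x hx1 hx2 hx3
      have h2 := coeff_mul_eq_sum hx1 hx3 j
      rw [mul_inv_cancel₀ (ne_zero_of_coeff hx2), sub_neg_eq_add,
        ← Finset.add_sum_erase _ _ (Finset.left_mem_Icc.2 (by omega : e ≤ j + e)),
        Finset.Icc_erase_left] at h2
      rw [h2, div_eq_iff hx2]
      ring
  intro k
  by_cases hk : k < -e
  · refine analyticAt_const (v := (0 : ℂ)).congr ?_
    filter_upwards [hinv] with x hx using (hx k hk).symm
  · obtain ⟨j, hj⟩ := Int.eq_ofNat_of_zero_le (a := k + e) (by omega)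
    have := key j
    rwa [show (j : ℤ) - e = k by omega] at this

/-- A family of Laurent series in a moving parameter `z = p - π(x)`, invertible near `x₀`, whose
logarithmic derivative for fixed `p` in the direction `ξ` is `u`; the speed of `π` is `w`. -/
structure LogPD (w : ℂ) (S : E → LaurentSeries ℂ) (x₀ ξ : E) (u : LaurentSeries ℂ) : Prop where
  an : LAn S x₀
  ord : ∃ e, LOrd S x₀ e
  ld : HasLD S x₀ ξ (S x₀ * u + HahnSeries.C w * dz (S x₀))

variable {w : ℂ} {u u' : LaurentSeries ℂ}

lemma LogPD.ne_zero (h : LogPD w S x₀ ξ u) : S x₀ ≠ 0 := by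
  obtain ⟨e, he⟩ := h.ord
  exact ne_zero_of_coeff he.2

lemma LogPD.congr (h : LogPD w S x₀ ξ u) (hST : S =ᶠ[𝓝 x₀] T) : LogPD w T x₀ ξ u := by
  obtain ⟨e, he⟩ := h.ord
  refine ⟨h.an.congr hST, ⟨e, ?_, ?_⟩, ?_⟩
  · filter_upwards [he.1, hST] with x h1 h2
    rwa [← h2]
  · rw [← hST.self_of_nhds]; exact he.2
  · rw [← hST.self_of_nhds]; exact h.ld.congr hST

lemma logPD_one : LogPD w (fun _ : E => 1) x₀ ξ 0 := by
  refine ⟨lAn_const 1, ⟨0, Eventually.of_forall fun _ => ordGE_one, by simp⟩, ?_⟩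
  have h1 : dz 1 = 0 := leibniz_one dz_mul
  rw [h1, mul_zero, mul_zero, add_zero]
  exact hasLD_const 1

lemma LogPD.mul (h : LogPD w S x₀ ξ u) (h' : LogPD w T x₀ ξ u') :
    LogPD w (fun x => S x * T x) x₀ ξ (u + u') := by
  obtain ⟨e, he⟩ := h.ord
  obtain ⟨f, hf⟩ := h'.ord
  refine ⟨h.an.mul h'.an, ⟨_, he.mul hf⟩, ?_⟩
  have := HasLD.mul h.an h'.an h.ld h'.ld
  rw [dz_mul]
  convert this using 1
  ring

lemma LogPD.inv (h : LogPD w S x₀ ξ u) : LogPD w (fun x => (S x)⁻¹) x₀ ξ (-u) := by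
  obtain ⟨e, he⟩ := h.ord
  have hinv := h.an.inv he
  refine ⟨hinv, ⟨_, he.inv h.an⟩, ?_⟩
  obtain ⟨τ, hτ⟩ := hinv.exists_hasLD ξ
  have h1 := HasLD.mul h.an hinv h.ld hτ
  have h2 : HasLD (fun x => S x * (S x)⁻¹) x₀ ξ 0 := by
    refine (hasLD_const 1).congr ?_
    filter_upwards [he.eventually_ne h.an] with x hx
    rw [mul_inv_cancel₀ (ne_zero_of_coeff hx)]
  have h3 := h1.unique h2
  have h0 := h.ne_zero
  have h4 : dz (S x₀) = S x₀ * (dz (S x₀) * (S x₀)⁻¹) := by field_simp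
  rw [leibniz_inv dz_mul h0 h4]
  convert hτ using 1
  apply mul_left_cancel₀ h0
  rw [← sub_eq_zero, ← neg_eq_zero, ← h3]
  field_simp
  ring

lemma LogPD.pow (h : LogPD w S x₀ ξ u) (k : ℕ) :
    LogPD w (fun x => S x ^ k) x₀ ξ (k * u) := by
  induction k with
  | zero => simpa using logPD_one
  | succ k ih =>
    have := ih.mul h
    simp only [← pow_succ] at this
    convert this using 1
    push_cast; ring

lemma LogPD.zpow (h : LogPD w S x₀ ξ u) (k : ℤ) :
    LogPD w (fun x => S x ^ k) x₀ ξ (k * u) := by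
  obtain ⟨j, rfl | rfl⟩ := k.eq_nat_or_neg
  · simpa using h.pow j
  · have := (h.pow j).inv
    simp only [zpow_neg, zpow_natCast]
    convert this using 1
    push_cast; ring

lemma LogPD.prod {ι : Type*} (t : Finset ι) {F : ι → E → LaurentSeries ℂ}
    {f : ι → LaurentSeries ℂ} (h : ∀ i ∈ t, LogPD w (F i) x₀ ξ (f i)) :
    LogPD w (fun x => ∏ i ∈ t, F i x) x₀ ξ (∑ i ∈ t, f i) := by
  classical
  induction t using Finset.induction_on with
  | empty => simpa using logPD_one
  | insert i t hi ih =>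
    simp only [Finset.prod_insert hi, Finset.sum_insert hi]
    exact (h i (Finset.mem_insert_self _ _)).mul (ih fun j hj => h j (Finset.mem_insert_of_mem hj))

end Families

end FlatCoord
end


noncomputable section
namespace FlatCoord
open Filter Topology

section Families

variable {E : Type*} [NormedAddCommGroup E] [NormedSpace ℂ E] {x₀ ξ : E}

/-! ### Continuous branches of logarithms and roots are analytic -/

lemma analyticAt_of_exp_eq {c f : E → ℂ} (hc : AnalyticAt ℂ c x₀) (hf : ContinuousAt f x₀)
    (h : ∀ᶠ x in 𝓝 x₀, Complex.exp (f x) = c x) : AnalyticAt ℂ f x₀ := by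
  have h0 := h.self_of_nhds
  have hc0 : c x₀ ≠ 0 := by rw [← h0]; exact Complex.exp_ne_zero _
  have h1 : AnalyticAt ℂ (fun x => Complex.log (c x / c x₀) + f x₀) x₀ := by
    refine AnalyticAt.add (AnalyticAt.clog (hc.div analyticAt_const hc0) ?_) analyticAt_const
    rw [div_self hc0]; exact Complex.one_mem_slitPlane
  refine h1.congr ?_
  have h2 : ContinuousAt (fun x => (f x - f x₀).im) x₀ :=
    Complex.continuous_im.continuousAt.comp (hf.sub continuousAt_const)
  have h3 : ∀ᶠ x in 𝓝 x₀, (f x - f x₀).im ∈ Set.Ioo (-Real.pi) Real.pi := by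
    refine h2.eventually_mem (Ioo_mem_nhds ?_ ?_) <;> simp [Real.pi_pos]
  filter_upwards [h, h3] with x hx hx3
  rw [← hx, ← h0, ← Complex.exp_sub, Complex.log_exp hx3.1 hx3.2.le]
  ring

lemma analyticAt_of_pow_eq {m : ℕ} (hm : 1 ≤ m) {c r : E → ℂ} (hc : AnalyticAt ℂ c x₀)
    (hc0 : c x₀ ≠ 0) (hr : ContinuousAt r x₀) (h : ∀ᶠ x in 𝓝 x₀, r x ^ m = c x) :
    AnalyticAt ℂ r x₀ := by
  have hm0 : (m : ℂ) ≠ 0 := by exact_mod_cast (by omega : m ≠ 0)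
  have h0 := h.self_of_nhds
  have hr0 : r x₀ ≠ 0 := by
    intro h'
    rw [h', zero_pow (by omega)] at h0
    exact hc0 h0.symm
  have hdiv : ContinuousAt (fun x => r x / r x₀) x₀ := hr.div_const _
  have hslit : r x₀ / r x₀ ∈ Complex.slitPlane := by
    rw [div_self hr0]; exact Complex.one_mem_slitPlane
  have h1 : AnalyticAt ℂ (fun x => (m : ℂ) * Complex.log (r x / r x₀)) x₀ := by
    refine analyticAt_of_exp_eq (c := fun x => c x / c x₀) (hc.div analyticAt_const hc0)
      (continuousAt_const.mul (hdiv.clog hslit)) ?_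
    filter_upwards [h, hr.eventually_ne hr0] with x hx hx0
    rw [Complex.exp_nat_mul, Complex.exp_log (div_ne_zero hx0 hr0), div_pow, hx, h0]
  have h2 : AnalyticAt ℂ (fun x => r x₀ * Complex.exp ((m : ℂ) * Complex.log (r x / r x₀) / m)) x₀ :=
    analyticAt_const.mul ((h1.div analyticAt_const hm0).cexp)
  refine h2.congr ?_
  filter_upwards [hr.eventually_ne hr0] with x hx0
  rw [mul_div_cancel_left₀ _ hm0, Complex.exp_log (div_ne_zero hx0 hr0), mul_div_cancel₀ _ hr0]

variable {S R u l : E → LaurentSeries ℂ} {w : ℂ} {U : LaurentSeries ℂ}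

/-! ### Roots of families -/

lemma order_of_pow_eq {m : ℕ} (hm : 1 ≤ m) {f g : LaurentSeries ℂ} (h : f ^ m = g)
    (hg : OrdGE g (-m)) (hg0 : g.coeff (-m) ≠ 0) : f.order = -1 := by
  have h1 := order_eq hg hg0
  rw [← h, HahnSeries.order_pow, nsmul_eq_mul] at h1
  have hm' : (m : ℤ) ≠ 0 := by omega
  have h2 : (m : ℤ) * f.order = m * (-1) := by linarith
  exact mul_left_cancel₀ hm' h2

lemma lAn_root {m : ℕ} (hm : 1 ≤ m) (hu : LAn u x₀) (ho : LOrd u x₀ (-m))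
    (hR : ∀ᶠ x in 𝓝 x₀, R x ^ m = u x) (hR1 : AnalyticAt ℂ (fun x => (R x).coeff (-1)) x₀) :
    LAn R x₀ := by
  have hm0 : (m : ℂ) ≠ 0 := by exact_mod_cast (by omega : m ≠ 0)
  let W : E → LaurentSeries ℂ := fun x => HahnSeries.C (1 / m : ℂ) * (dz (u x) * (u x)⁻¹)
  have hW : LAn W x₀ := (lAn_C analyticAt_const).mul (hu.dz.mul (hu.inv ho))
  have hord : ∀ᶠ x in 𝓝 x₀, OrdGE (R x) (-1) ∧ (R x).coeff (-1) ≠ 0 ∧ dz (R x) = W x * R x ∧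
      OrdGE (W x) (-1) ∧ (W x).coeff (-1) = -1 := by
    filter_upwards [hR, ho.1, ho.eventually_ne hu] with x h1 h2 h3
    have h4 := order_of_pow_eq hm h1 h2 h3
    have hR0 : R x ≠ 0 := by
      intro h
      rw [h, zero_pow (by omega)] at h1
      exact ne_zero_of_coeff h3 h1.symm
    have h5 : OrdGE (R x) (-1) := h4 ▸ ordGE_order (R x)
    have h6 : (R x).coeff (-1) ≠ 0 := h4 ▸ HahnSeries.coeff_order_eq_zero.not.2 hR0
    have h7 : dz (R x) = R x * (dz (R x) * (R x)⁻¹) := by field_simp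
    have h8 : W x = dz (R x) * (R x)⁻¹ := by
      have := leibniz_log_pow dz_mul h7 m
      rw [h1] at this
      simp only [W, this]
      have hu0 := ne_zero_of_coeff h3
      have hC : HahnSeries.C (1 / m : ℂ) * (m : LaurentSeries ℂ) = 1 := by
        rw [← map_natCast HahnSeries.C m, ← map_mul, one_div_mul_cancel hm0, map_one]
      rw [mul_right_comm (u x), mul_inv_cancel₀ hu0, one_mul, ← mul_assoc, hC, one_mul]
    refine ⟨h5, h6, ?_, ?_, ?_⟩
    · rw [h8]; field_simp
    · rw [h8]; exact (h5.dz.mul (h5.inv h6)).mono (by norm_num)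
    · have h9 := coeff_mul_lead h5.dz (h5.inv h6)
      rw [coeff_inv_lead h5 h6, coeff_dz] at h9
      rw [h8, show (-1 : ℤ) = -1 - 1 + - -1 by norm_num, h9]
      push_cast
      field_simp
      norm_num
  refine ⟨⟨-1, hord.mono fun x hx => hx.1⟩, ?_⟩
  have key : ∀ j : ℕ, AnalyticAt ℂ (fun x => (R x).coeff (j - 1)) x₀ := by
    intro j
    induction j using Nat.strong_induction_on with
    | _ j ih =>
      rcases Nat.eq_zero_or_pos j with rfl | hj
      · simpa using hR1
      · have hj0 : (j : ℂ) ≠ 0 := by exact_mod_cast hj.ne'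
        have h1 : AnalyticAt ℂ (fun x =>
            (∑ i ∈ Finset.Ioc (-1 : ℤ) (j - 1), (W x).coeff i * (R x).coeff (j - 2 - i)) / j) x₀ := by
          refine AnalyticAt.div
            (Finset.analyticAt_fun_sum _ fun i hi => (hW.an i).mul ?_) analyticAt_const hj0
          rw [Finset.mem_Ioc] at hi
          obtain ⟨j', hj'⟩ := Int.eq_ofNat_of_zero_le (a := j - 1 - i) (by omega)
          have := ih j' (by omega)
          rwa [show (j' : ℤ) - 1 = j - 2 - i by omega] at this
        refine h1.congr ?_
        filter_upwards [hord] with x ⟨hx1, _, hx2, hx3, hx4⟩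
        have h2 := congrArg (fun f => f.coeff ((j : ℤ) - 2)) hx2
        simp only [coeff_dz] at h2
        rw [coeff_mul_eq_sum hx3 hx1, show (j : ℤ) - 2 - -1 = j - 1 by ring,
          ← Finset.add_sum_erase _ _ (Finset.left_mem_Icc.2 (by omega : (-1 : ℤ) ≤ j - 1)),
          Finset.Icc_erase_left, hx4, show (j : ℤ) - 2 + 1 = j - 1 by ring,
          show (j : ℤ) - 2 - -1 = j - 1 by ring] at h2
        rw [div_eq_iff hj0]
        push_cast at h2
        linear_combination -h2
  intro k
  by_cases hk : k < -1
  · refine analyticAt_const (v := (0 : ℂ)).congr ?_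
    filter_upwards [hord] with x hx using (hx.1 k hk).symm
  · obtain ⟨j, hj⟩ := Int.eq_ofNat_of_zero_le (a := k + 1) (by omega)
    have := key j
    rwa [show (j : ℤ) - 1 = k by omega] at this

lemma LogPD.root {m : ℕ} (hm : 1 ≤ m) (hu : LogPD w u x₀ ξ U) (ho : LOrd u x₀ (-m))
    (hR : ∀ᶠ x in 𝓝 x₀, R x ^ m = u x) (hR1 : AnalyticAt ℂ (fun x => (R x).coeff (-1)) x₀) :
    LogPD w R x₀ ξ (HahnSeries.C (1 / m : ℂ) * U) := by
  have hm0 : (m : ℂ) ≠ 0 := by exact_mod_cast (by omega : m ≠ 0)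
  have hRan := lAn_root hm hu.an ho hR hR1
  have hR0 : R x₀ ≠ 0 := by
    intro h
    have := hR.self_of_nhds
    rw [h, zero_pow (by omega)] at this
    exact hu.ne_zero this.symm
  have hord : LOrd R x₀ (-1) := by
    refine ⟨?_, ?_⟩
    · filter_upwards [hR, ho.1, ho.eventually_ne hu.an] with x h1 h2 h3
      exact order_of_pow_eq hm h1 h2 h3 ▸ ordGE_order (R x)
    · rw [← order_of_pow_eq hm hR.self_of_nhds ho.1.self_of_nhds ho.2]
      exact HahnSeries.coeff_order_eq_zero.not.2 hR0
  obtain ⟨τ, hτ⟩ := hRan.exists_hasLD ξ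
  refine ⟨hRan, ⟨_, hord⟩, ?_⟩
  have h1 : LogPD w R x₀ ξ ((τ - HahnSeries.C w * dz (R x₀)) * (R x₀)⁻¹) := by
    refine ⟨hRan, ⟨_, hord⟩, ?_⟩
    convert hτ using 1
    field_simp
    ring
  have h2 := ((h1.pow m).congr hR).ld.unique hu.ld
  have h3 : (m : LaurentSeries ℂ) * ((τ - HahnSeries.C w * dz (R x₀)) * (R x₀)⁻¹) = U :=
    mul_left_cancel₀ hu.ne_zero (add_right_cancel h2)
  have hC : HahnSeries.C (1 / m : ℂ) * (m : LaurentSeries ℂ) = 1 := by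
    rw [← map_natCast HahnSeries.C m, ← map_mul, one_div_mul_cancel hm0, map_one]
  have h4 : HahnSeries.C (1 / m : ℂ) * U = (τ - HahnSeries.C w * dz (R x₀)) * (R x₀)⁻¹ := by
    rw [← h3, ← mul_assoc, hC, one_mul]
  rw [h4]
  exact h1.ld

/-! ### Logarithms of families -/

lemma lAn_log (hu : LAn u x₀) (ho : LOrd u x₀ 0) (hl : ∀ᶠ x in 𝓝 x₀, IsLog (u x) (l x))
    (hl0 : AnalyticAt ℂ (fun x => (l x).coeff 0) x₀) : LAn l x₀ := by
  refine ⟨⟨0, hl.mono fun x hx => hx.coeff_neg⟩, fun k => ?_⟩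
  rcases eq_or_ne k 0 with rfl | hk
  · exact hl0
  · have hk0 : (k : ℂ) ≠ 0 := by exact_mod_cast hk
    have h1 := ((hu.dz.mul (hu.inv ho)).an (k - 1)).div analyticAt_const hk0
    refine h1.congr ?_
    filter_upwards [hl, ho.eventually_ne hu] with x hx hx0
    have h2 : dz (u x) * (u x)⁻¹ = dz (l x) := by
      rw [← hx.deriv_eq, mul_assoc, mul_inv_cancel₀ (ne_zero_of_coeff hx0), mul_one]
    simp only [Pi.div_apply]
    rw [h2, coeff_dz, sub_add_cancel, div_eq_iff hk0]
    push_cast; ring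

lemma hasLD_log (hu : LogPD w u x₀ ξ U) (ho : LOrd u x₀ 0) (hl : ∀ᶠ x in 𝓝 x₀, IsLog (u x) (l x))
    (hlan : LAn l x₀) : HasLD l x₀ ξ (U + HahnSeries.C w * dz (l x₀)) := by
  obtain ⟨σ, hσ⟩ := hlan.exists_hasLD ξ
  have hl₀ := hl.self_of_nhds
  have hu0 := hu.ne_zero
  set ρ := U + HahnSeries.C w * dz (l x₀) with hρ
  have hδ : HasLD u x₀ ξ (u x₀ * ρ) := by
    convert hu.ld using 1
    rw [hρ, ← hl₀.deriv_eq]; ring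
  have h1 := HasLD.mul hlan.dz hu.an (hσ.dz hlan) hδ
  have h2 : HasLD (fun x => dz (l x) * u x) x₀ ξ (dz (u x₀ * ρ)) :=
    (hδ.dz hu.an).congr (hl.mono fun x hx => hx.deriv_eq.symm)
  have h3 : dz σ = dz ρ := by
    have h4 := h1.unique h2
    rw [dz_mul, ← hl₀.deriv_eq] at h4
    apply mul_right_cancel₀ hu0
    linear_combination h4
  have hρ0 : OrdGE ρ 0 := by
    have h4 := ((hδ.ordGE ho.1).mul (ho.1.self_of_nhds.inv ho.2))
    rw [mul_comm (u x₀), mul_assoc, mul_inv_cancel₀ hu0, mul_one] at h4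
    simpa using h4
  have h5 : σ = ρ := by
    ext k
    rcases eq_or_ne k 0 with rfl | hk
    · have h6 := coeff_mul_lead ho.1.self_of_nhds hρ0
      rw [add_zero, ← hδ 0] at h6
      have h7 : (fun x => (u x).coeff 0) =ᶠ[𝓝 x₀] fun x => Complex.exp ((l x).coeff 0) :=
        hl.mono fun x hx => hx.exp_eq.symm
      rw [h7.fderiv_eq, (hlan.an 0).differentiableAt.hasFDerivAt.cexp.fderiv,
        _root_.smul_apply, hσ 0, hl₀.exp_eq, smul_eq_mul] at h6
      exact mul_left_cancel₀ ho.2 h6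
    · have h6 := congrArg (fun f => f.coeff (k - 1)) h3
      simp only [coeff_dz, sub_add_cancel] at h6
      have hk0 : (((k - 1 : ℤ) : ℂ) + 1) ≠ 0 := by
        push_cast; rw [sub_add_cancel]; exact_mod_cast hk
      exact mul_left_cancel₀ hk0 h6
  rwa [← h5]

/-! ### Linear factors -/

lemma logPD_linear_fin (π b : E →L[ℂ] ℂ) (h : π x₀ ≠ b x₀ ∨ ∀ x, π x = b x) (ξ : E) :
    LogPD (π ξ) (fun x => (Place.fin (π x)).expand (RatFunc.X - RatFunc.C (b x))) x₀ ξ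
      ((Place.fin (π x₀)).expand (RatFunc.C (-b ξ) * (RatFunc.X - RatFunc.C (b x₀))⁻¹)) := by
  have hfun : (fun x => (Place.fin (π x)).expand (RatFunc.X - RatFunc.C (b x))) =
      fun x => HahnSeries.C ((π - b) x) + HahnSeries.single 1 1 :=
    funext fun x => Place.expand_X_sub_C_fin _ _
  have han : LAn (fun x => HahnSeries.C ((π - b) x)) x₀ := lAn_C (ContinuousLinearMap.analyticAt _ _)
  refine ⟨?_, ?_, ?_⟩
  · rw [hfun]; exact han.add (lAn_const _)
  · rcases h with h | h
    · refine ⟨0, Eventually.of_forall fun x => Place.ordGE_X_sub_C_fin _ _, ?_⟩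
      rw [Place.coeff_X_sub_C_fin]; exact sub_ne_zero.2 h
    · refine ⟨1, Eventually.of_forall fun x => ?_, ?_⟩
      · beta_reduce
        rw [Place.expand_X_sub_C_fin, h x, sub_self, map_zero, zero_add]
        exact ordGE_single _ _
      · beta_reduce
        rw [Place.expand_X_sub_C_fin, h x₀]; simp
  · rw [← Place.expand_mul, mul_left_comm, mul_inv_cancel₀ (X_sub_C_ne_zero' _), mul_one, hfun]
    convert HasLD.add han (lAn_const (HahnSeries.single 1 (1 : ℂ))) (hasLD_C (ξ := ξ) (π - b))
      (hasLD_const _) using 1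
    rw [Place.expand_X_sub_C_fin, Place.expand_C, map_add, dz_C, dz_single]
    simp
    ring

lemma logPD_linear_inf (b : E →L[ℂ] ℂ) (ξ : E) :
    LogPD 0 (fun x => Place.inf.expand (RatFunc.X - RatFunc.C (b x))) x₀ ξ
      (Place.inf.expand (RatFunc.C (-b ξ) * (RatFunc.X - RatFunc.C (b x₀))⁻¹)) := by
  have hfun : (fun x => Place.inf.expand (RatFunc.X - RatFunc.C (b x))) =
      fun x => HahnSeries.C ((-b) x) + HahnSeries.single (-1) 1 :=
    funext fun x => by rw [Place.expand_X_sub_C_inf]; simp [sub_eq_add_neg, add_comm]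
  have han : LAn (fun x => HahnSeries.C ((-b) x)) x₀ := lAn_C (ContinuousLinearMap.analyticAt _ _)
  refine ⟨?_, ⟨-1, Eventually.of_forall fun x => Place.ordGE_X_sub_C_inf _, ?_⟩, ?_⟩
  · rw [hfun]; exact han.add (lAn_const _)
  · rw [Place.coeff_X_sub_C_inf]; exact one_ne_zero
  · rw [← Place.expand_mul, mul_left_comm, mul_inv_cancel₀ (X_sub_C_ne_zero' _), mul_one, hfun]
    convert HasLD.add han (lAn_const (HahnSeries.single (-1) (1 : ℂ))) (hasLD_C (ξ := ξ) (-b))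
      (hasLD_const _) using 1
    rw [Place.expand_C]
    simp

/-! ### Derivatives of traces -/

lemma hasTrace_fin {P : E → LaurentSeries ℂ} {σ : LaurentSeries ℂ} (hP : LogPD w P x₀ ξ 0)
    (hS : LAn S x₀) (h : HasLD S x₀ ξ (σ + HahnSeries.C w * dz (S x₀))) :
    fderiv ℂ (fun x => (P x * S x).coeff (-1)) x₀ ξ = (P x₀ * σ).coeff (-1) := by
  have h1 := HasLD.mul hP.an hS hP.ld h (-1)
  rw [h1, mul_zero, zero_add]
  have h2 : HahnSeries.C w * dz (P x₀) * S x₀ + P x₀ * (σ + HahnSeries.C w * dz (S x₀)) =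
      P x₀ * σ + w • dz (P x₀ * S x₀) := by
    rw [dz_mul, ← HahnSeries.C_mul_eq_smul]; ring
  rw [h2, HahnSeries.coeff_add, HahnSeries.coeff_smul, coeff_dz_neg_one, smul_zero, add_zero]

end Families

end FlatCoord
end


noncomputable section
namespace FlatCoord
open Filter Topology
namespace Shape

variable {D : Shape} {x : D.Param} {ξ : D.Param}

/-! ### The expansions of `λ` as families of Laurent series -/

/-- The zero `aᵢ` as a linear coordinate. -/
def aL (i : Fin D.L) : D.Param →L[ℂ] ℂ :=
  (ContinuousLinearMap.proj i).comp
    ((ContinuousLinearMap.fst ℂ (Fin D.L → ℂ) (Fin D.K → ℂ)).comp D.Param.subtypeL)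

/-- The position of a finite marked point as a linear coordinate. -/
def posL (q : D.FinPole) : D.Param →L[ℂ] ℂ :=
  match q.1 with
  | none => 0
  | some j => (ContinuousLinearMap.proj j).comp
      ((ContinuousLinearMap.snd ℂ (Fin D.L → ℂ) (Fin D.K → ℂ)).comp D.Param.subtypeL)

lemma posL_apply (q : D.FinPole) (x : D.Param) : posL q x = pos x q := by
  obtain ⟨_ | j, h⟩ := q <;> rfl

/-- The derivative of the position of a marked point; `0` at `∞`. -/
def speed (ν : D.Marked) (ξ : D.Param) : ℂ :=
  match ν with
  | none => 0
  | some q => pos ξ q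

lemma logPD_linear (ν : D.Marked) (b : D.Param →L[ℂ] ℂ)
    (h : ∀ q, ν = some q → pos x q ≠ b x ∨ ∀ y, pos y q = b y) :
    LogPD (speed ν ξ) (fun y => (place y ν).expand (RatFunc.X - RatFunc.C (b y))) x ξ
      ((place x ν).expand (RatFunc.C (-b ξ) * (RatFunc.X - RatFunc.C (b x))⁻¹)) := by
  cases ν with
  | none => exact logPD_linear_inf b ξ
  | some q =>
    have := logPD_linear_fin (x₀ := x) (posL q) b (by simpa only [posL_apply] using h q rfl) ξ
    simp only [posL_apply] at this
    exact this

lemma logPD_a (hx : x ∈ D.M) (ν : D.Marked) (i : Fin D.L) :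
    LogPD (speed ν ξ) (fun y => (place y ν).expand (RatFunc.X - RatFunc.C (a y i))) x ξ
      ((place x ν).expand (RatFunc.C (-a ξ i) * (RatFunc.X - RatFunc.C (a x i))⁻¹)) :=
  logPD_linear ν (aL i) fun q _ => Or.inl (a_ne_pos hx i q).symm

lemma logPD_pos (hx : x ∈ D.M) (ν : D.Marked) (q : D.FinPole) :
    LogPD (speed ν ξ) (fun y => (place y ν).expand (RatFunc.X - RatFunc.C (pos y q))) x ξ
      ((place x ν).expand (RatFunc.C (-pos ξ q) * (RatFunc.X - RatFunc.C (pos x q))⁻¹)) := by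
  have := logPD_linear (x := x) (ξ := ξ) ν (posL q) fun q' _ => by
    simp only [posL_apply]
    rcases eq_or_ne q' q with rfl | h
    · exact Or.inr fun _ => rfl
    · exact Or.inl ((pos_injective hx).ne h)
  simpa only [posL_apply] using this

lemma logPD_lam (hx : x ∈ D.M) (ν : D.Marked) :
    LogPD (speed ν ξ) (fun y => (place y ν).expand (lam y)) x ξ
      ((place x ν).expand (logTangent x ξ)) := by
  have h1 := LogPD.prod Finset.univ fun i _ => logPD_a (ξ := ξ) hx ν i
  have h2 := LogPD.prod Finset.univ fun q _ => (logPD_pos (ξ := ξ) hx ν q).zpow (-deg q)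
  have h3 := h1.mul h2
  have h4 : (fun y => (place y ν).expand (lam y)) = fun y =>
      (∏ i, (place y ν).expand (RatFunc.X - RatFunc.C (a y i))) *
        ∏ q, (place y ν).expand (RatFunc.X - RatFunc.C (pos y q)) ^ (-deg q) := by
    funext y
    rw [lam_eq, Place.expand_mul, Place.expand_prod, Place.expand_prod]
    simp only [Place.expand_zpow]
  rw [h4]
  convert h3 using 1
  rw [logTangent, Place.expand_add, Place.expand_sum, Place.expand_sum]
  congr 1
  refine Finset.sum_congr rfl fun q _ => ?_
  rw [Place.expand_mul, Place.expand_mul, ← mul_assoc, Place.expand_C, Place.expand_C, map_mul,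
    map_neg, Int.cast_neg, map_intCast]
  ring

lemma logPD_Xs (hx : x ∈ D.M) (ν : D.Marked) :
    LogPD (speed ν ξ) (fun y => (place y ν).expand (RatFunc.X ^ (-(D.s : ℤ)))) x ξ 0 := by
  rcases D.s_eq with hs | hs
  · simp only [hs, Nat.cast_zero, neg_zero, zpow_zero, Place.expand_one]
    exact logPD_one
  · have h := (logPD_pos (ξ := ξ) hx ν ⟨none, fun _ => hs⟩).zpow (-(D.s : ℤ))
    simp only [pos, map_zero, sub_zero, neg_zero, zero_mul, Place.expand_zero, mul_zero,
      ← Place.expand_zpow] at h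
    exact h

lemma lOrd_lam_pos {U : Set D.Param} (hU : U ⊆ D.M) (hx : U ∈ 𝓝 x) (q : D.FinPole) :
    LOrd (fun y => (place y (some q)).expand (lam y)) x (-deg q) := by
  refine ⟨?_, ?_⟩
  · filter_upwards [hx] with y hy
    rw [← order_lam_pos (hU hy) q]
    exact ordGE_order _
  · rw [← order_lam_pos (hU (mem_of_mem_nhds hx)) q]
    exact HahnSeries.coeff_order_eq_zero.not.2 (Place.expand_ne_zero _ (lam_ne_zero x))

lemma lOrd_lam_inf : LOrd (fun y : D.Param => (place y none).expand (lam y)) x (-D.n) := by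
  refine ⟨Eventually.of_forall fun y => ?_, ?_⟩
  · rw [← order_lam_inf y]
    exact ordGE_order _
  · rw [← order_lam_inf x]
    exact HahnSeries.coeff_order_eq_zero.not.2 (Place.expand_ne_zero _ (lam_ne_zero x))

/-! ### Derivatives of the coordinates -/

lemma tr_eq_res (ν : Place) (f : LaurentSeries ℂ) :
    ν.tr D.s f = ν.res (ν.expand (RatFunc.X ^ (-(D.s : ℤ))) * f) := by
  rw [Place.tr_eq, Place.expand_zpow, Place.expand_X]

lemma analyticAt_tr (hx : x ∈ D.M) (ν : D.Marked) {S : D.Param → LaurentSeries ℂ} (hS : LAn S x) :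
    AnalyticAt ℂ (fun y => (place y ν).tr D.s (S y)) x := by
  simp only [tr_eq_res]
  have := (logPD_Xs (ξ := 0) hx ν).an.mul hS
  cases ν with
  | none => exact this.an 1
  | some q => exact this.an (-1)

lemma fderiv_tr (hx : x ∈ D.M) (ν : D.Marked) {S : D.Param → LaurentSeries ℂ} (hS : LAn S x)
    {σ : LaurentSeries ℂ} (h : HasLD S x ξ (σ + HahnSeries.C (speed ν ξ) * dz (S x))) :
    fderiv ℂ (fun y => (place y ν).tr D.s (S y)) x ξ = (place x ν).tr D.s σ := by
  simp only [tr_eq_res]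
  have hP := logPD_Xs (ξ := ξ) hx ν
  cases ν with
  | none =>
    have h1 := HasLD.mul hP.an hS hP.ld h 1
    simp only [speed, map_zero, zero_mul, add_zero, mul_zero, zero_add] at h1
    exact h1
  | some q => exact hasTrace_fin hP hS h

lemma tr_mul_C (ν : Place) (s : ℕ) (c : ℂ) (f : LaurentSeries ℂ) :
    ν.tr s (HahnSeries.C c * f) = c * ν.tr s f := by
  rw [Place.tr_eq, Place.tr_eq, mul_left_comm, Place.res_C_mul]

lemma coord_root (hx : x ∈ D.M) (ν : D.Marked) {d : ℕ} (hd : 1 ≤ d)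
    (ho : LOrd (fun y => (place y ν).expand (lam y)) x (-d)) {R : D.Param → LaurentSeries ℂ}
    (hR : ∀ᶠ y in 𝓝 x, R y ^ d = (place y ν).expand (lam y))
    (hR1 : AnalyticAt ℂ (fun y => (R y).coeff (-1)) x) {j : ℤ} (hj : j ≠ d) :
    AnalyticAt ℂ (fun y => 1 / (1 - (j : ℂ) / d) * (place y ν).tr D.s (R y ^ ((d : ℤ) - j))) x ∧
    ∀ ξ, fderiv ℂ (fun y => 1 / (1 - (j : ℂ) / d) * (place y ν).tr D.s (R y ^ ((d : ℤ) - j))) x ξ =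
      (place x ν).tr D.s (R x ^ (-j) * (place x ν).expand (tangent x ξ)) := by
  have key : ∀ ξ, LogPD (speed ν ξ) (fun y => R y ^ ((d : ℤ) - j)) x ξ _ := fun ξ =>
    ((logPD_lam (ξ := ξ) hx ν).root hd ho hR hR1).zpow ((d : ℤ) - j)
  have han := analyticAt_tr hx ν (key 0).an
  refine ⟨analyticAt_const.mul han, fun ξ => ?_⟩
  rw [fderiv_const_mul han.differentiableAt, _root_.smul_apply, smul_eq_mul,
    fderiv_tr hx ν (key ξ).an (key ξ).ld]
  have hR0 : R x ≠ 0 := by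
    intro h
    have := hR.self_of_nhds
    rw [h, zero_pow (by omega)] at this
    exact Place.expand_ne_zero _ (lam_ne_zero x) this.symm
  have hd0 : (d : ℂ) ≠ 0 := by exact_mod_cast (by omega : d ≠ 0)
  have hdj : (d : ℂ) - j ≠ 0 := by
    rw [sub_ne_zero]
    exact_mod_cast hj.symm
  have h1 : R x ^ ((d : ℤ) - j) * ((((d : ℤ) - j : ℤ) : LaurentSeries ℂ) *
      (HahnSeries.C (1 / d : ℂ) * (place x ν).expand (logTangent x ξ))) =
      HahnSeries.C (((d : ℂ) - j) * (1 / d)) *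
        (R x ^ (-j) * (place x ν).expand (tangent x ξ)) := by
    rw [tangent_eq, Place.expand_mul, ← hR.self_of_nhds, sub_eq_add_neg, zpow_add₀ hR0, zpow_natCast,
      map_mul, map_sub, map_natCast, map_intCast]
    push_cast
    ring
  rw [h1, tr_mul_C]
  have h2 : (1 : ℂ) - j / d ≠ 0 := by
    rw [sub_ne_zero]
    intro h
    apply hdj
    field_simp at h
    rw [h, sub_self]
  field_simp

/-- Truncating a representative does not change the covector. -/
lemma tr_trunc (hx : x ∈ D.M) (ν : D.Marked) (f : LaurentSeries ℂ) (ξ : D.Param) {l : ℤ}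
    (hl : l = match ν with | none => (D.n : ℤ) - 1 | some q => deg q) :
    (place x ν).tr D.s ((place x ν).expand ((place x ν).trunc l f * tangent x ξ)) =
      (place x ν).tr D.s (f * (place x ν).expand (tangent x ξ)) := by
  have h1 : OrdGE (f - (place x ν).expand ((place x ν).trunc l f)) (l + 1) := fun k hk => by
    rw [HahnSeries.coeff_sub, Place.coeff_expand_trunc, if_pos (by omega), sub_self]
  rw [eq_comm, ← sub_eq_zero, Place.tr_eq, Place.tr_eq, ← Place.res_sub]
  have h2 : (place x ν).pSeries ^ (-(D.s : ℤ)) * (f * (place x ν).expand (tangent x ξ)) -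
      (place x ν).pSeries ^ (-(D.s : ℤ)) *
        (place x ν).expand ((place x ν).trunc l f * tangent x ξ) =
      (f - (place x ν).expand ((place x ν).trunc l f)) * (place x ν).expand (ztan x ξ) := by
    rw [ztan_apply, Place.expand_mul, Place.expand_mul, Place.expand_zpow, Place.expand_X]; ring
  rw [h2]
  have hZ := isTan_ztan hx ξ
  cases ν with
  | none => exact (h1.mul hZ.inf) 1 (by simp only at hl; omega)
  | some q => exact (h1.mul (hZ.pole q)) (-1) (by simp only at hl; omega)

variable {U : Set D.Param}

lemma continuousAt_of_branch {f : D.Param → ℂ} (hU : IsOpen U) (hx : x ∈ U) (h : ContinuousOn f U) :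
    ContinuousAt f x := h.continuousAt (hU.mem_nhds hx)

lemma coord_tInf (hU : IsOpen U) (hUM : U ⊆ D.M) (B : D.Branches U) (hx : x ∈ U) {i : ℕ}
    (hi : i < D.n) : AnalyticAt ℂ (tInf B i) x ∧
    ∀ ξ, fderiv ℂ (tInf B i) x ξ = (place x none).tr D.s
      (B.rootInf x ^ (-(i : ℤ)) * (place x none).expand (tangent x ξ)) := by
  have hUx := hU.mem_nhds hx
  have h1 : AnalyticAt ℂ (fun y => (B.rootInf y).coeff (-1)) x :=
    (analyticAt_const (v := (1 : ℂ))).congr (by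
      filter_upwards [hUx] with y hy using (B.rootInf_lead y hy).symm)
  have h2 : ∀ᶠ y in 𝓝 x, B.rootInf y ^ D.n = (place y none).expand (lam y) := by
    filter_upwards [hUx] with y hy using B.rootInf_pow y hy
  have := coord_root (hUM hx) none D.n_pos lOrd_lam_inf h2 h1 (j := i) (by omega)
  simp only [Int.cast_natCast] at this
  exact this

lemma lOrd_root_data (hU : IsOpen U) (hUM : U ⊆ D.M) (B : D.Branches U) (hx : x ∈ U)
    (q : D.FinPole) {d : ℕ} (hd : deg q = d) (hd1 : 1 ≤ d) :
    LOrd (fun y => (place y (some q)).expand (lam y)) x (-d) ∧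
    (∀ᶠ y in 𝓝 x, B.root q y ^ d = (place y (some q)).expand (lam y)) ∧
    AnalyticAt ℂ (fun y => (B.root q y).coeff (-1)) x := by
  have hUx := hU.mem_nhds hx
  have hq : 1 ≤ deg q := by omega
  have ho := lOrd_lam_pos hUM hUx q
  rw [hd] at ho
  have hpow : ∀ y ∈ U, B.root q y ^ d = (place y (some q)).expand (lam y) := fun y hy => by
    have := B.root_pow q hq y hy
    rwa [hd, zpow_natCast] at this
  refine ⟨ho, ?_, ?_⟩
  · filter_upwards [hUx] with y hy using hpow y hy
  · refine analyticAt_of_pow_eq hd1 ((logPD_lam (ξ := 0) (hUM hx) (some q)).an.an (-d)) ho.2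
      (continuousAt_of_branch hU hx (B.root_cont q hq)) ?_
    filter_upwards [hUx] with y hy
    have h1 := order_lam_pos (hUM hy) q
    have h2 : OrdGE ((place y (some q)).expand (lam y)) (-d) := by
      rw [← hd, ← h1]; exact ordGE_order _
    have h3 : ((place y (some q)).expand (lam y)).coeff (-d) ≠ 0 := by
      rw [← hd, ← h1]
      exact HahnSeries.coeff_order_eq_zero.not.2 (Place.expand_ne_zero _ (lam_ne_zero y))
    have h4 : OrdGE (B.root q y) (-1) := by
      rw [← order_of_pow_eq hd1 (hpow y hy) h2 h3]; exact ordGE_order _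
    rw [← hpow y hy]
    have h5 := (pow_lead h4 d).2
    rw [mul_neg_one] at h5
    exact h5.symm

lemma coord_tFin_root (hU : IsOpen U) (hUM : U ⊆ D.M) (B : D.Branches U) (hx : x ∈ U)
    (q : D.FinPole) {j : ℕ} (hj : (j : ℤ) < deg q) : AnalyticAt ℂ (tFin B q j) x ∧
    ∀ ξ, fderiv ℂ (tFin B q j) x ξ = (place x (some q)).tr D.s
      (B.root q x ^ (-(j : ℤ)) * (place x (some q)).expand (tangent x ξ)) := by
  obtain ⟨d, hd⟩ := Int.eq_ofNat_of_zero_le (a := deg q) (by omega)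
  have hd1 : 1 ≤ d := by omega
  obtain ⟨h1, h2, h3⟩ := lOrd_root_data hU hUM B hx q hd hd1
  have := coord_root (hUM hx) (some q) hd1 h1 h2 h3 (j := j) (by omega)
  have hfun : tFin B q j = fun y =>
      1 / (1 - ((j : ℤ) : ℂ) / d) * (place y (some q)).tr D.s (B.root q y ^ ((d : ℤ) - j)) := by
    funext y
    rw [tFin, if_pos hj, hd, Int.cast_natCast, Int.cast_natCast]
    rfl
  rw [hfun]
  exact this

lemma lOrd_mul_zpow_pos (hU : IsOpen U) (hUM : U ⊆ D.M) (hx : x ∈ U) (q : D.FinPole) :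
    LOrd (fun y => (place y (some q)).expand ((RatFunc.X - RatFunc.C (pos y q)) ^ deg q * lam y))
      x 0 := by
  have ho := lOrd_lam_pos hUM (hU.mem_nhds hx) q
  have h1 : LOrd (fun y : D.Param =>
      (place y (some q)).expand ((RatFunc.X - RatFunc.C (pos y q)) ^ deg q)) x (deg q) := by
    have : ∀ y : D.Param, (place y (some q)).expand ((RatFunc.X - RatFunc.C (pos y q)) ^ deg q) =
        HahnSeries.single (deg q) 1 := fun y => (Place.fin (pos y q)).expand_unif_zpow (deg q)
    simp only [this]
    exact ⟨Eventually.of_forall fun _ => ordGE_single _ _, by simp⟩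
  have := h1.mul ho
  rw [add_neg_cancel] at this
  simpa only [Place.expand_mul] using this

lemma lOrd_sep (hx : x ∈ D.M) {q q' : D.FinPole} (h : q' ≠ q) :
    LOrd (fun y => (place y (some q')).expand (RatFunc.X - RatFunc.C (pos y q))) x 0 := by
  refine ⟨Eventually.of_forall fun y => Place.ordGE_X_sub_C_fin _ _, ?_⟩
  change ((Place.fin (pos x q')).expand (RatFunc.X - RatFunc.C (pos x q))).coeff 0 ≠ 0
  rw [Place.coeff_X_sub_C_fin]
  exact sub_ne_zero.2 ((pos_injective hx).ne h)

lemma lOrd_mul_zpow_inf (q : D.FinPole) :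
    LOrd (fun y : D.Param =>
      (place y none).expand ((RatFunc.X - RatFunc.C (pos y q)) ^ (-(D.n : ℤ)) * lam y)) x 0 := by
  have h0 : ∀ y : D.Param, (Place.inf.expand
      ((RatFunc.X - RatFunc.C (pos y q)) ^ (-(D.n : ℤ)) * lam y)).order = 0 := fun y => by
    rw [Place.expand_mul, HahnSeries.order_mul, Place.order_X_sub_C_zpow_inf, order_lam_inf]
    · ring
    · exact Place.expand_ne_zero _ (zpow_ne_zero _ (X_sub_C_ne_zero' _))
    · exact Place.expand_ne_zero _ (lam_ne_zero y)
  refine ⟨Eventually.of_forall fun y => ?_, ?_⟩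
  · rw [← h0 y]; exact ordGE_order _
  · rw [← h0 x]
    exact HahnSeries.coeff_order_eq_zero.not.2 (Place.expand_ne_zero _
      (mul_ne_zero (zpow_ne_zero _ (X_sub_C_ne_zero' _)) (lam_ne_zero x)))

/-- The derivative of the trace of a branch of the logarithm of a function. -/
lemma coord_log (hU : IsOpen U) (hUM : U ⊆ D.M) (hx : x ∈ U) (ν : D.Marked)
    {f : D.Param → RatFunc ℂ} {g : D.Param → RatFunc ℂ} {l : D.Param → LaurentSeries ℂ}
    (hf : ∀ ξ, LogPD (speed ν ξ) (fun y => (place y ν).expand (f y)) x ξ ((place x ν).expand (g ξ)))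
    (ho : LOrd (fun y => (place y ν).expand (f y)) x 0)
    (hl : ∀ y ∈ U, IsLog ((place y ν).expand (f y)) (l y))
    (hl0 : ContinuousOn (fun y => (l y).coeff 0) U) :
    AnalyticAt ℂ (fun y => (place y ν).tr D.s (l y)) x ∧
    ∀ ξ, fderiv ℂ (fun y => (place y ν).tr D.s (l y)) x ξ =
      (place x ν).rres (RatFunc.X ^ (-(D.s : ℤ)) * g ξ) := by
  have hl' : ∀ᶠ y in 𝓝 x, IsLog ((place y ν).expand (f y)) (l y) := by
    filter_upwards [hU.mem_nhds hx] with y hy using hl y hy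
  have h0 : AnalyticAt ℂ (fun y => (l y).coeff 0) x :=
    analyticAt_of_exp_eq ((hf 0).an.an 0) (continuousAt_of_branch hU hx hl0)
      (hl'.mono fun y hy => hy.exp_eq)
  have han := lAn_log (hf 0).an ho hl' h0
  refine ⟨analyticAt_tr (hUM hx) ν han, fun ξ => ?_⟩
  rw [fderiv_tr (hUM hx) ν han (hasLD_log (hf ξ) ho hl' han), Place.tr_expand]

lemma logPD_zpow_mul_lam (hx : x ∈ D.M) (ν : D.Marked) (q : D.FinPole) (k : ℤ) (ξ : D.Param) :
    LogPD (speed ν ξ)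
      (fun y => (place y ν).expand ((RatFunc.X - RatFunc.C (pos y q)) ^ k * lam y)) x ξ
      ((place x ν).expand
        (RatFunc.C (-(k * pos ξ q)) * (RatFunc.X - RatFunc.C (pos x q))⁻¹ + logTangent x ξ)) := by
  have h := ((logPD_pos (ξ := ξ) hx ν q).zpow k).mul (logPD_lam (ξ := ξ) hx ν)
  simp only [Place.expand_mul, Place.expand_zpow]
  convert h using 1
  rw [Place.expand_add, Place.expand_mul, Place.expand_mul, Place.expand_C, Place.expand_C]
  simp only [map_neg, map_mul, map_intCast]
  ring

lemma coord_tLog (hU : IsOpen U) (hUM : U ⊆ D.M) (B : D.Branches U) (hx : x ∈ U)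
    (q : D.FinPole) (hq : 1 ≤ deg q) : AnalyticAt ℂ (tLog B q) x ∧
    ∀ ξ, fderiv ℂ (tLog B q) x ξ = (place x (some q)).tr D.s
      ((place x (some q)).expand (logTangent x ξ)) := by
  have hxM := hUM hx
  have h1 := coord_log hU hUM hx (some q) (logPD_zpow_mul_lam hxM (some q) q (deg q))
    (lOrd_mul_zpow_pos hU hUM hx q) (B.logFin_isLog q hq) (B.logFin_cont q hq)
  have h2 := coord_log hU hUM hx none (logPD_zpow_mul_lam hxM none q (-(D.n : ℤ)))
    (lOrd_mul_zpow_inf q) (B.logInf_isLog q hq) (B.logInf_cont q hq)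
  have h3 : ∀ q' ∈ Finset.univ.erase q, _ := fun q' hq' =>
    coord_log hU hUM hx (some q') (fun ξ => logPD_pos (ξ := ξ) hxM (some q') q)
      (lOrd_sep hxM (Finset.ne_of_mem_erase hq'))
      (B.logSep_isLog q q' hq (Finset.ne_of_mem_erase hq'))
      (B.logSep_cont q q' hq (Finset.ne_of_mem_erase hq'))
  have hfun : tLog B q = fun y => (place y (some q)).tr D.s (B.logFin q y) +
      (deg q : ℂ) / D.n * (place y none).tr D.s (B.logInf q y) +
      (deg q : ℂ) * ∑ q' ∈ Finset.univ.erase q, (place y (some q')).tr D.s (B.logSep q q' y) := rfl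
  have hsum : AnalyticAt ℂ (fun y => ∑ q' ∈ Finset.univ.erase q,
      (place y (some q')).tr D.s (B.logSep q q' y)) x :=
    Finset.analyticAt_fun_sum _ fun q' hq' => (h3 q' hq').1
  rw [hfun]
  refine ⟨(h1.1.add (analyticAt_const.mul h2.1)).add (analyticAt_const.mul hsum), fun ξ => ?_⟩
  have h2' := h2.1.differentiableAt.const_mul ((deg q : ℂ) / D.n)
  rw [fderiv_fun_add (h1.1.differentiableAt.fun_add h2') (hsum.differentiableAt.const_mul _),
    fderiv_fun_add h1.1.differentiableAt h2',
    fderiv_const_mul h2.1.differentiableAt, fderiv_const_mul hsum.differentiableAt,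
    fderiv_fun_sum fun q' hq' => (h3 q' hq').1.differentiableAt]
  simp only [_root_.add_apply, _root_.smul_apply, _root_.sum_apply, smul_eq_mul]
  rw [h1.2, h2.2, Finset.sum_congr rfl fun q' hq' => (h3 q' hq').2 ξ, Place.tr_expand]
  set G : RatFunc ℂ := RatFunc.X ^ (-(D.s : ℤ)) * (RatFunc.X - RatFunc.C (pos x q))⁻¹ with hG
  have hmul : ∀ c : ℂ, RatFunc.X ^ (-(D.s : ℤ)) *
      (RatFunc.C c * (RatFunc.X - RatFunc.C (pos x q))⁻¹) = RatFunc.C c * G := fun c => by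
    rw [hG, mul_left_comm]
  simp only [mul_add, Place.rres_add, hmul, Place.rres_C_mul]
  have hT : totalRes x G = 0 := by
    refine totalRes_eq_zero hxM fun c hc => ?_
    rw [hG, Place.expand_mul, show (0 : ℤ) = 0 + 0 by rfl]
    refine (ordGE_Xs_fin (unmarked_ne_zero hc)).mul ((ordGE_order _).mono ?_)
    have := Place.order_X_sub_C_zpow_fin (hc q).symm (-1)
    rw [zpow_neg_one] at this
    exact this.ge
  have hinf : (place x none).rres (RatFunc.X ^ (-(D.s : ℤ)) * logTangent x ξ) = 0 := by
    apply Place.rres_inf_eq_zero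
    rw [Place.expand_mul, expand_Xs_inf]
    exact ((ordGE_single _ _).mul (ordGE_logTangent_inf x ξ)).mono (by omega)
  have hn : (D.n : ℂ) ≠ 0 := by
    have := D.n_pos
    exact_mod_cast (by omega : D.n ≠ 0)
  rw [totalRes, ← Finset.add_sum_erase _ _ (Finset.mem_univ q), sub_eq_zero] at hT
  rw [hinf, ← Finset.mul_sum]
  change (place x none).rres G = (place x (some q)).rres G +
    ∑ q' ∈ Finset.univ.erase q, (place x (some q')).rres G at hT
  rw [hT]
  push_cast
  field_simp
  ring

lemma coord_spec (hU : IsOpen U) (hUM : U ⊆ D.M) (B : D.Branches U) (hx : x ∈ U) (b : D.Index) :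
    AnalyticAt ℂ (coord B b) x ∧
      Represents (indexPole b) x (diffRep B x b) (fderiv ℂ (coord B b) x) := by
  rcases b with i | ⟨q, j⟩
  · have h := coord_tInf hU hUM B hx (i := i + 1) (by omega)
    refine ⟨h.1, fun ξ => ?_⟩
    have h2 := tr_trunc (hUM hx) none (B.rootInf x ^ (-((i : ℤ) + 1))) ξ rfl
    refine (h.2 ξ).trans ?_
    rw [Nat.cast_add, Nat.cast_one]
    exact h2.symm
  · have hj := j.2
    have hq : 1 ≤ deg q := by
      have := deg_cases q
      omega
    by_cases hjd : ((j : ℕ) : ℤ) < deg q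
    · have h := coord_tFin_root hU hUM B hx q hjd
      exact ⟨h.1, fun ξ => (h.2 ξ).trans
        (tr_trunc (hUM hx) (some q) (B.root q x ^ (-(j : ℤ))) ξ rfl).symm⟩
    · have h := coord_tLog hU hUM B hx q hq
      have hfun : coord B (Sum.inr ⟨q, j⟩) = tLog B q := by
        funext y
        change tFin B q j y = _
        rw [tFin, if_neg hjd]
      rw [hfun]
      refine ⟨h.1, fun ξ => (h.2 ξ).trans ?_⟩
      refine Eq.trans ?_ (tr_trunc (hUM hx) (some q) (B.root q x ^ (-(j : ℤ))) ξ rfl).symm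
      have hjd' : ((j : ℕ) : ℤ) = deg q := by omega
      rw [hjd', zpow_neg, B.root_pow q hq x hx, tangent_eq, Place.expand_mul]
      change _ = Place.tr _ _ ((Place.expand _ _)⁻¹ * (Place.expand (Place.fin (pos x q)) _ * _))
      rw [inv_mul_cancel_left₀ (Place.expand_ne_zero _ (lam_ne_zero x))]

end Shape
end FlatCoord
end


noncomputable section
namespace FlatCoord
open Polynomial

/-! ### Residues of powers of a root -/

lemma ordGE_zpow {R : LaurentSeries ℂ} (hR : R.order = -1) (h0 : R ≠ 0) (k : ℤ) :
    OrdGE (R ^ k) (-k) := by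
  have := ordGE_order (R ^ k)
  rwa [order_zpow' h0, hR, mul_neg_one] at this

lemma coeff_dz_zpow_mul_zpow {R : LaurentSeries ℂ} (hR : R.order = -1) (h0 : R ≠ 0) (d r : ℤ) :
    (dz (R ^ d) * R ^ (-r)).coeff (-1) = if r = d then -(d : ℂ) else 0 := by
  have h1 : OrdGE R (-1) := hR ▸ ordGE_order R
  have h2 : R.coeff (-1) ≠ 0 := hR ▸ HahnSeries.coeff_order_eq_zero.not.2 h0
  have hw : dz R = R * (dz R * R⁻¹) := by field_simp
  have hz := fun k : ℤ => leibniz_log_zpow dz_mul h0 hw k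
  have hC : ∀ (k : ℤ) (f : LaurentSeries ℂ), ((k : LaurentSeries ℂ) * f).coeff (-1) =
      k * f.coeff (-1) := fun k f => by
    rw [← map_intCast HahnSeries.C k, HahnSeries.C_apply, HahnSeries.coeff_single_zero_mul]
  split_ifs with h
  · subst h
    have h3 : dz (R ^ r) * R ^ (-r) = r * (dz R * R⁻¹) := by
      rw [hz, mul_right_comm, ← zpow_add₀ h0, add_neg_cancel, zpow_zero, one_mul]
    have h4 := coeff_mul_lead h1.dz (h1.inv h2)
    rw [show (-1 - 1 + - -1 : ℤ) = -1 by norm_num, coeff_inv_lead h1 h2, coeff_dz] at h4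
    rw [h3, hC, h4]
    norm_num
    rw [mul_inv_cancel₀ h2, mul_one]
  · have h3 : ((d - r : ℤ) : LaurentSeries ℂ) * (dz (R ^ d) * R ^ (-r)) = d * dz (R ^ (d - r)) := by
      rw [hz, hz, sub_eq_add_neg, zpow_add₀ h0]; ring
    have h4 := congrArg (fun f : LaurentSeries ℂ => f.coeff (-1)) h3
    simp only [hC, coeff_dz_neg_one, mul_zero, mul_eq_zero] at h4
    refine h4.resolve_left ?_
    exact_mod_cast sub_ne_zero.2 (Ne.symm h)

namespace Place

lemma neg_fin_eq_zero {c : ℂ} {f : RatFunc ℂ} (h : OrdGE ((Place.fin c).expand f) 0) :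
    (Place.fin c).neg f = 0 := by
  apply (Place.fin c).expand_injective
  ext k
  rw [neg_fin, coeff_expand_trunc, expand_zero]
  split_ifs with hk
  · exact h k (by omega)
  · rfl

lemma nonneg_inf_eq_zero {f : RatFunc ℂ} (h : OrdGE (Place.inf.expand f) 1) :
    Place.inf.nonneg f = 0 := by
  apply Place.inf.expand_injective
  ext k
  rw [nonneg, coeff_expand_trunc, expand_zero]
  split_ifs with hk
  · exact h k (by omega)
  · rfl

lemma ordGE_expand_trunc (ν : Place) (l : ℤ) {f : LaurentSeries ℂ} {e : ℤ} (h : OrdGE f e) :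
    OrdGE (ν.expand (ν.trunc l f)) e := fun k hk => by
  rw [coeff_expand_trunc, h k hk, ite_self]

lemma ordGE_expand_trunc_sub (ν : Place) (l : ℤ) (f : LaurentSeries ℂ) :
    OrdGE (ν.expand (ν.trunc l f) - f) (l + 1) := fun k hk => by
  rw [HahnSeries.coeff_sub, coeff_expand_trunc, if_pos (by omega), sub_self]

lemma ordGE_expand_trunc_mul_sub (ν : Place) {l : ℤ} {f g : LaurentSeries ℂ} {e : ℤ}
    (hf : OrdGE f e) (hg : OrdGE g e) :
    OrdGE (ν.expand (ν.trunc l f) * ν.expand (ν.trunc l g) - f * g) (l + 1 + e) := by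
  have h1 := (ν.ordGE_expand_trunc_sub l f).mul (ν.ordGE_expand_trunc l hg)
  have h2 := hf.mul (ν.ordGE_expand_trunc_sub l g)
  rw [add_comm e] at h2
  convert h1.add h2 using 1
  ring

/-- A truncated expansion is a polynomial in the inverse of the local parameter, up to a power
of the latter. -/
lemma exists_trunc_eq (ν : Place) {l e : ℤ} {f : LaurentSeries ℂ} (hf : OrdGE f e) {d : ℕ}
    (hd : l - e < d) : ∃ p ∈ degreeLT ℂ d, ν.trunc l f = ν.unif ^ l * aeval ν.unif⁻¹ p := by
  refine ⟨∑ i ∈ Finset.Icc f.order l, monomial (l - i).toNat (f.coeff i), ?_, ?_⟩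
  · refine Submodule.sum_mem _ fun i hi => ?_
    rw [Finset.mem_Icc] at hi
    by_cases h : i < e
    · rw [hf i h, map_zero]; exact Submodule.zero_mem _
    · rw [mem_degreeLT]
      refine (degree_monomial_le _ _).trans_lt ?_
      exact_mod_cast (by omega : (l - i).toNat < d)
  · rw [trunc, map_sum, Finset.mul_sum]
    refine Finset.sum_congr rfl fun i hi => ?_
    rw [Finset.mem_Icc] at hi
    have h1 : ν.unif⁻¹ ^ (l - i).toNat = ν.unif ^ (i - l) := by
      rw [inv_pow, ← zpow_natCast, ← zpow_neg, Int.toNat_of_nonneg (by omega), neg_sub]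
    rw [aeval_monomial, h1, mul_left_comm, ← zpow_add₀ ν.unif_ne_zero, add_sub_cancel]
    rfl

end Place

namespace Shape

variable {D : Shape} {x : D.Param}

/-! ### The components of the metric -/

lemma traceForm_trunc_fin (hx : x ∈ D.M) (q : D.FinPole) {R : LaurentSeries ℂ}
    (hR : R ^ deg q = (place x (some q)).expand (lam x)) (hR1 : R.order = -1) (hR0 : R ≠ 0)
    (j k : ℕ) :
    traceForm (some q) x ((place x (some q)).trunc (deg q) (R ^ (-(j : ℤ))))
      ((place x (some q)).trunc (deg q) (R ^ (-(k : ℤ)))) =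
      if (j : ℤ) + k = deg q then (deg q : ℂ) else 0 := by
  have hj : ∀ j : ℕ, OrdGE (R ^ (-(j : ℤ))) 0 := fun j =>
    (ordGE_zpow hR1 hR0 _).mono (by omega)
  have hs : ∀ j : ℕ, (place x (some q)).neg
      ((place x (some q)).trunc (deg q) (R ^ (-(j : ℤ)))) = 0 := fun j =>
    Place.neg_fin_eq_zero (Place.ordGE_expand_trunc _ _ (hj j))
  rw [traceForm_eq, sharp_eq, hs, mul_zero, zero_sub, neg_mul, mul_comm, Place.rres_neg,
    Place.rres_mul_neg]
  have h1 := Place.nonneg_add_neg (place x (some q))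
    ((place x (some q)).trunc (deg q) (R ^ (-(k : ℤ))))
  rw [hs, add_zero] at h1
  rw [h1]
  have h2 := (ordGE_pDeriv_lam_pos hx q).mul (Place.ordGE_expand_trunc_mul_sub (place x (some q))
    (l := deg q) (hj j) (hj k)) (-1) (by omega)
  have h3 := coeff_dz_zpow_mul_zpow hR1 hR0 (deg q) (j + k)
  rw [mul_sub, HahnSeries.coeff_sub, sub_eq_zero] at h2
  have h4 : R ^ (-((j : ℤ) + k)) = R ^ (-(j : ℤ)) * R ^ (-(k : ℤ)) := by
    rw [← zpow_add₀ hR0]; congr 1; ring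
  have h5 : (place x (some q)).expand (pDeriv (lam x)) = dz (R ^ deg q) := by
    rw [Place.expand_pDeriv, hR]; rfl
  change -(((place x (some q)).expand _).coeff (-1)) = _
  rw [mul_left_comm, Place.expand_mul, Place.expand_mul,
    mul_comm ((place x (some q)).expand (Place.trunc _ _ (R ^ (-(k : ℤ)))))]
  refine (congrArg Neg.neg h2).trans ?_
  rw [← h4]
  change -(((place x (some q)).expand (pDeriv (lam x)) * _).coeff (-1)) = _
  rw [h5, h3]
  split_ifs <;> simp

lemma traceForm_trunc_inf {R : LaurentSeries ℂ} (hR : R ^ D.n = Place.inf.expand (lam x))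
    (hR1 : R.order = -1) (hR0 : R ≠ 0) {j k : ℤ} (hj : 1 ≤ j) (hk : 1 ≤ k) :
    traceForm none x (Place.inf.trunc ((D.n : ℤ) - 1) (R ^ (-j)))
      (Place.inf.trunc ((D.n : ℤ) - 1) (R ^ (-k))) =
      if j + k = D.n then (D.n : ℂ) else 0 := by
  have hz : ∀ j : ℤ, 1 ≤ j → OrdGE (R ^ (-j)) 1 := fun j hj =>
    (ordGE_zpow hR1 hR0 _).mono (by omega)
  have hs : ∀ j : ℤ, 1 ≤ j → Place.inf.nonneg
      (Place.inf.trunc ((D.n : ℤ) - 1) (R ^ (-j))) = 0 := fun j hj =>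
    Place.nonneg_inf_eq_zero (Place.ordGE_expand_trunc _ _ (hz j hj))
  rw [traceForm_eq, sharp]
  change Place.inf.rres ((Place.inf.nonneg _ - _ * Place.inf.nonneg _) * _) = _
  rw [hs j hj, mul_zero, sub_zero, ← Place.rres_mul_neg, Place.neg, hs k hk, sub_zero]
  have h2 := (ordGE_pDeriv_lam_inf x).mul (Place.ordGE_expand_trunc_mul_sub Place.inf
    (l := (D.n : ℤ) - 1) (hz j hj) (hz k hk)) 1 (by omega)
  have h3 := coeff_dz_zpow_mul_zpow hR1 hR0 D.n (j + k)
  rw [mul_sub, HahnSeries.coeff_sub, sub_eq_zero] at h2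
  have h4 : R ^ (-(j + k)) = R ^ (-j) * R ^ (-k) := by
    rw [← zpow_add₀ hR0]; congr 1; ring
  have h5 : Place.inf.expand (pDeriv (lam x)) =
      HahnSeries.single 2 (-1) * dz (R ^ (D.n : ℤ)) := by
    rw [Place.expand_pDeriv, zpow_natCast, hR, HahnSeries.single_neg]; rfl
  change (Place.inf.expand _).coeff 1 = _
  rw [mul_assoc, Place.expand_mul, Place.expand_mul, h2, ← h4, h5, mul_assoc, show (1 : ℤ) = -1 + 2 by norm_num, HahnSeries.coeff_single_mul_add, h3]
  split_ifs <;> simp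

lemma sharp_fin {q : D.FinPole} {α : RatFunc ℂ} (h : OrdGE ((place x (some q)).expand α) 0) :
    sharp (some q) x α = -(place x (some q)).neg (pDeriv (lam x) * α) := by
  rw [sharp_eq]
  change _ * (Place.fin _).neg α - _ = _
  rw [Place.neg_fin_eq_zero h, mul_zero, zero_sub]

lemma sharp_inf {α : RatFunc ℂ} (h : OrdGE ((place x none).expand α) 1) :
    sharp none x α = (place x none).nonneg (pDeriv (lam x) * α) := by
  rw [sharp]
  change _ - _ * Place.inf.nonneg α = _
  rw [Place.nonneg_inf_eq_zero h, mul_zero, sub_zero]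

/-- The label of the coordinate paired with a given one by the metric. -/
def dualIndex : D.Index → D.Index
  | .inl i => .inl i.rev
  | .inr ⟨q, j⟩ => .inr ⟨q, j.rev⟩

lemma dualIndex_dualIndex (b : D.Index) : dualIndex (dualIndex b) = b := by
  rcases b with i | ⟨q, j⟩ <;> simp [dualIndex]

/-- The component of the metric between a coordinate and its dual. -/
def indexWeight : D.Index → ℂ
  | .inl _ => D.n
  | .inr ⟨q, _⟩ => deg q

lemma one_le_deg (q : D.FinPole) (j : Fin (deg q + 1).toNat) : 1 ≤ deg q := by
  have := deg_cases q
  have := j.2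
  omega

lemma indexWeight_ne_zero (b : D.Index) : indexWeight b ≠ 0 := by
  rcases b with i | ⟨q, j⟩
  · have := D.n_pos
    exact Nat.cast_ne_zero.2 (by omega)
  · have := one_le_deg q j
    exact Int.cast_ne_zero.2 (by omega)

variable {U : Set D.Param}

lemma order_rootInf (B : D.Branches U) (hx : x ∈ U) :
    (B.rootInf x).order = -1 ∧ B.rootInf x ≠ 0 := by
  refine ⟨order_of_pow_eq D.n_pos (B.rootInf_pow x hx) (lOrd_lam_inf (x := x)).1.self_of_nhds
    (lOrd_lam_inf (x := x)).2, fun h => ?_⟩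
  have := B.rootInf_lead x hx
  rw [h] at this
  exact zero_ne_one this

lemma order_root (hUM : U ⊆ D.M) (B : D.Branches U) (hx : x ∈ U) {q : D.FinPole}
    (hq : 1 ≤ deg q) : (B.root q x).order = -1 ∧ B.root q x ≠ 0 := by
  have hpow := B.root_pow q hq x hx
  have h0 : B.root q x ≠ 0 := by
    intro h
    rw [h, zero_zpow _ (by omega)] at hpow
    exact Place.expand_ne_zero _ (lam_ne_zero x) hpow.symm
  have h1 := congrArg HahnSeries.order hpow
  rw [order_zpow' h0, order_lam_pos (hUM hx)] at h1
  exact ⟨mul_left_cancel₀ (by omega : deg q ≠ 0) (by rw [h1]; ring), h0⟩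

lemma ordGE_diffRep_inf (B : D.Branches U) (hx : x ∈ U) (i : Fin (D.n - 1)) :
    OrdGE ((place x none).expand (diffRep B x (.inl i))) 1 :=
  Place.ordGE_expand_trunc _ _
    ((ordGE_zpow (order_rootInf B hx).1 (order_rootInf B hx).2 _).mono (by omega))

lemma ordGE_diffRep_fin (hUM : U ⊆ D.M) (B : D.Branches U) (hx : x ∈ U) (q : D.FinPole)
    (j : Fin (deg q + 1).toNat) :
    OrdGE ((place x (some q)).expand (diffRep B x (.inr ⟨q, j⟩))) 0 := by
  have h := order_root hUM B hx (one_le_deg q j)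
  exact Place.ordGE_expand_trunc _ _ ((ordGE_zpow h.1 h.2 _).mono (by omega))

lemma exists_sharp_diffRep (hU : IsOpen U) (hUM : U ⊆ D.M) (B : D.Branches U) (hx : x ∈ U)
    (b : D.Index) : ∃ ξ, sharp (indexPole b) x (diffRep B x b) = ztan x ξ ∧
      ∀ b', fderiv ℂ (coord B b') x ξ = if b' = dualIndex b then indexWeight b else 0 := by
  obtain ⟨ξ, hξ⟩ := (isTan_sharp (hUM hx) (indexPole b) (diffRep B x b)).exists_tangent (hUM hx)
  refine ⟨ξ, hξ.symm, fun b' => ?_⟩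
  have h' := (coord_spec hU hUM B hx b').2
  by_cases hp : indexPole b' = indexPole b
  · rw [hp] at h'
    rw [← traceForm_eq_apply h' hξ.symm]
    rcases b with i | ⟨q, j⟩ <;> rcases b' with i' | ⟨q', j'⟩
    · refine (traceForm_trunc_inf (B.rootInf_pow x hx) (order_rootInf B hx).1
        (order_rootInf B hx).2 (by omega) (by omega)).trans ?_
      refine if_congr ?_ rfl rfl
      rw [dualIndex, Sum.inl.injEq, Fin.ext_iff, Fin.val_rev]
      omega
    · cases hp
    · cases hp
    · obtain rfl : q' = q := Option.some_injective _ hp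
      have h := order_root hUM B hx (one_le_deg q' j)
      refine (traceForm_trunc_fin (hUM hx) q' (B.root_pow q' (one_le_deg q' j) x hx) h.1 h.2
        j j').trans ?_
      refine if_congr ?_ rfl rfl
      rw [dualIndex, Sum.inr.injEq, Sigma.mk.injEq, heq_eq_eq, Fin.ext_iff, Fin.val_rev,
        eq_self_iff_true, true_and]
      have := one_le_deg q' j
      have := j.2
      have := j'.2
      omega
  · rw [if_neg, represents_iff.1 h', hξ]
    swap
    · rintro rfl
      rcases b with i | ⟨q, j⟩ <;> exact hp rfl
    rcases b with i | ⟨q, j⟩ <;> rcases b' with i' | ⟨q', j'⟩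
    · exact absurd rfl hp
    · change (place x (some q')).rres (_ * sharp none x _) = 0
      rw [sharp_inf (ordGE_diffRep_inf B hx i)]
      refine Place.rres_fin_eq_zero ?_
      rw [Place.expand_mul]
      exact (ordGE_diffRep_fin hUM B hx q' j').mul (Place.ordGE_nonneg_inf_fin _ _)
    · change Place.inf.rres (_ * sharp (some q) x _) = 0
      rw [sharp_fin (ordGE_diffRep_fin hUM B hx q j)]
      refine Place.rres_inf_eq_zero ?_
      rw [Place.expand_mul, Place.expand_neg]
      exact (ordGE_diffRep_inf B hx i').mul (Place.ordGE_neg_fin_inf _ _).neg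
    · change (place x (some q')).rres (_ * sharp (some q) x _) = 0
      rw [sharp_fin (ordGE_diffRep_fin hUM B hx q j)]
      refine Place.rres_fin_eq_zero ?_
      have hqq : q' ≠ q := fun h => hp (congrArg some h)
      rw [Place.expand_mul, Place.expand_neg]
      exact (ordGE_diffRep_fin hUM B hx q' j').mul
        (Place.ordGE_neg_fin_fin ((pos_injective (hUM hx)).ne hqq) _).neg

lemma cometric_coord (hU : IsOpen U) (hUM : U ⊆ D.M) (B : D.Branches U) (hx : x ∈ U)
    (ν : D.Marked) (b b' : D.Index) :
    cometric ν x (fderiv ℂ (coord B b) x) (fderiv ℂ (coord B b') x) =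
      if b' = dualIndex b then indexWeight b else 0 := by
  obtain ⟨ξ, h1, h2⟩ := exists_sharp_diffRep hU hUM B hx b
  rw [cometric_eq_apply (hUM hx) ν _ _ (coord_spec hU hUM B hx b).2 h1, h2]

/-! ### The coordinates form a chart -/

lemma sum_toNat_deg_add_one :
    ((∑ q : D.FinPole, (deg q + 1).toNat : ℕ) : ℤ) + (D.n - 1 : ℕ) = D.N := by
  have h := sum_deg_add_one (D := D)
  have h1 : ((∑ q : D.FinPole, (deg q + 1).toNat : ℕ) : ℤ) = ∑ q : D.FinPole, (deg q + 1) := by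
    push_cast
    refine Finset.sum_congr rfl fun q _ => ?_
    have := deg_cases q
    omega
  have := D.n_pos
  omega

lemma card_index : Fintype.card D.Index = D.N := by
  have := sum_toNat_deg_add_one (D := D)
  simp only [Fintype.card_sum, Fintype.card_sigma, Fintype.card_fin]
  omega

lemma bijective_coord (hU : IsOpen U) (hUM : U ⊆ D.M) (B : D.Branches U) (hx : x ∈ U) :
    Function.Bijective fun (ξ : D.Param) (b : D.Index) => fderiv ℂ (coord B b) x ξ := by
  let T : D.Param →ₗ[ℂ] (D.Index → ℂ) := LinearMap.pi fun b => (fderiv ℂ (coord B b) x : _ →ₗ[ℂ] _)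
  have hsurj : Function.Surjective T := by
    choose ξ _ h2 using fun b => exists_sharp_diffRep hU hUM B hx b
    intro y
    refine ⟨∑ b, (y (dualIndex b) / indexWeight b) • ξ b, funext fun b => ?_⟩
    change fderiv ℂ (coord B b) x _ = _
    rw [map_sum, Finset.sum_eq_single (dualIndex b)]
    · rw [map_smul, h2, dualIndex_dualIndex, if_pos rfl, smul_eq_mul,
        div_mul_cancel₀ _ (indexWeight_ne_zero _)]
    · intro b' _ hb'
      rw [map_smul, h2, if_neg, smul_zero]
      rintro rfl
      exact hb' (dualIndex_dualIndex b').symm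
    · intro h
      exact absurd (Finset.mem_univ _) h
  have hrank : Module.finrank ℂ D.Param = Module.finrank ℂ (D.Index → ℂ) := by
    rw [(finrank_and_range_ztan (hUM hx)).1, Module.finrank_fintype_fun_eq_card, card_index]
  exact ⟨(LinearMap.injective_iff_surjective_of_finrank_eq_finrank hrank).2 hsurj, hsurj⟩

lemma isFlatCoordinates_coord (hU : IsOpen U) (hUM : U ⊆ D.M) (B : D.Branches U) (ν : D.Marked) :
    IsFlatCoordinates U (cometric ν) (coord B) :=
  isFlatCoordinates_of_gram hU (isContravariantMetric_cometric hUM ν)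
    (fun b _ hx => (coord_spec hU hUM B hx b).1) (fun _ hx => bijective_coord hU hUM B hx)
    fun _ hx => cometric_coord hU hUM B hx ν

lemma diffRep_mem (hUM : U ⊆ D.M) (B : D.Branches U) (hx : x ∈ U) (b : D.Index) :
    diffRep B x b ∈ cotangentRep x (indexPole b) := by
  have hN := sum_toNat_deg_add_one (D := D)
  rcases b with i | ⟨q, j⟩
  · have h := ordGE_zpow (order_rootInf B hx).1 (order_rootInf B hx).2 (-((i : ℤ) + 1))
    obtain ⟨f, hf, h1⟩ := Place.inf.exists_trunc_eq (l := (D.n : ℤ) - 1) (d := D.N) h (by omega)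
    refine ⟨f, hf, h1.trans ?_⟩
    rw [Place.unif, inv_inv, inv_zpow', neg_sub]
  · have h := order_root hUM B hx (one_le_deg q j)
    have h2 := ordGE_zpow h.1 h.2 (-(j : ℤ))
    have h3 := Finset.single_le_sum (f := fun q : D.FinPole => (deg q + 1).toNat)
      (fun _ _ => Nat.zero_le _) (Finset.mem_univ q)
    obtain ⟨f, hf, h1⟩ := (Place.fin (pos x q)).exists_trunc_eq (l := deg q) (d := D.N) h2 (by
      have := deg_cases q
      omega)
    exact ⟨f, hf, h1⟩

end Shape
end FlatCoord
end


noncomputable section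
namespace FlatCoord
open Filter Topology

/-! ### Roots and logarithms of Laurent series -/

lemma exists_isLog {u : LaurentSeries ℂ} (hu : OrdGE u 0) (h0 : u.coeff 0 ≠ 0) {c : ℂ}
    (hc : Complex.exp c = u.coeff 0) : ∃ l, IsLog u l ∧ l.coeff 0 = c := by
  let w := dz u * u⁻¹
  have hw : OrdGE w 0 := hu.dz_zero.mul (hu.inv h0)
  let f : ℤ → ℂ := fun k => if k = 0 then c else w.coeff (k - 1) / k
  have hf : ∀ k < 0, f k = 0 := fun k hk => by
    simp only [f, if_neg hk.ne, hw (k - 1) (by omega), zero_div]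
  let l : LaurentSeries ℂ := HahnSeries.ofSuppBddBelow f ⟨0, fun k hk => by
    by_contra! h
    exact hk (hf k h)⟩
  have hl : ∀ k, l.coeff k = f k := fun _ => rfl
  have hl0 : l.coeff 0 = c := by rw [hl]; exact if_pos rfl
  have hd : dz l = w := by
    ext k
    rw [coeff_dz, hl]
    rcases eq_or_ne (k + 1) 0 with h | h
    · have h' : (k : ℂ) + 1 = 0 := by exact_mod_cast h
      rw [h', zero_mul, hw k (by omega)]
    · have h' : (k : ℂ) + 1 ≠ 0 := by exact_mod_cast h
      simp only [f, if_neg h, add_sub_cancel_right]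
      push_cast
      field_simp
  refine ⟨l, ⟨fun k hk => by rw [hl, hf k hk], ?_, by rw [hl0, hc]⟩, hl0⟩
  change dz l * u = dz u
  rw [hd]
  exact inv_mul_cancel_right₀ (ne_zero_of_coeff h0) _

lemma PowerSeries.exists_pow_eq {d : ℕ} (hd : d ≠ 0) {f : PowerSeries ℂ}
    (hf : PowerSeries.constantCoeff f = 1) : ∃ g : PowerSeries ℂ, g ^ d = f := by
  have hpow : ∀ k : ℕ, PowerSeries.binomialSeries ℂ (1 / d : ℂ) ^ k =
      PowerSeries.binomialSeries ℂ (k * (1 / d) : ℂ) := fun k => by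
    induction k with
    | zero => simp
    | succ k ih =>
      rw [pow_succ, ih, ← PowerSeries.binomialSeries_add]
      push_cast
      ring_nf
  have h1 : PowerSeries.binomialSeries ℂ (1 / d : ℂ) ^ d = 1 + PowerSeries.X := by
    rw [hpow, mul_one_div_cancel (Nat.cast_ne_zero.2 hd), ← Nat.cast_one,
      PowerSeries.binomialSeries_nat, pow_one]
  have hs : PowerSeries.HasSubst (f - 1) :=
    PowerSeries.HasSubst.of_constantCoeff_zero' (by rw [map_sub, hf, map_one, sub_self])
  refine ⟨PowerSeries.substAlgHom (R := ℂ) hs (PowerSeries.binomialSeries ℂ (1 / d : ℂ)), ?_⟩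
  rw [← map_pow, h1, map_add, map_one, PowerSeries.substAlgHom_X]
  ring

lemma exists_root {d : ℕ} (hd : 1 ≤ d) {u : LaurentSeries ℂ} (hu : OrdGE u (-d))
    (h0 : u.coeff (-d) ≠ 0) {r : ℂ} (hr : r ^ d = u.coeff (-d)) :
    ∃ R : LaurentSeries ℂ, R ^ d = u ∧ R.coeff (-1) = r := by
  have hord := order_eq hu h0
  have hd0 : d ≠ 0 := by omega
  obtain ⟨g, hg⟩ := PowerSeries.exists_pow_eq hd0
    (f := PowerSeries.C (u.coeff (-d))⁻¹ * u.powerSeriesPart) (by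
      rw [map_mul, PowerSeries.constantCoeff_C, ← PowerSeries.coeff_zero_eq_constantCoeff_apply,
        LaurentSeries.powerSeriesPart_coeff, hord, Nat.cast_zero, add_zero, inv_mul_cancel₀ h0])
  let G : LaurentSeries ℂ := HahnSeries.single (-1) 1 * HahnSeries.ofPowerSeries ℤ ℂ g
  have hG : G ^ d = HahnSeries.C (u.coeff (-d))⁻¹ * u := by
    rw [mul_pow, HahnSeries.single_pow, ← map_pow (HahnSeries.ofPowerSeries ℤ ℂ), hg, map_mul,
      LaurentSeries.ofPowerSeries_powerSeriesPart, HahnSeries.ofPowerSeries_C, hord, mul_left_comm,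
      ← mul_assoc (HahnSeries.single (d • (-1 : ℤ)) _), HahnSeries.single_mul_single]
    simp
  have hG1 : OrdGE (HahnSeries.C (u.coeff (-d))⁻¹ * u) (-d) := by
    simpa using (ordGE_C _).mul hu
  have hG2 : (HahnSeries.C (u.coeff (-d))⁻¹ * u).coeff (-d) = 1 := by
    rw [HahnSeries.C_apply, HahnSeries.coeff_single_zero_mul, inv_mul_cancel₀ h0]
  have hGo := order_of_pow_eq hd hG hG1 (by rw [hG2]; exact one_ne_zero)
  have hlead : G.coeff (-1) ^ d = 1 := by
    have h := (pow_lead (hGo ▸ ordGE_order G) d).2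
    rw [mul_neg_one] at h
    rw [← h, hG, hG2]
  have hl0 : G.coeff (-1) ≠ 0 := by
    intro h
    rw [h, zero_pow hd0] at hlead
    exact zero_ne_one hlead
  refine ⟨HahnSeries.C (r / G.coeff (-1)) * G, ?_, ?_⟩
  · rw [mul_pow, ← map_pow, div_pow, hlead, hr, hG, ← mul_assoc, ← map_mul, div_one,
      mul_inv_cancel₀ h0, map_one, one_mul]
  · rw [HahnSeries.C_apply, HahnSeries.coeff_single_zero_mul, div_mul_cancel₀ _ hl0]

/-! ### Local branches -/

section Branch

variable {E : Type*} [TopologicalSpace E] {M : Set E} {x₀ : E}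

lemma eventually_exists_log {c : E → ℂ} (hM : M ∈ 𝓝 x₀) (hc : ContinuousOn c M)
    (h0 : ∀ x ∈ M, c x ≠ 0) : ∀ᶠ U in (𝓝 x₀).smallSets, ∃ l : E → ℂ, ContinuousOn l U ∧
      ∀ x ∈ U, Complex.exp (l x) = c x := by
  have hx₀ := mem_of_mem_nhds hM
  have hcont : ContinuousAt (fun x => c x / c x₀) x₀ := (hc.continuousAt hM).div_const _
  have h1 : ∀ᶠ x in 𝓝 x₀, c x / c x₀ ∈ Complex.slitPlane :=
    hcont.eventually (Complex.isOpen_slitPlane.mem_nhds (by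
      simp only [div_self (h0 x₀ hx₀)]; exact Complex.one_mem_slitPlane))
  rw [eventually_smallSets]
  refine ⟨_, inter_mem hM h1, fun U hU => ⟨fun x => Complex.log (c x / c x₀) + Complex.log (c x₀),
    ?_, fun x hx => ?_⟩⟩
  · refine ContinuousOn.add (ContinuousOn.clog ?_ fun x hx => (hU hx).2) continuousOn_const
    exact (hc.mono fun x hx => (hU hx).1).div_const _
  · rw [Complex.exp_add, Complex.exp_log, Complex.exp_log (h0 x₀ hx₀), div_mul_cancel₀ _ (h0 x₀ hx₀)]
    exact div_ne_zero (h0 x (hU hx).1) (h0 x₀ hx₀)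

lemma eventually_exists_isLog {u : E → LaurentSeries ℂ} (hM : M ∈ 𝓝 x₀)
    (hu : ∀ x ∈ M, OrdGE (u x) 0) (h0 : ∀ x ∈ M, (u x).coeff 0 ≠ 0)
    (hc : ContinuousOn (fun x => (u x).coeff 0) M) : ∀ᶠ U in (𝓝 x₀).smallSets,
      ∃ l : E → LaurentSeries ℂ, (∀ x ∈ U, IsLog (u x) (l x)) ∧
        ContinuousOn (fun x => (l x).coeff 0) U := by
  filter_upwards [eventually_exists_log hM hc h0, eventually_smallSets.2 ⟨M, hM, fun _ h => h⟩]
    with U ⟨c, hcU, hcx⟩ hUM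
  choose! l hl using fun x (hx : x ∈ U) => exists_isLog (hu x (hUM hx)) (h0 x (hUM hx)) (hcx x hx)
  exact ⟨l, fun x hx => (hl x hx).1, hcU.congr fun x hx => (hl x hx).2⟩

lemma eventually_exists_root {u : E → LaurentSeries ℂ} {d : ℕ} (hd : 1 ≤ d) (hM : M ∈ 𝓝 x₀)
    (hu : ∀ x ∈ M, OrdGE (u x) (-d)) (h0 : ∀ x ∈ M, (u x).coeff (-d) ≠ 0)
    (hc : ContinuousOn (fun x => (u x).coeff (-d)) M) : ∀ᶠ U in (𝓝 x₀).smallSets,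
      ∃ R : E → LaurentSeries ℂ, (∀ x ∈ U, R x ^ d = u x) ∧
        ContinuousOn (fun x => (R x).coeff (-1)) U := by
  have hd0 : (d : ℂ) ≠ 0 := Nat.cast_ne_zero.2 (by omega)
  filter_upwards [eventually_exists_log hM hc h0, eventually_smallSets.2 ⟨M, hM, fun _ h => h⟩]
    with U ⟨c, hcU, hcx⟩ hUM
  have hr : ∀ x ∈ U, Complex.exp (c x / d) ^ d = (u x).coeff (-d) := fun x hx => by
    rw [← Complex.exp_nat_mul, mul_div_cancel₀ _ hd0, hcx x hx]
  choose! R hR using fun x (hx : x ∈ U) => exists_root hd (hu x (hUM hx)) (h0 x (hUM hx)) (hr x hx)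
  exact ⟨R, fun x hx => (hR x hx).1,
    (Complex.continuous_exp.comp_continuousOn (hcU.div_const _)).congr fun x hx => (hR x hx).2⟩

end Branch

/-! ### Leading coefficient at infinity -/

/-- The leading term is `z ^ e` with coefficient `1`. -/
def LeadOne (f : LaurentSeries ℂ) (e : ℤ) : Prop := OrdGE f e ∧ f.coeff e = 1

section LeadOne

variable {f g : LaurentSeries ℂ} {e e' : ℤ}

lemma leadOne_one : LeadOne 1 0 := ⟨ordGE_one, by simp⟩

lemma LeadOne.mul (h : LeadOne f e) (h' : LeadOne g e') : LeadOne (f * g) (e + e') :=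
  ⟨h.1.mul h'.1, by rw [coeff_mul_lead h.1 h'.1, h.2, h'.2, one_mul]⟩

lemma LeadOne.inv (h : LeadOne f e) : LeadOne f⁻¹ (-e) := by
  have h0 : f.coeff e ≠ 0 := by rw [h.2]; exact one_ne_zero
  exact ⟨h.1.inv h0, by rw [coeff_inv_lead h.1 h0, h.2, inv_one]⟩

lemma LeadOne.pow (h : LeadOne f e) (k : ℕ) : LeadOne (f ^ k) (k * e) :=
  ⟨(pow_lead h.1 k).1, by rw [(pow_lead h.1 k).2, h.2, one_pow]⟩

lemma LeadOne.zpow (h : LeadOne f e) (k : ℤ) : LeadOne (f ^ k) (k * e) := by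
  obtain ⟨j, rfl | rfl⟩ := k.eq_nat_or_neg
  · rw [zpow_natCast]; exact h.pow j
  · rw [zpow_neg, zpow_natCast, neg_mul]; exact (h.pow j).inv

lemma LeadOne.prod {ι : Type*} (t : Finset ι) {F : ι → LaurentSeries ℂ} {e : ι → ℤ}
    (h : ∀ i ∈ t, LeadOne (F i) (e i)) : LeadOne (∏ i ∈ t, F i) (∑ i ∈ t, e i) := by
  classical
  induction t using Finset.induction_on with
  | empty => simpa using leadOne_one
  | insert i t hi ih =>
    rw [Finset.prod_insert hi, Finset.sum_insert hi]
    exact (h i (Finset.mem_insert_self _ _)).mul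
      (ih fun j hj => h j (Finset.mem_insert_of_mem hj))

lemma leadOne_X_sub_C (b : ℂ) : LeadOne (Place.inf.expand (RatFunc.X - RatFunc.C b)) (-1) :=
  ⟨Place.ordGE_X_sub_C_inf b, by
    rw [Place.expand_X_sub_C_inf, HahnSeries.coeff_sub, HahnSeries.C_apply,
      HahnSeries.coeff_single_same, HahnSeries.coeff_single_of_ne (by norm_num), sub_zero]⟩

end LeadOne

namespace Shape

variable {D : Shape} {x : D.Param}

lemma leadOne_lam (x : D.Param) : LeadOne (Place.inf.expand (lam x)) (-D.n) := by
  have h1 := LeadOne.prod Finset.univ fun i _ => leadOne_X_sub_C (a x i)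
  have h2 := LeadOne.prod Finset.univ fun q _ => (leadOne_X_sub_C (pos x q)).zpow (-deg q)
  have h3 := h1.mul h2
  simp only [← Place.expand_zpow] at h3
  rw [← Place.expand_prod, ← Place.expand_prod, ← Place.expand_mul, ← lam_eq] at h3
  convert h3 using 1
  have := sum_deg (D := D)
  simp only [mul_neg, mul_one, neg_neg, this, Finset.sum_neg_distrib, Finset.sum_const,
    Finset.card_univ, Fintype.card_fin, nsmul_eq_mul]
  ring

/-! ### Existence of branches -/

lemma isOpen_M : IsOpen D.M := by
  have ha : ∀ i, Continuous fun x : D.Param => a x i := fun i => (aL i).continuous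
  have hv : ∀ j, Continuous fun x : D.Param => v x j := fun j =>
    (continuous_apply j).comp (continuous_snd.comp continuous_subtype_val)
  have h : D.M = {x | (∀ i i', i ≠ i' → a x i ≠ a x i') ∧ (∀ j j', j ≠ j' → v x j ≠ v x j') ∧
      (∀ i j, a x i ≠ v x j) ∧ (D.s = 1 → (∀ i, a x i ≠ 0) ∧ ∀ j, v x j ≠ 0)} := by
    ext x
    simp only [M, Function.Injective, Set.mem_ofPred_eq, ne_eq, not_imp_not]
  rw [h, isOpen_iff_mem_nhds]
  rintro x ⟨h1, h2, h3, h4⟩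
  have hne : ∀ {f g : D.Param → ℂ}, Continuous f → Continuous g → f x ≠ g x →
      ∀ᶠ y in 𝓝 x, f y ≠ g y := fun hf hg h => (isOpen_ne_fun hf hg).mem_nhds h
  refine Filter.inter_mem ?_ (Filter.inter_mem ?_ (Filter.inter_mem ?_ ?_))
  · exact eventually_all.2 fun i => eventually_all.2 fun i' => eventually_imp_distrib_left.2 fun hi =>
      hne (ha i) (ha i') (h1 i i' hi)
  · exact eventually_all.2 fun j => eventually_all.2 fun j' => eventually_imp_distrib_left.2 fun hj =>
      hne (hv j) (hv j') (h2 j j' hj)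
  · exact eventually_all.2 fun i => eventually_all.2 fun j => hne (ha i) (hv j) (h3 i j)
  · exact eventually_imp_distrib_left.2 fun hs =>
      (eventually_all.2 fun i => hne (ha i) continuous_const ((h4 hs).1 i)).and
        (eventually_all.2 fun j => hne (hv j) continuous_const ((h4 hs).2 j))

lemma continuousOn_coeff {u : D.Param → LaurentSeries ℂ} (h : ∀ x ∈ D.M, LAn u x) (k : ℤ) :
    ContinuousOn (fun x => (u x).coeff k) D.M := fun x hx =>
  ((h x hx).an k).continuousAt.continuousWithinAt

lemma eventually_exists_isLog_expand (hx : x ∈ D.M) (ν : D.Marked) {f : D.Param → RatFunc ℂ}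
    (han : ∀ x ∈ D.M, LAn (fun y => (place y ν).expand (f y)) x)
    (ho : ∀ x ∈ D.M, LOrd (fun y => (place y ν).expand (f y)) x 0) :
    ∀ᶠ U in (𝓝 x).smallSets, ∃ l : D.Param → LaurentSeries ℂ,
      (∀ y ∈ U, IsLog ((place y ν).expand (f y)) (l y)) ∧
        ContinuousOn (fun y => (l y).coeff 0) U :=
  eventually_exists_isLog (isOpen_M.mem_nhds hx) (fun y hy => (ho y hy).1.self_of_nhds)
    (fun y hy => (ho y hy).2) (continuousOn_coeff han 0)

lemma exists_branches (hx : x ∈ D.M) :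
    ∃ U : Set D.Param, IsOpen U ∧ x ∈ U ∧ U ⊆ D.M ∧ Nonempty (D.Branches U) := by
  have hM := isOpen_M.mem_nhds hx
  have hroot : ∀ᶠ U in (𝓝 x).smallSets, ∀ q : D.FinPole, ∃ R : D.Param → LaurentSeries ℂ,
      1 ≤ deg q → (∀ y ∈ U, R y ^ deg q = (place y (some q)).expand (lam y)) ∧
        ContinuousOn (fun y => (R y).coeff (-1)) U := by
    refine eventually_all.2 fun q => ?_
    by_cases hq : 1 ≤ deg q
    · obtain ⟨d, hd⟩ := Int.eq_ofNat_of_zero_le (a := deg q) (by omega)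
      have ho : ∀ y ∈ D.M, LOrd (fun y => (place y (some q)).expand (lam y)) y (-d) :=
        fun y hy => hd ▸ lOrd_lam_pos subset_rfl (isOpen_M.mem_nhds hy) q
      filter_upwards [eventually_exists_root (d := d) (by omega) hM
        (fun y hy => (ho y hy).1.self_of_nhds) (fun y hy => (ho y hy).2)
        (continuousOn_coeff (fun y hy => (logPD_lam (ξ := 0) hy (some q)).an) _)] with U ⟨R, h1, h2⟩
      exact ⟨R, fun _ => ⟨fun y hy => by rw [hd, zpow_natCast, h1 y hy], h2⟩⟩
    · exact Eventually.of_forall fun U => ⟨0, fun h => absurd h hq⟩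
  have hfin : ∀ᶠ U in (𝓝 x).smallSets, ∀ q : D.FinPole, ∃ l : D.Param → LaurentSeries ℂ,
      (∀ y ∈ U, IsLog ((place y (some q)).expand
        ((RatFunc.X - RatFunc.C (pos y q)) ^ deg q * lam y)) (l y)) ∧
        ContinuousOn (fun y => (l y).coeff 0) U :=
    eventually_all.2 fun q => eventually_exists_isLog_expand hx (some q)
      (fun y hy => (logPD_zpow_mul_lam hy (some q) q (deg q) 0).an)
      fun y hy => lOrd_mul_zpow_pos isOpen_M subset_rfl hy q
  have hinf : ∀ᶠ U in (𝓝 x).smallSets, ∀ q : D.FinPole, ∃ l : D.Param → LaurentSeries ℂ,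
      (∀ y ∈ U, IsLog ((place y none).expand
        ((RatFunc.X - RatFunc.C (pos y q)) ^ (-(D.n : ℤ)) * lam y)) (l y)) ∧
        ContinuousOn (fun y => (l y).coeff 0) U :=
    eventually_all.2 fun q => eventually_exists_isLog_expand hx none
      (fun y hy => (logPD_zpow_mul_lam hy none q (-(D.n : ℤ)) 0).an)
      fun y _ => lOrd_mul_zpow_inf q
  have hsep : ∀ᶠ U in (𝓝 x).smallSets, ∀ q q' : D.FinPole, ∃ l : D.Param → LaurentSeries ℂ,
      q' ≠ q → (∀ y ∈ U, IsLog ((place y (some q')).expand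
        (RatFunc.X - RatFunc.C (pos y q))) (l y)) ∧
        ContinuousOn (fun y => (l y).coeff 0) U := by
    refine eventually_all.2 fun q => eventually_all.2 fun q' => ?_
    by_cases hq : q' = q
    · exact Eventually.of_forall fun U => ⟨0, fun h => absurd hq h⟩
    · filter_upwards [eventually_exists_isLog_expand hx (some q')
        (fun y hy => (logPD_pos (ξ := 0) hy (some q') q).an) fun y hy => lOrd_sep hy hq]
        with U ⟨l, hl⟩ using ⟨l, fun _ => hl⟩
  obtain ⟨V, hV, h⟩ := eventually_smallSets.1 (hroot.and (hfin.and (hinf.and hsep)))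
  obtain ⟨U, hUV, hU, hxU⟩ := mem_nhds_iff.1 (inter_mem hV hM)
  obtain ⟨h1, h2, h3, h4⟩ := h U fun y hy => (hUV hy).1
  choose R hR using h1
  choose lf hlf using h2
  choose li hli using h3
  choose ls hls using h4
  choose S hS using fun y : D.Param => exists_root (u := Place.inf.expand (lam y)) D.n_pos
    (leadOne_lam y).1 (by rw [(leadOne_lam y).2]; exact one_ne_zero) (r := 1)
    (by rw [(leadOne_lam y).2, one_pow])
  exact ⟨U, hU, hxU, fun y hy => (hUV hy).2, ⟨{
    rootInf := S
    rootInf_pow := fun y _ => (hS y).1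
    rootInf_lead := fun y _ => (hS y).2
    root := R
    root_pow := fun q hq => (hR q hq).1
    root_cont := fun q hq => (hR q hq).2
    logFin := lf
    logFin_isLog := fun q _ => (hlf q).1
    logFin_cont := fun q _ => (hlf q).2
    logInf := li
    logInf_isLog := fun q _ => (hli q).1
    logInf_cont := fun q _ => (hli q).2
    logSep := ls
    logSep_isLog := fun q q' _ h => (hls q q' h).1
    logSep_cont := fun q q' _ h => (hls q q' h).2 }⟩⟩

end Shape
end FlatCoord
end

theorem mainTheorem7 (D : FlatCoord.Shape) :
    (∀ x ∈ D.M, ∃ U : Set D.Param, IsOpen U ∧ x ∈ U ∧ U ⊆ D.M ∧ Nonempty (D.Branches U)) ∧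
    ∀ U : Set D.Param, IsOpen U → U ⊆ D.M → ∀ B : D.Branches U,
      (∀ ν : D.Marked, D.CometricWellDefined ν U ∧
        FlatCoord.IsFlatCoordinates U (FlatCoord.Shape.cometric ν) (FlatCoord.Shape.coord B)) ∧
      (∀ x ∈ U, ∀ b : D.Index,
        FlatCoord.Shape.diffRep B x b ∈
            FlatCoord.Shape.cotangentRep x (FlatCoord.Shape.indexPole b) ∧
          FlatCoord.Shape.Represents (FlatCoord.Shape.indexPole b) x
            (FlatCoord.Shape.diffRep B x b) (fderiv ℂ (FlatCoord.Shape.coord B b) x)) :=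
  ⟨fun _ hx => FlatCoord.Shape.exists_branches hx, fun _ hU hUM B =>
    ⟨fun ν => ⟨FlatCoord.Shape.cometricWellDefined hUM ν,
      FlatCoord.Shape.isFlatCoordinates_coord hU hUM B ν⟩,
    fun _ hx b => ⟨FlatCoord.Shape.diffRep_mem hUM B hx b,
      (FlatCoord.Shape.coord_spec hU hUM B hx b).2⟩⟩⟩
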